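/- All graphs are finite, simple and connected. Let $G$ be a cactus graph (its cycles are pairwise edge-disjoint). **Definitions.** For a vertex $u$ and an edge $e=vw$ put $d(u,e)=\min\{d(u,v),d(u,w)\}$; $\mathrm{edim}(G)$ is the least size of a set $S\subseteq V(G)$ such that any two distinct edges $e,e'$ satisfy $d(s,e)\neq d(s,e')$ for some $s\in S$. A *thread* hanging at a vertex $v$ of degree at least $3$ is a path $u_1\ldots u_m$ where $u_1$ is a leaf, $u_2,\ldots,u_m$ have degree $2$ and $u_m$ is adjacent to $v$; its length is $m$. Let $\ell(v)$ be the number of threads hanging at $v$ and $L(G)=\sum_{\ell(v)>1}(\ell(v)-1)$. For a cycle $C$ and $v\in V(C)$ let $G_v(C)$ be the component of $G-E(C)$ containing $v$. The vertex $v$ is *branch-active* on $C$ if $\deg(v)\ge4$ or $G_v(C)$ contains a vertex of degree at least $3$ other than $v$. An *end-cycle* is a cycle with exactly one branch-active vertex. Let $S\subseteq V(G)$. A vertex $v\in V(C)$ is *$S$-active* on $C$ if $G_v(C)$ contains a vertex of $S$; $a_S(C)$ is the number of $S$-active vertices on $C$. A thread is *$S$-free* if it contains no vertex of $S$. $S$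 is a *BBR set* if $a_S(C)\ge2$ for every cycle $C$ and no two distinct $S$-free threads hang at the same vertex. A *smallest* BBR set is one of least cardinality. Given a BBR set $S$ and a cycle $C$ of length $g$, label $V(C)=\{v_0,\ldots,v_{g-1}\}$ in cyclic order so that $v_0$ is $S$-active and $k=\max\{i:v_i\text{ is }S\text{-active}\}$ is as small as possible; $v_0v_1\cdots v_k$, of length $k$, is the *$S$-path* of $C$. With respect to $S$ the cycle $C$ contains configuration * $\mathcal A$ if $a_S(C)=2$, $g$ is even and $k=g/2$; * $\mathcal D$ if $k\le\lceil g/2\rceil-1$ and an $S$-free thread hangs at some $v_i$ with $i\in[k,\lceil g/2\rceil-1]\cup[\lfloor g/2\rfloor+k+1,g-1]\cup\{0\}$; * $\mathcal E$ if $a_S(C)=2$ and an $S$-free thread of length at least $\lfloor g/2\rfloor-k+1$ hangs at some $v_i$ with $i\in[0,k]$ and, in case $g$ is even, an $S$-free thread also hangs at $v_j$ with $j=g/2+k-i$ (index modulo $g$). A cycle $C$ is *$\mathcal{ADE}$-negative* if for some smallest BBR set $S$ it contains none of $\mathcal A,\mathcal D,\mathcal E$ with respect to $S$, and *$\mathcal{ADE}$-positive*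 otherwise. A vertex of $C$ is *edge-critical* on $C$ with respect to $S$ if it is an end-vertex of the $S$-path of $C$ and $k\le\lceil g/2\rceil-1$. Two distinct cycles are *edge-critically incident* with respect to $S$ if they share a vertex that is edge-critical on both. A set $S$ is *nice* if it is a smallest BBR set with respect to which no $\mathcal{ADE}$-negative cycle contains any of $\mathcal A,\mathcal D,\mathcal E$ and if, among all such sets, the number of pairs of edge-critically incident cycles with respect to $S$ is the smallest possible. **Proposition.** Let $G$ be a cactus graph with $c\ge2$ cycles. Then nice sets exist in $G$, and for every nice set $S$ we have $\mathrm{edim}(G)=L(G)+2c-1$ if and only if one of the following holds: 1. every cycle in $G$ is an end-cycle, at most $c-1$ cycles are $\mathcal{ADE}$-positive, and all remaining (that is, $\mathcal{ADE}$-negative) cycles are pairwise edge-critically incident with respect to $S$; 2. precisely $c-1$ cycles in $G$ are end-cycles, and every cycle in $G$ is $\mathcal{ADE}$-positive. -/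

import Mathlib

namespace SimpleGraph

variable {V : Type*} (G : SimpleGraph V)

/-! ### Edge metric dimension -/

/-- The distance `d(u, e) = min {d(u, v), d(u, w)}` of a vertex `u` and an edge `e = vw`. -/
noncomputable def vertexEdgeDist (u : V) (e : Sym2 V) : ℕ :=
  Sym2.lift ⟨fun v w => min (G.dist u v) (G.dist u w), fun _ _ => min_comm _ _⟩ e

/-- Every two distinct edges are distinguished by some vertex of `S`. -/
def IsEdgeMetricGenerator (S : Finset V) : Prop :=
  ∀ e ∈ G.edgeSet, ∀ e' ∈ G.edgeSet, e ≠ e' →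
    ∃ s ∈ S, G.vertexEdgeDist s e ≠ G.vertexEdgeDist s e'

/-- The cardinality of a smallest edge metric generator. -/
noncomputable def edgeMetricDim : ℕ :=
  sInf {n | ∃ S : Finset V, G.IsEdgeMetricGenerator S ∧ S.card = n}

/-! ### Cycles and cacti -/

/-- The cycles of `G`, as subgraphs. -/
def cycleSubgraphs : Set G.Subgraph :=
  {C | ∃ (v : V) (w : G.Walk v v), w.IsCycle ∧ w.toSubgraph = C}

/-- A cactus: a connected graph whose cycles are pairwise edge disjoint. -/
def IsCactus : Prop :=
  G.Connected ∧ G.cycleSubgraphs.Pairwise fun C C' => Disjoint C.edgeSet C'.edgeSet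

/-- The vertex set of `G_v(C)`, the connected component of `G - E(C)` that contains `v`. -/
def hangingPart (C : G.Subgraph) (v : V) : Set V :=
  {x | (G.deleteEdges C.edgeSet).Reachable v x}

section Threads

variable [Fintype V] [DecidableRel G.Adj]

/-- The list `P = [u₁, …, u_k]` is a thread hanging at `v`: a path that starts in a leaf `u₁`,
whose other vertices have degree two in `G`, and whose last vertex `u_k` is adjacent to the
vertex `v` of degree at least three. (Such a path is automatically an induced one.)
The length of the thread is `k = P.length`, the distance from `v` to the leaf. -/
def IsThread (v : V) (P : List V) : Prop :=
  3 ≤ G.degree v ∧ P.Nodup ∧ P.IsChain G.Adj ∧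
    (∃ u ∈ P.head?, G.degree u = 1) ∧ (∀ x ∈ P.tail, G.degree x = 2) ∧
    (∃ u ∈ P.getLast?, G.Adj u v)

/-- `ℓ(v)`, the number of threads hanging at `v`. -/
noncomputable def numThreads (v : V) : ℕ := {P : List V | G.IsThread v P}.ncard

/-- `L(G) = ∑_{ℓ(v) > 1} (ℓ(v) - 1)`. -/
noncomputable def threadExcess : ℕ :=
  ∑ v with 1 < G.numThreads v, (G.numThreads v - 1)

/-! ### Branch-active vertices and end-cycles -/

/-- The vertex `v` of the cycle `C` is branch-active on `C`. -/
def IsBranchActive (C : G.Subgraph) (v : V) : Prop :=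
  v ∈ C.verts ∧ (4 ≤ G.degree v ∨ ∃ x ∈ G.hangingPart C v, x ≠ v ∧ 3 ≤ G.degree x)

/-- An end-cycle has exactly one branch-active vertex. -/
def IsEndCycle (C : G.Subgraph) : Prop :=
  C ∈ G.cycleSubgraphs ∧ {v | G.IsBranchActive C v}.ncard = 1

end Threads

/-! ### Biactive branch-resolving sets -/

/-- The vertex `v` of the cycle `C` is `S`-active on `C`. -/
def IsSActive (S : Finset V) (C : G.Subgraph) (v : V) : Prop :=
  v ∈ C.verts ∧ ∃ s ∈ S, s ∈ G.hangingPart C v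

/-- `a_S(C)`, the number of `S`-active vertices on `C`. -/
noncomputable def numSActive (S : Finset V) (C : G.Subgraph) : ℕ :=
  {v | G.IsSActive S C v}.ncard

/-- Every cycle has at least two `S`-active vertices. -/
def IsBiactive (S : Finset V) : Prop :=
  ∀ C ∈ G.cycleSubgraphs, 2 ≤ G.numSActive S C

section BBR

variable [Fintype V] [DecidableRel G.Adj]

/-- `P` is an `S`-free thread hanging at `v`. -/
def IsFreeThread (S : Finset V) (v : V) (P : List V) : Prop :=
  G.IsThread v P ∧ ∀ x ∈ P, x ∉ S

/-- No two `S`-free threads hang at the same vertex. -/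
def IsBranchResolving (S : Finset V) : Prop :=
  ∀ v P Q, G.IsFreeThread S v P → G.IsFreeThread S v Q → P = Q

/-- Biactive branch-resolving (BBR) sets. -/
def IsBBR (S : Finset V) : Prop := G.IsBiactive S ∧ G.IsBranchResolving S

/-- BBR sets of smallest cardinality. -/
def IsSmallestBBR (S : Finset V) : Prop :=
  G.IsBBR S ∧ ∀ T : Finset V, G.IsBBR T → S.card ≤ T.card

end BBR

/-! ### Labellings of a cycle and `S`-paths

A labelling `v₀, v₁, …, v_{g-1}` of the cycle `C` in cyclic order is a closed walk `w` that runs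
once through `C`: here `g = w.length` and `v_i = w.getVert i`. -/

/-- `w` labels the cycle `C`, the vertex `v₀` is `S`-active on `C`, and
`k = max {i | v_i is S-active}`. -/
def IsActiveLabelling (S : Finset V) (C : G.Subgraph) {v : V} (w : G.Walk v v) (k : ℕ) : Prop :=
  w.IsCycle ∧ w.toSubgraph = C ∧ G.IsSActive S C v ∧
    IsGreatest {i | i < w.length ∧ G.IsSActive S C (w.getVert i)} k

/-- An active labelling of `C` for which `k` is smallest possible. Its initial part
`v₀ v₁ ⋯ v_k` is the `S`-path of `C`, which has length `k`. -/
def IsSPathLabelling (S : Finset V) (C : G.Subgraph) {v : V} (w : G.Walk v v) (k : ℕ) : Prop :=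
  G.IsActiveLabelling S C w k ∧
    ∀ (v' : V) (w' : G.Walk v' v') (k' : ℕ), G.IsActiveLabelling S C w' k' → k ≤ k'

/-! ### The configurations `A`, `D`, `E`

The floor and the ceiling of `g / 2` are `g / 2` and `(g + 1) / 2` in `ℕ`. -/

/-- Configuration `A`. -/
def ConfigA (S : Finset V) (C : G.Subgraph) {v : V} (w : G.Walk v v) (k : ℕ) : Prop :=
  G.numSActive S C = 2 ∧ Even w.length ∧ k = w.length / 2

section Configurations

variable [Fintype V] [DecidableRel G.Adj]

/-- Configuration `D`. -/
def ConfigD (S : Finset V) {v : V} (w : G.Walk v v) (k : ℕ) : Prop :=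
  k ≤ (w.length + 1) / 2 - 1 ∧
    ∃ i P, G.IsFreeThread S (w.getVert i) P ∧
      (i ∈ Set.Icc k ((w.length + 1) / 2 - 1) ∨
        i ∈ Set.Icc (w.length / 2 + k + 1) (w.length - 1) ∨ i = 0)

/-- Configuration `E`. The thread has length at least `⌊g/2⌋ - k + 1`; the index
`j = g/2 + k - i` is read modulo `g`. -/
def ConfigE (S : Finset V) (C : G.Subgraph) {v : V} (w : G.Walk v v) (k : ℕ) : Prop :=
  G.numSActive S C = 2 ∧
    ∃ i ≤ k, (∃ P, G.IsFreeThread S (w.getVert i) P ∧ w.length / 2 + 1 ≤ P.length + k) ∧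
      (Even w.length →
        ∃ Q, G.IsFreeThread S (w.getVert ((w.length / 2 + (k - i)) % w.length)) Q)

/-- The cycle `C` contains one of the configurations `A`, `D`, `E` with respect to `S`. -/
def ContainsADE (S : Finset V) (C : G.Subgraph) : Prop :=
  ∃ (v : V) (w : G.Walk v v) (k : ℕ), G.IsSPathLabelling S C w k ∧
    (G.ConfigA S C w k ∨ G.ConfigD S w k ∨ G.ConfigE S C w k)

/-- `C` is ADE-negative: for some smallest BBR set `S` it contains none of the configurations. -/
def IsADENegative (C : G.Subgraph) : Prop :=
  C ∈ G.cycleSubgraphs ∧ ∃ S, G.IsSmallestBBR S ∧ ¬ G.ContainsADE S C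

/-- A cycle is ADE-positive if it is not ADE-negative. -/
def IsADEPositive (C : G.Subgraph) : Prop :=
  C ∈ G.cycleSubgraphs ∧ ¬ G.IsADENegative C

end Configurations

/-! ### Edge-critical incidence -/

/-- The vertex `x` is edge-critical on `C` with respect to `S`: it is an end-vertex of the
`S`-path, and the length of the `S`-path is at most `⌈g/2⌉ - 1`. -/
def IsEdgeCritical (S : Finset V) (C : G.Subgraph) (x : V) : Prop :=
  ∃ (v : V) (w : G.Walk v v) (k : ℕ), G.IsSPathLabelling S C w k ∧
    (x = w.getVert 0 ∨ x = w.getVert k) ∧ k ≤ (w.length + 1) / 2 - 1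

/-- The graph on the subgraphs of `G` whose edges are the pairs of distinct cycles of `G` that
are edge-critically incident with respect to `S`, that is, which share a vertex that is
edge-critical on both of them. -/
def edgeCriticalIncidence (S : Finset V) : SimpleGraph G.Subgraph where
  Adj C C' := C ≠ C' ∧ C ∈ G.cycleSubgraphs ∧ C' ∈ G.cycleSubgraphs ∧
    ∃ x, x ∈ C.verts ∧ x ∈ C'.verts ∧ G.IsEdgeCritical S C x ∧ G.IsEdgeCritical S C' x
  symm := ⟨fun _ _ ⟨h, hC, hC', x, h1, h2, h3, h4⟩ => ⟨h.symm, hC', hC, x, h2, h1, h4, h3⟩⟩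
  loopless := ⟨fun _ h => h.1 rfl⟩

section Nice

variable [Fintype V] [DecidableRel G.Adj]

/-- A smallest BBR set with respect to which no ADE-negative cycle contains one of the
configurations `A`, `D`, `E`. -/
def IsADEAvoiding (S : Finset V) : Prop :=
  G.IsSmallestBBR S ∧ ∀ C, G.IsADENegative C → ¬ G.ContainsADE S C

/-- Nice sets: among the smallest BBR sets with respect to which no ADE-negative cycle contains
one of the configurations, those with the smallest number of pairs of edge-critically incident
cycles. -/
def IsNiceBBR (S : Finset V) : Prop :=
  G.IsADEAvoiding S ∧ ∀ T, G.IsADEAvoiding T →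
    (G.edgeCriticalIncidence S).edgeSet.ncard ≤ (G.edgeCriticalIncidence T).edgeSet.ncard

end Nice

end SimpleGraph

set_option linter.unusedSectionVars false

namespace SimpleGraph

/-! ### Distances through cut vertices -/

section Separation

variable {V : Type*} {G : SimpleGraph V}

/-! A set `T` is an edge metric generator exactly when it is a BBR set, no cycle contains A, D or E
with respect to `T`, and no two cycles are edge-critically incident. Each violation exhibits two
edges with the same distances to all of `T` (`IsEdgeMetricGenerator.isBBR`, `not_containsADE`,
`not_incident`). Conversely, with respect to a BBR set every edge is of one of four kinds
(`IsBBR.edgeKind`): a bridge with vertices of the set on both sides, an edge of a free tail at an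
anchor, an edge of a cycle, or an edge of a free thread at an inactive vertex of a cycle. Distances
between parts that hang at different vertices of a cycle run through these vertices
(`Gates.dist_eq`), and so two undistinguished edges produce a configuration or an incident pair
(`IsBBR.isEdgeMetricGenerator`).

Let `m` be the number of end-cycles. The threads at a junction and the private part of an end-cycle
form pairwise disjoint regions, and being BBR amounts to all but one thread at a vertex and every
such private part being hit. Hence a smallest BBR set has `L(G) + m` vertices
(`IsSmallestBBR.card_eq`).

Upper bound: one further vertex makes a cycle wide, which removes its configurations and its
edge-critical vertices and changes nothing for the worse on other cycles. If this is done to an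
ADE-avoiding set on all cycles except for a set `Y` of pairwise non-incident ADE-negative ones, then
`edim ≤ L(G) + m + c - |Y|` (`IsADEAvoiding.exists_isEdgeMetricGenerator`).

Lower bound: let `T` be a generator, and call an end-cycle sparse if its private part contains only
one vertex of `T`. An end-cycle that is not sparse costs one vertex beyond `L(G) + m`. So does an
ADE-positive sparse one: its configuration can only be destroyed by leaving no thread free at its
branch-active vertex, and two sparse cycles with a common branch-active vertex would be incident.
Thus `|T| ≥ L(G) + 2m` minus the number of ADE-negative sparse cycles (`le_card_add`), with strict
inequality if all cycles are ADE-positive and one of them is not an end-cycle (`lt_card`).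

The value `L(G) + 2c - 1` therefore requires `m ≥ c - 1`. For `m = c` it is attained if and only if
there is an ADE-negative cycle and no two such cycles are non-incident, for `m = c - 1` if and only
if there is no ADE-negative cycle. -/

@[simp] lemma vertexEdgeDist_mk (u v w : V) :
    G.vertexEdgeDist u s(v, w) = min (G.dist u v) (G.dist u w) := rfl

/-- Along a walk `F` grows by at most one per step. The lower bounds in `IsSepAt.dist_eq` and
`Gates.dist_eq` come from this, with the claimed distance from `x` in the role of `F`. -/
lemma le_dist_of_lipschitz (hG : G.Connected) (F : V → ℕ) {x : V} (h0 : F x = 0)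
    (hF : ∀ a b, G.Adj a b → F b ≤ F a + 1) (y : V) : F y ≤ G.dist x y := by
  have key : ∀ {u v : V} (p : G.Walk u v), F v ≤ F u + p.length := by
    intro u v p
    induction p with
    | nil => simp
    | cons h p ih =>
      have := hF _ _ h
      rw [Walk.length_cons]
      omega
  obtain ⟨p, hp⟩ := hG.exists_walk_length_eq_dist x y
  have := key p
  omega

lemma Connected.dist_le_add_one (hG : G.Connected) (x : V) {a b : V} (h : G.Adj a b) :
    G.dist x b ≤ G.dist x a + 1 := by
  have h1 := hG.dist_triangle (u := x) (v := a) (w := b)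
  rw [dist_eq_one_iff_adj.2 h] at h1
  exact h1

/-- A set closed under adjacency in a connected graph is everything. -/
lemma Connected.mem_of_closed (hG : G.Connected) {K : Set V} {x : V} (hx : x ∈ K)
    (hK : ∀ z ∈ K, ∀ z', G.Adj z z' → z' ∈ K) (y : V) : y ∈ K := by
  obtain ⟨p⟩ := hG.preconnected x y
  induction p with
  | nil => exact hx
  | cons h p ih => exact ih (hK _ hx _ h)

/-- `r` separates the set `K` from the remaining vertices. -/
def IsSepAt (G : SimpleGraph V) (K : Set V) (r : V) : Prop :=
  r ∉ K ∧ ∀ z ∈ K, ∀ z', G.Adj z z' → z' ∈ K ∨ z' = r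

lemma IsSepAt.dist_eq (hG : G.Connected) {K : Set V} {r x y : V} (h : G.IsSepAt K r)
    (hx : x ∈ K) (hy : y ∉ K) : G.dist x y = G.dist x r + G.dist r y := by
  classical
  refine le_antisymm hG.dist_triangle ?_
  have := le_dist_of_lipschitz hG
    (fun z => if z ∈ K then G.dist x z else G.dist x r + G.dist r z) (x := x) (by simp [hx]) ?_ y
  · simpa [hy] using this
  intro a b hab
  by_cases ha : a ∈ K <;> by_cases hb : b ∈ K <;> simp only [ha, hb, if_true, if_false]
  · exact hG.dist_le_add_one x hab
  · obtain hb' | rfl := h.2 a ha b hab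
    · exact absurd hb' hb
    · simpa using hG.dist_le_add_one x hab
  · obtain ha' | rfl := h.2 b hb a hab.symm
    · exact absurd ha' ha
    · simpa using hG.dist_le_add_one x hab
  · have := hG.dist_le_add_one r hab
    omega

/-- The branch at `r` towards `a`: the component of `G - r` that contains `a ≠ r`. -/
def branch (G : SimpleGraph V) (r a : V) : Set V :=
  {x | Relation.ReflTransGen (fun x y => G.Adj x y ∧ x ≠ r ∧ y ≠ r) a x}

lemma mem_branch_self (r a : V) : a ∈ G.branch r a := Relation.ReflTransGen.refl

lemma mem_branch_of_adj {r a x y : V} (hx : x ∈ G.branch r a) (h : G.Adj x y) (hxr : x ≠ r)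
    (hyr : y ≠ r) : y ∈ G.branch r a := Relation.ReflTransGen.tail hx ⟨h, hxr, hyr⟩

lemma notMem_branch {r a : V} (h : a ≠ r) : r ∉ G.branch r a := by
  intro hr
  rcases Relation.ReflTransGen.cases_tail hr with h' | ⟨c, _, hc⟩
  · exact h h'.symm
  · exact hc.2.2 rfl

lemma isSepAt_branch {r a : V} (h : a ≠ r) : G.IsSepAt (G.branch r a) r := by
  refine ⟨notMem_branch h, fun z hz z' hzz' => ?_⟩
  by_cases hr : z' = r
  · exact Or.inr hr
  · exact Or.inl (mem_branch_of_adj hz hzz' (fun h' => notMem_branch h (h' ▸ hz)) hr)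

lemma IsSepAt.branch_subset {K : Set V} {r a : V} (h : G.IsSepAt K r) (ha : a ∈ K) :
    G.branch r a ⊆ K := by
  intro x hx
  induction hx with
  | refl => exact ha
  | tail _ h2 ih => exact (h.2 _ ih _ h2.1).resolve_right h2.2.2

lemma branch_symm {r a x : V} (hx : x ∈ G.branch r a) : a ∈ G.branch r x := by
  have hs : Std.Symm (fun x y => G.Adj x y ∧ x ≠ r ∧ y ≠ r) :=
    ⟨fun x y h => ⟨h.1.symm, h.2.2, h.2.1⟩⟩
  exact Relation.ReflTransGen.stdSymm.symm _ _ hx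

end Separation

/-! ### Threads, built inductively from the leaf -/

section Tails

variable {V : Type*} [Fintype V] {G : SimpleGraph V} [DecidableRel G.Adj]

lemma eq_of_degree_eq_one {a v b : V} (h : G.degree a = 1) (hv : G.Adj a v) (hb : G.Adj a b) :
    b = v := by
  obtain ⟨c, hc, h'⟩ := G.degree_eq_one_iff_existsUnique_adj.1 h
  rw [h' b hb, h' v hv]

lemma eq_or_eq_of_degree_eq_two {a u v b : V} (h : G.degree a = 2) (huv : u ≠ v) (hu : G.Adj a u)
    (hv : G.Adj a v) (hb : G.Adj a b) : b = u ∨ b = v := by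
  classical
  by_contra! hne
  have : ({u, v, b} : Finset V) ⊆ G.neighborFinset a := by
    intro x hx
    simp only [Finset.mem_insert, Finset.mem_singleton] at hx
    rcases hx with rfl | rfl | rfl <;> simpa
  have h1 := Finset.card_le_card this
  rw [card_neighborFinset_eq_degree, Finset.card_eq_three.2 ⟨u, v, b, huv, hne.1.symm, hne.2.symm,
    rfl⟩] at h1
  omega

/-- A thread at `v`, without the requirement on the degree of `v`. -/
inductive Tail (G : SimpleGraph V) [DecidableRel G.Adj] : V → List V → Prop
  | leaf {v a : V} : G.degree a = 1 → G.Adj a v → Tail G v [a]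
  | snoc {v a : V} {P : List V} : Tail G a P → G.degree a = 2 → G.Adj a v → v ∉ P →
      Tail G v (P ++ [a])

namespace Tail

variable {v : V} {P : List V}

lemma notMem (h : G.Tail v P) : v ∉ P := by
  cases h with
  | leaf h1 h2 => simpa using h2.ne'
  | snoc h1 h2 h3 h4 => simpa [h4] using h3.ne'

lemma exists_adj (h : G.Tail v P) : ∃ u ∈ P, G.Adj u v := by
  cases h with
  | leaf h1 h2 => exact ⟨_, by simp, h2⟩
  | snoc h1 h2 h3 h4 => exact ⟨_, by simp, h3⟩

lemma ne_nil (h : G.Tail v P) : P ≠ [] := by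
  obtain ⟨u, hu, -⟩ := h.exists_adj
  exact List.ne_nil_of_mem hu

/-- A vertex of degree two on the tail has one neighbour on the side of the leaf and one on the side
of the anchor; the condition `v ∉ P` in `snoc` keeps the two apart. -/
lemma isSepAt (h : G.Tail v P) : G.IsSepAt {x | x ∈ P} v := by
  refine ⟨h.notMem, ?_⟩
  induction h with
  | leaf h1 h2 =>
    intro z hz z' hzz'
    obtain rfl : z = _ := by simpa using hz
    exact Or.inr (eq_of_degree_eq_one h1 h2 hzz')
  | @snoc v a P h1 h2 h3 h4 ih =>
    intro z hz z' hzz'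
    simp only [Set.mem_ofPred_eq, List.mem_append, List.mem_singleton] at hz ih ⊢
    rcases hz with hz | rfl
    · exact Or.inl (ih z hz z' hzz')
    · obtain ⟨u, hu, hu'⟩ := h1.exists_adj
      rcases eq_or_eq_of_degree_eq_two h2 (fun h : u = v => h4 (h ▸ hu)) hu'.symm h3 hzz' with rfl | rfl
      · exact Or.inl (Or.inl hu)
      · exact Or.inr rfl

lemma mem_or_eq (h : G.Tail v P) {z z' : V} (hz : z ∈ P) (hzz' : G.Adj z z') : z' ∈ P ∨ z' = v :=
  h.isSepAt.2 z hz z' hzz'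

lemma degree_le (h : G.Tail v P) {x : V} (hx : x ∈ P) : G.degree x ≤ 2 := by
  induction h with
  | leaf h1 h2 =>
    obtain rfl : x = _ := by simpa using hx
    omega
  | snoc h1 h2 h3 h4 ih =>
    simp only [List.mem_append, List.mem_singleton] at hx
    rcases hx with hx | rfl
    · exact ih hx
    · omega

lemma adj_unique (h : G.Tail v P) {x y : V} (hx : x ∈ P) (hy : y ∈ P) (hxv : G.Adj x v)
    (hyv : G.Adj y v) : x = y := by
  cases h with
  | leaf h1 h2 =>
    simp only [List.mem_singleton] at hx hy
    rw [hx, hy]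
  | @snoc _ a P h1 h2 h3 h4 =>
    have key : ∀ z ∈ P ++ [a], G.Adj z v → z = a := by
      intro z hz hzv
      simp only [List.mem_append, List.mem_singleton] at hz
      rcases hz with hz | hz
      · rcases h1.mem_or_eq hz hzv with h | h
        · exact absurd h h4
        · exact absurd h h3.ne'
      · exact hz
    rw [key x hx hxv, key y hy hyv]

lemma adj_getLast (h : G.Tail v P) : ∃ u ∈ P.getLast?, G.Adj u v := by
  cases h with
  | leaf h1 h2 => exact ⟨_, by simp, h2⟩
  | snoc h1 h2 h3 h4 => exact ⟨_, by simp, h3⟩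

lemma nodup (h : G.Tail v P) : P.Nodup := by
  induction h with
  | leaf h1 h2 => simp
  | snoc h1 h2 h3 h4 ih =>
    rw [List.nodup_append]
    refine ⟨ih, by simp, ?_⟩
    rintro x hx y hy rfl
    simp only [List.mem_singleton] at hy
    exact h1.notMem (hy ▸ hx)

lemma isChain (h : G.Tail v P) : P.IsChain G.Adj := by
  induction h with
  | leaf h1 h2 => simp
  | @snoc _ a _ h1 h2 h3 h4 ih =>
    rw [List.isChain_append]
    refine ⟨ih, by simp, ?_⟩
    obtain ⟨u, hu, hu'⟩ := h1.adj_getLast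
    intro x hx y hy
    have : y = a := by simpa using hy.symm
    rw [this]
    rw [Option.mem_def] at hu hx
    rw [hu] at hx
    exact (Option.some_injective _ hx) ▸ hu'

lemma exists_cons (h : G.Tail v P) :
    ∃ l R, P = l :: R ∧ G.degree l = 1 ∧ ∀ x ∈ R, G.degree x = 2 := by
  induction h with
  | @leaf _ a h1 h2 => exact ⟨a, [], rfl, h1, by simp⟩
  | @snoc _ a P h1 h2 h3 h4 ih =>
    obtain ⟨l, R, rfl, h5, h6⟩ := ih
    refine ⟨l, R ++ [a], rfl, h5, ?_⟩
    intro x hx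
    simp only [List.mem_append, List.mem_singleton] at hx
    rcases hx with hx | rfl
    · exact h6 x hx
    · exact h2

lemma of_list : ∀ {v : V} {P : List V}, v ∉ P → P.Nodup → P.IsChain G.Adj →
    (∃ u ∈ P.head?, G.degree u = 1) → (∀ x ∈ P.tail, G.degree x = 2) →
    (∃ u ∈ P.getLast?, G.Adj u v) → G.Tail v P := by
  intro v P
  induction P using List.reverseRecOn generalizing v with
  | nil => rintro - - - ⟨u, hu, -⟩; simp at hu
  | append_singleton P a ih =>
    intro hv hnd hch hhd htl hlast
    have hav : G.Adj a v := by simpa using hlast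
    rcases P.eq_nil_or_concat with rfl | ⟨Q, b, rfl⟩
    · exact Tail.leaf (by simpa using hhd) hav
    · rw [List.concat_eq_append] at *
      rw [List.nodup_append] at hnd
      rw [List.isChain_append] at hch
      have hba : G.Adj b a := hch.2.2 b (by simp) a (by simp)
      refine Tail.snoc (ih ?_ hnd.1 hch.1 ?_ ?_ ⟨b, by simp, hba⟩) ?_ hav ?_
      · intro h
        exact hnd.2.2 a h a (by simp) rfl
      · obtain ⟨u, hu, hu'⟩ := hhd
        refine ⟨u, ?_, hu'⟩
        cases Q <;> simpa using hu
      · intro x hx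
        apply htl
        cases Q <;> simp at hx ⊢
        tauto
      · apply htl
        cases Q <;> simp
      · intro h
        exact hv (by simp at h ⊢; tauto)

end Tail

lemma isThread_iff {v : V} {P : List V} : G.IsThread v P ↔ 3 ≤ G.degree v ∧ G.Tail v P := by
  constructor
  · rintro ⟨h1, h2, h3, h4, h5, h6⟩
    refine ⟨h1, Tail.of_list ?_ h2 h3 h4 h5 h6⟩
    intro hv
    obtain ⟨u, hu, hu'⟩ := h4
    cases P with
    | nil => simp at hv
    | cons a P =>
      simp only [List.head?_cons, Option.mem_def, Option.some.injEq] at hu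
      subst hu
      rcases List.mem_cons.1 hv with rfl | hv
      · omega
      · have := h5 v hv
        omega
  · rintro ⟨h1, h2⟩
    obtain ⟨l, R, rfl, h3, h4⟩ := h2.exists_cons
    exact ⟨h1, h2.nodup, h2.isChain, ⟨l, by simp, h3⟩, by simpa using h4, h2.adj_getLast⟩

namespace Tail

variable {v : V} {P : List V}

/-- A tail is connected, and `K` can be left only through `r`. -/
lemma subset_of_isSepAt {K : Set V} {r : V} (h : G.Tail v P) (hK : G.IsSepAt K r) (hr : r ∉ P)
    {x : V} (hx : x ∈ P) (hxK : x ∈ K) : ∀ y ∈ P, y ∈ K := by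
  induction h generalizing x with
  | leaf h1 h2 =>
    intro y hy
    simp only [List.mem_singleton] at hx hy
    rwa [hy, ← hx]
  | @snoc v a P h1 h2 h3 h4 ih =>
    simp only [List.mem_append, List.mem_singleton, not_or] at hx hr
    obtain ⟨u, hu, hua⟩ := h1.exists_adj
    have hcl : ∀ {z z'}, z ∈ K → G.Adj z z' → z' ≠ r → z' ∈ K := fun hz hzz' hz' =>
      (hK.2 _ hz _ hzz').resolve_right hz'
    have hP : (∀ y ∈ P, y ∈ K) ∧ a ∈ K := by
      rcases hx with hx | rfl
      · have := ih hr.1 hx hxK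
        exact ⟨this, hcl (this u hu) hua (Ne.symm hr.2)⟩
      · exact ⟨ih hr.1 hu (hcl hxK hua.symm (fun h => hr.1 (h ▸ hu))), hxK⟩
    intro y hy
    simp only [List.mem_append, List.mem_singleton] at hy
    rcases hy with hy | rfl
    · exact hP.1 y hy
    · exact hP.2

lemma eq_of_prefix (h : G.Tail v P) {b : V} {R : List V} (hnd : (P ++ b :: R).Nodup)
    (hch : (P ++ b :: R).IsChain G.Adj) : b = v := by
  rw [List.nodup_append] at hnd
  rw [List.isChain_append] at hch
  obtain ⟨u, hu, huv⟩ := h.adj_getLast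
  rcases h.mem_or_eq (List.mem_of_mem_getLast? hu) (hch.2.2 u hu b (by simp)) with h' | h'
  · exact absurd rfl (hnd.2.2 b h' b (by simp))
  · exact h'

/-- A path that starts in the leaf has no choice until it reaches the anchor. -/
lemma prefix_or_prefix (h : G.Tail v P) {Q : List V} (hnd : Q.Nodup) (hch : Q.IsChain G.Adj)
    (hd : Q.head? = P.head?) : P <+: Q ∨ Q <+: P := by
  induction h with
  | @leaf _ a h1 h2 =>
    cases Q with
    | nil => simp at hd
    | cons b Q =>
      simp only [List.head?_cons, Option.some.injEq] at hd
      subst hd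
      exact Or.inl ⟨Q, rfl⟩
  | @snoc v a P h1 h2 h3 h4 ih =>
    have : Q.head? = P.head? := by
      obtain ⟨l, R, rfl, -⟩ := h1.exists_cons
      simpa using hd
    rcases ih this with ⟨R, rfl⟩ | h
    · cases R with
      | nil => exact Or.inr ⟨[a], by simp⟩
      | cons b R =>
        obtain rfl := h1.eq_of_prefix hnd hch
        exact Or.inl ⟨R, by simp⟩
    · exact Or.inr (h.trans (List.prefix_append _ _))

lemma eq_of_mem_of_degree (h : G.Tail v P) {x : V} (hx : x ∈ P) (hd : G.degree x = 1) :
    P.head? = some x := by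
  obtain ⟨l, R, rfl, h3, h4⟩ := h.exists_cons
  rcases List.mem_cons.1 hx with rfl | hx
  · rfl
  · have := h4 x hx
    omega

/-- Two tails which share a vertex, and whose anchors are not on the other tail, coincide. -/
lemma unique (h : G.Tail v P) {v' : V} {P' : List V} (h' : G.Tail v' P') (hv : v ∉ P')
    (hv' : v' ∉ P) {x : V} (hx : x ∈ P) (hx' : x ∈ P') : v = v' ∧ P = P' := by
  -- Each tail can be left only through its anchor, so the two have the same vertices. Hence they
  -- start in the same leaf, and one is a prefix of the other.
  have h1 : ∀ y ∈ P', y ∈ P := h'.subset_of_isSepAt h.isSepAt hv hx' hx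
  have h2 : ∀ y ∈ P, y ∈ P' := h.subset_of_isSepAt h'.isSepAt hv' hx hx'
  have hhd : P'.head? = P.head? := by
    obtain ⟨l, R, rfl, h3, h4⟩ := h'.exists_cons
    rw [h.eq_of_mem_of_degree (h1 l (by simp)) h3]
    rfl
  have key : ∀ {v : V} {P P' : List V}, (∀ y ∈ P', y ∈ P) → P'.Nodup → P <+: P' → P = P' := by
    rintro v P _ h1 hnd ⟨R, rfl⟩
    cases R with
    | nil => simp
    | cons b R =>
      rw [List.nodup_append] at hnd
      exact absurd rfl (hnd.2.2 b (h1 b (by simp)) b (by simp))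
  have hPP : P = P' := by
    rcases h.prefix_or_prefix h'.nodup h'.isChain hhd with hp | hp
    · exact key (v := v) h1 h'.nodup hp
    · exact (key (v := v) h2 h.nodup hp).symm
  subst hPP
  obtain ⟨u, hu, huv⟩ := h.exists_adj
  rcases h'.mem_or_eq hu huv with h3 | h3
  · exact absurd h3 hv
  · exact ⟨h3, rfl⟩

lemma prefix_tail (h : G.Tail v P) {P₁ R : List V} (hP : P = P₁ ++ R) (h1 : P₁ ≠ []) :
    ∃ b, G.Tail b P₁ := by
  induction h generalizing R with
  | @leaf v a h2 h3 =>
    rcases List.singleton_eq_append_iff.1 hP with ⟨rfl, -⟩ | ⟨rfl, -⟩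
    · exact absurd rfl h1
    · exact ⟨v, .leaf h2 h3⟩
  | @snoc v a P h2 h3 h4 h5 ih =>
    rcases R.eq_nil_or_concat with rfl | ⟨R, c, rfl⟩
    · rw [List.append_nil] at hP
      exact ⟨v, hP ▸ .snoc h2 h3 h4 h5⟩
    · rw [List.concat_eq_append, ← List.append_assoc] at hP
      exact ih (List.append_inj' hP rfl).1

/-- The anchor `b` of the initial part `P₁` is `R.length` steps up the tail from `v`, and every path
from outside enters the tail through `v`. -/
lemma dist_anchor (hG : G.Connected) (h : G.Tail v P) {P₁ R : List V} (hP : P = P₁ ++ R) {b s : V}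
    (h1 : G.Tail b P₁) (hs : s ∉ P) : G.dist s b = G.dist s v + R.length := by
  have hbase : ∀ {v : V}, G.Tail v P₁ → b = v := fun hv =>
    (h1.unique hv h1.notMem hv.notMem (List.mem_of_mem_head? (a := P₁.head h1.ne_nil) (by
      simp [List.head?_eq_some_head h1.ne_nil])) (List.head_mem _)).1
  induction h generalizing R with
  | @leaf v a h2 h3 =>
    rcases List.singleton_eq_append_iff.1 hP with ⟨rfl, -⟩ | ⟨rfl, rfl⟩
    · exact absurd rfl h1.ne_nil
    · simp [hbase (.leaf h2 h3)]
  | @snoc v a P h2 h3 h4 h5 ih =>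
    rcases R.eq_nil_or_concat with rfl | ⟨R, c, rfl⟩
    · rw [List.append_nil] at hP
      have hT : G.Tail v P₁ := hP ▸ Tail.snoc h2 h3 h4 h5
      simp [hbase hT]
    · rw [List.concat_eq_append, ← List.append_assoc] at hP
      obtain ⟨hP1, hP2⟩ := List.append_inj' hP rfl
      simp only [List.mem_append, List.mem_singleton, not_or] at hs
      rw [ih hP1 hs.1]
      have hT : G.Tail v (P ++ [a]) := .snoc h2 h3 h4 h5
      have h6 := hT.isSepAt.dist_eq hG (x := a) (y := s) (by simp) (by simp [hs])
      rw [dist_eq_one_iff_adj.2 h4, dist_comm, dist_comm (u := v)] at h6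
      simp only [List.concat_eq_append, List.length_append, List.length_singleton]
      omega

end Tail

/-- `e` is the edge at distance `h` from `v` on the tail `P` at `v`. -/
def IsTailEdge (G : SimpleGraph V) [DecidableRel G.Adj] (P : List V) (h : ℕ) (e : Sym2 V) : Prop :=
  ∃ P₁ R a b, P = P₁ ++ R ∧ R.length = h ∧ G.Tail b P₁ ∧ a ∈ P₁ ∧ G.Adj a b ∧ e = s(a, b)

namespace Tail

variable {v : V} {P : List V} {h : ℕ} {e : Sym2 V}

/-- From outside the tail only the anchor and the depth of the edge are visible. Edges of equal
depth on two free tails with the same anchor are therefore never distinguished. -/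
lemma vertexEdgeDist (hG : G.Connected) (hT : G.Tail v P) (he : G.IsTailEdge P h e) {s : V}
    (hs : s ∉ P) : G.vertexEdgeDist s e = G.dist s v + h := by
  obtain ⟨P₁, R, a, b, hP, rfl, h1, ha, hab, rfl⟩ := he
  have h2 := hT.dist_anchor hG hP h1 hs
  have h3 := h1.isSepAt.dist_eq hG (x := a) (y := s) ha (fun h => hs (by
    rw [hP]; exact List.mem_append_left _ h))
  rw [dist_eq_one_iff_adj.2 hab, dist_comm, dist_comm (u := b)] at h3
  rw [vertexEdgeDist_mk, ← h2]
  omega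

lemma edge_unique {e' : Sym2 V} (he : G.IsTailEdge P h e) (he' : G.IsTailEdge P h e') :
    e = e' := by
  obtain ⟨P₁, R, a, b, rfl, rfl, h1, ha, hab, rfl⟩ := he
  obtain ⟨P₂, R', a', b', hP', hR, h1', ha', hab', rfl⟩ := he'
  obtain ⟨rfl, -⟩ := List.append_inj' hP' hR.symm
  obtain ⟨rfl, -⟩ := h1.unique h1' h1.notMem h1'.notMem ha ha
  rw [h1.adj_unique ha ha' hab hab']

lemma exists_edge (hT : G.Tail v P) (hh : h < P.length) : ∃ e, G.IsTailEdge P h e := by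
  have hP := (List.take_append_drop (P.length - h) P).symm
  have hne : P.take (P.length - h) ≠ [] := by
    rw [Ne, List.take_eq_nil_iff]
    have := hT.ne_nil
    simp [this]
    omega
  obtain ⟨b, hb⟩ := hT.prefix_tail hP hne
  obtain ⟨a, ha, hab⟩ := hb.exists_adj
  exact ⟨s(a, b), _, _, a, b, hP, by rw [List.length_drop]; omega, hb, ha, hab, rfl⟩

lemma edge_lt (hT : G.Tail v P) (he : G.IsTailEdge P h e) : h < P.length := by
  obtain ⟨P₁, R, a, b, rfl, rfl, h1, ha, hab, rfl⟩ := he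
  have := List.length_pos_of_mem ha
  rw [List.length_append]
  omega

lemma edge_mem (hT : G.Tail v P) (he : G.IsTailEdge P h e) :
    e ∈ G.edgeSet ∧ (∃ a ∈ P, a ∈ e) ∧ ∀ x ∈ e, x ∈ P ∨ x = v := by
  obtain ⟨P₁, R, a, b, hP, rfl, h1, ha, hab, rfl⟩ := he
  have haP : a ∈ P := by rw [hP]; exact List.mem_append_left _ ha
  refine ⟨hab, ⟨a, haP, by simp⟩, ?_⟩
  intro x hx
  rcases Sym2.mem_iff.1 hx with rfl | rfl
  · exact Or.inl haP
  · exact hT.mem_or_eq haP hab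

end Tail

end Tails

/-! ### Labelled cycles and the gates through which other vertices see them -/

section Cycles

variable {V : Type*} {G : SimpleGraph V} {C : G.Subgraph} {g : ℕ} {f : ℕ → V}

/-- `f 0, …, f (g - 1)` are the vertices of the cycle `C` in cyclic order, and `f g = f 0`. -/
structure CycLab (G : SimpleGraph V) (C : G.Subgraph) (g : ℕ) (f : ℕ → V) : Prop where
  mem : C ∈ G.cycleSubgraphs
  three_le : 3 ≤ g
  wrap : f g = f 0
  inj : ∀ i < g, ∀ j < g, f i = f j → i = j
  verts : ∀ x, x ∈ C.verts ↔ ∃ i < g, f i = x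
  edges : ∀ e, e ∈ C.edgeSet ↔ ∃ i < g, s(f i, f (i + 1)) = e

lemma exists_walk_arc {f : ℕ → V} {H : SimpleGraph V} {a b : ℕ} (hab : a ≤ b)
    (hH : ∀ i, a ≤ i → i < b → H.Adj (f i) (f (i + 1))) :
    ∃ p : H.Walk (f a) (f b), p.length = b - a := by
  induction b, hab using Nat.le_induction with
  | base => exact ⟨.nil, by simp⟩
  | succ b hab ih =>
    obtain ⟨p, hp⟩ := ih fun i h1 h2 => hH i h1 (by omega)
    exact ⟨p.concat (hH b hab (by omega)), by rw [Walk.length_concat, hp]; omega⟩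

lemma cycLab_getVert {v : V} {w : G.Walk v v} (hw : w.IsCycle) :
    CycLab G w.toSubgraph w.length w.getVert where
  mem := ⟨v, w, hw, rfl⟩
  three_le := hw.three_le_length
  wrap := by simp
  inj i hi j hj h := hw.getVert_injOn' (by simp only [Set.mem_ofPred_eq]; omega)
    (by simp only [Set.mem_ofPred_eq]; omega) h
  verts x := by
    rw [Walk.mem_verts_toSubgraph, Walk.mem_support_iff_exists_getVert]
    constructor
    · rintro ⟨i, rfl, hi⟩
      rcases hi.lt_or_eq with hi | rfl
      · exact ⟨i, hi, rfl⟩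
      · exact ⟨0, by have := hw.three_le_length; omega, by simp⟩
    · rintro ⟨i, hi, rfl⟩
      exact ⟨i, rfl, hi.le⟩
  edges e := by
    induction e using Sym2.ind with
    | _ a b => rw [Walk.mem_edges_toSubgraph, Walk.mk_mem_edges_iff_exists]

/-- The `S`-path is defined by minimising over all labellings, so the same cycle has to be read from
any of its vertices. -/
lemma exists_getVert_rotate {v : V} {w : G.Walk v v} (hw : w.IsCycle) {a : ℕ} (ha : a < w.length) :
    ∃ w' : G.Walk (w.getVert a) (w.getVert a), w'.IsCycle ∧ w'.toSubgraph = w.toSubgraph ∧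
      w'.length = w.length ∧
      ∀ i < w.length, w'.getVert i = w.getVert (if a + i < w.length then a + i
        else a + i - w.length) := by
  classical
  have hm := w.getVert_mem_support a
  refine ⟨w.rotate _ hm, hw.rotate hm, by simp, by simp, fun i hi => ?_⟩
  have hl : (w.takeUntil _ hm).length = a := by
    have h1 := Walk.getVert_length_takeUntil hm
    have h2 := w.length_takeUntil_le_length hm
    rcases h2.lt_or_eq with h2 | h2
    · exact (cycLab_getVert hw).inj _ h2 _ ha h1
    · rw [h2, Walk.getVert_length] at h1
      have h0 : 0 = a := (cycLab_getVert hw).inj 0 (by omega) a ha (by simpa using h1)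
      have h3 : ∀ (u : V) (hu : u ∈ w.support), v = u → (w.takeUntil u hu).length = 0 := by
        rintro u hu rfl
        simp
      rw [h3 _ hm h1, h0]
  have hl' : (w.dropUntil _ hm).length = w.length - a := by
    have := congrArg Walk.length (w.take_spec hm)
    rw [Walk.length_append] at this
    omega
  rw [Walk.rotate, Walk.getVert_append, hl']
  split_ifs with h1 h2 h2
  · conv_rhs => rw [← w.take_spec hm, Walk.getVert_append, hl, if_neg (by omega)]
    congr 1
    omega
  · omega
  · omega
  · rw [Walk.getVert_takeUntil hm (by omega)]
    congr 1
    omega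

lemma exists_cycLab (hC : C ∈ G.cycleSubgraphs) : ∃ g f, CycLab G C g f := by
  obtain ⟨v, w, hw, rfl⟩ := hC
  exact ⟨_, _, cycLab_getVert hw⟩

lemma exists_cycLab_zero (hC : C ∈ G.cycleSubgraphs) {r : V} (hr : r ∈ C.verts) :
    ∃ g f, CycLab G C g f ∧ f 0 = r := by
  obtain ⟨v, w, hw, rfl⟩ := hC
  obtain ⟨a, ha, rfl⟩ := ((cycLab_getVert hw).verts r).1 hr
  obtain ⟨w', hw', h1, h2, h3⟩ := exists_getVert_rotate hw ha
  exact ⟨_, _, h1 ▸ cycLab_getVert hw', by simp⟩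

namespace CycLab

variable (h : CycLab G C g f)
include h

lemma mem_verts {i : ℕ} (hi : i ≤ g) : f i ∈ C.verts := by
  rw [h.verts]
  rcases hi.lt_or_eq with hi | rfl
  · exact ⟨i, hi, rfl⟩
  · exact ⟨0, by have := h.three_le; omega, h.wrap.symm⟩

lemma mem_edgeSet {i : ℕ} (hi : i < g) : s(f i, f (i + 1)) ∈ C.edgeSet :=
  (h.edges _).2 ⟨i, hi, rfl⟩

lemma adj {i : ℕ} (hi : i < g) : G.Adj (f i) (f (i + 1)) :=
  C.edgeSet_subset (h.mem_edgeSet hi)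

lemma inj_le {i j : ℕ} (hi : i ≤ g) (hj : j ≤ g) (hij : f i = f j) :
    i = j ∨ (i = 0 ∧ j = g) ∨ (i = g ∧ j = 0) := by
  have h3 := h.three_le
  rcases hi.lt_or_eq with hi | rfl <;> rcases hj.lt_or_eq with hj | rfl
  · exact Or.inl (h.inj i hi j hj hij)
  · rw [h.wrap] at hij
    have := h.inj i hi 0 (by omega) hij
    omega
  · rw [h.wrap] at hij
    have := h.inj 0 (by omega) j hj hij
    omega
  · exact Or.inl rfl

lemma edge_inj {i j : ℕ} (hi : i < g) (hj : j < g)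
    (hij : s(f i, f (i + 1)) = s(f j, f (j + 1))) : i = j := by
  have h3 := h.three_le
  rcases Sym2.eq_iff.1 hij with ⟨h1, -⟩ | ⟨h1, h2⟩
  · exact h.inj i hi j hj h1
  · have h1 := h.inj_le (by omega) (by omega) h1
    have h2 := h.inj_le (by omega) (by omega) h2
    omega

/-- A path from `f i` to `f j` off the edges of `C`, together with the arcs of `C` from `f (j + 1)`
through `f 0` to `f i`, joins the ends of the edge at `f j` without using the edge at `f i`. So the
edge at `f j` would lie on a second cycle. -/
lemma not_reachable_of_lt (hG : G.IsCactus) {i j : ℕ} (hij : i < j) (hj : j < g) :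
    ¬ (G.deleteEdges C.edgeSet).Reachable (f i) (f j) := by
  intro hr
  set e := s(f i, f (i + 1)) with he
  set H := G.deleteEdges {e} with hH
  set e' := s(f j, f (j + 1)) with he'
  have hne : e' ≠ e := fun h' => by
    have := h.edge_inj hj (by omega) h'
    omega
  have hadj : ∀ k < g, k ≠ i → k ≠ j → (H.deleteEdges {e'}).Adj (f k) (f (k + 1)) := by
    intro k hk h1 h2
    rw [hH, deleteEdges_adj, deleteEdges_adj]
    exact ⟨⟨h.adj hk, fun h' => h1 (h.edge_inj hk (by omega) h')⟩,
      fun h' => h2 (h.edge_inj hk hj h')⟩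
  have h1 : (H.deleteEdges {e'}).Reachable (f j) (f i) := by
    refine hr.symm.mono ?_
    intro a b hab
    rw [deleteEdges_adj] at hab
    rw [hH, deleteEdges_adj, deleteEdges_adj]
    refine ⟨⟨hab.1, fun h' => hab.2 ?_⟩, fun h' => hab.2 ?_⟩
    · rw [Set.mem_singleton_iff.1 h']
      exact h.mem_edgeSet (by omega)
    · rw [Set.mem_singleton_iff.1 h']
      exact h.mem_edgeSet hj
  have h2 : (H.deleteEdges {e'}).Reachable (f 0) (f i) :=
    let ⟨p, _⟩ := exists_walk_arc (Nat.zero_le i) fun k _ hk => hadj k (by omega) (by omega) (by omega)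
    ⟨p⟩
  have h3 : (H.deleteEdges {e'}).Reachable (f (j + 1)) (f g) :=
    let ⟨p, _⟩ := exists_walk_arc (show j + 1 ≤ g by omega) fun k h1 hk =>
      hadj k (by omega) (by omega) (by omega)
    ⟨p⟩
  rw [h.wrap] at h3
  have h4 : H.Adj (f j) (f (j + 1)) := by
    rw [hH, deleteEdges_adj]
    exact ⟨h.adj hj, hne⟩
  obtain ⟨u, p, hp, hpe⟩ := adj_and_reachable_delete_edges_iff_exists_cycle.1
    ⟨h4, h1.trans (h2.symm.trans h3.symm)⟩
  have hle : H ≤ G := deleteEdges_le _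
  have hp' : (p.mapLe hle).IsCycle := hp.mapLe hle
  have hmem : (p.mapLe hle).toSubgraph ∈ G.cycleSubgraphs := ⟨u, _, hp', rfl⟩
  by_cases heq : (p.mapLe hle).toSubgraph = C
  · have h5 : e ∈ (p.mapLe hle).edges := by
      rw [← Walk.mem_edges_toSubgraph, heq]
      exact h.mem_edgeSet (by omega)
    rw [Walk.edges_mapLe_eq_edges] at h5
    have := p.edges_subset_edgeSet h5
    rw [hH, edgeSet_deleteEdges] at this
    exact this.2 rfl
  · have hd := Set.disjoint_left.1 (hG.2 hmem h.mem heq)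
    refine hd (show e' ∈ _ from ?_) (h.mem_edgeSet hj)
    rw [Walk.mem_edges_toSubgraph, Walk.edges_mapLe_eq_edges]
    exact hpe

lemma exists_lab (hG : G.IsCactus) : ∃ lab : V → ℕ, (∀ x, lab x < g) ∧
    ∀ x, ∀ i < g, (x ∈ G.hangingPart C (f i) ↔ lab x = i) := by
  have h3 := h.three_le
  have hex : ∀ x, ∃ i < g, x ∈ G.hangingPart C (f i) := by
    refine hG.1.mem_of_closed (K := {x | ∃ i < g, x ∈ G.hangingPart C (f i)}) (x := f 0)
      ⟨0, by omega, Reachable.refl _⟩ ?_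
    rintro z ⟨i, hi, hz⟩ z' hzz'
    by_cases he : s(z, z') ∈ C.edgeSet
    · obtain ⟨j, hj, rfl⟩ := (h.verts z').1 (C.mem_verts_of_mem_edge he (Sym2.mem_mk_right _ _))
      exact ⟨j, hj, Reachable.refl _⟩
    · exact ⟨i, hi, Reachable.trans hz (Adj.reachable (deleteEdges_adj.2 ⟨hzz', he⟩))⟩
  choose lab hlt hlab using hex
  refine ⟨lab, hlt, fun x i hi => ⟨fun hx => ?_, fun hx => hx ▸ hlab x⟩⟩
  have hr : (G.deleteEdges C.edgeSet).Reachable (f i) (f (lab x)) :=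
    Reachable.trans hx (Reachable.symm (hlab x))
  rcases lt_trichotomy i (lab x) with h1 | h1 | h1
  · exact absurd hr (h.not_reachable_of_lt hG h1 (hlt x))
  · exact h1.symm
  · exact absurd hr.symm (h.not_reachable_of_lt hG h1 hi)

end CycLab

/-- The distance of the vertices with the labels `i` and `j` on a cycle of length `g`. -/
def cycDist (g i j : ℕ) : ℕ := min (max i j - min i j) (g - (max i j - min i j))

lemma cycDist_comm (g i j : ℕ) : cycDist g i j = cycDist g j i := by
  simp only [cycDist, max_comm, min_comm]

@[simp] lemma cycDist_self (g i : ℕ) : cycDist g i i = 0 := by simp [cycDist]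

/-- A labelling of a cycle, together with the map which sends a vertex to the label of the
vertex of the cycle at which it hangs. -/
structure Gates (G : SimpleGraph V) (C : G.Subgraph) (g : ℕ) (f : ℕ → V) (lab : V → ℕ) : Prop
    extends CycLab G C g f where
  lt : ∀ x, lab x < g
  mem_iff : ∀ x, ∀ i < g, (x ∈ G.hangingPart C (f i) ↔ lab x = i)

lemma CycLab.exists_gates (hG : G.IsCactus) (h : CycLab G C g f) : ∃ lab, Gates G C g f lab := by
  obtain ⟨lab, h1, h2⟩ := h.exists_lab hG
  exact ⟨lab, h, h1, h2⟩

namespace Gates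

variable {lab : V → ℕ} (h : Gates G C g f lab)
include h

lemma lab_f {i : ℕ} (hi : i < g) : lab (f i) = i := (h.mem_iff _ i hi).1 (Reachable.refl _)

lemma f_lab {x : V} (hx : x ∈ C.verts) : f (lab x) = x := by
  obtain ⟨i, hi, rfl⟩ := (h.verts x).1 hx
  rw [h.lab_f hi]

lemma mem_self (x : V) : x ∈ G.hangingPart C (f (lab x)) := (h.mem_iff x _ (h.lt x)).2 rfl

lemma lab_eq_of_adj {x y : V} (hxy : G.Adj x y) (he : s(x, y) ∉ C.edgeSet) : lab y = lab x :=
  (h.mem_iff y _ (h.lt x)).1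
    (Reachable.trans (h.mem_self x) (Adj.reachable (deleteEdges_adj.2 ⟨hxy, he⟩)))

lemma edge_cases {e : Sym2 V} (he : e ∈ C.edgeSet) :
    ∃ i < g, e = s(f i, f (i + 1)) ∧ lab (f (i + 1)) = if i + 1 < g then i + 1 else 0 := by
  have h3 := h.three_le
  obtain ⟨i, hi, rfl⟩ := (h.edges e).1 he
  refine ⟨i, hi, rfl, ?_⟩
  split_ifs with h1
  · exact h.lab_f h1
  · rw [show i + 1 = g by omega, h.wrap, h.lab_f (by omega)]

lemma dist_le {i j : ℕ} (hi : i < g) (hj : j < g) : G.dist (f i) (f j) ≤ cycDist g i j := by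
  wlog hij : i ≤ j generalizing i j
  · rw [dist_comm, cycDist_comm]
    exact this hj hi (by omega)
  have h1 : G.dist (f i) (f j) ≤ j - i := by
    obtain ⟨p, hp⟩ := exists_walk_arc (f := f) (H := G) hij fun k _ hk => h.adj (show k < g by omega)
    exact hp ▸ SimpleGraph.dist_le p
  have h2 : G.dist (f i) (f j) ≤ g - (j - i) := by
    obtain ⟨p, hp⟩ := exists_walk_arc (f := f) (H := G) (Nat.zero_le i) fun k _ hk => h.adj (show k < g by omega)
    obtain ⟨q, hq⟩ := exists_walk_arc (f := f) (H := G) hj.le fun k _ hk => h.adj (show k < g by omega)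
    have := SimpleGraph.dist_le (p.reverse.append ((q.copy rfl h.wrap).reverse))
    rw [Walk.length_append, Walk.length_reverse, Walk.length_reverse, Walk.length_copy] at this
    omega
  simp only [cycDist]
  omega

/-- A path between different hanging parts passes both gates and an arc of the cycle. Formally, the
right-hand side, as a function of `y`, grows by at most one along each edge: off `C` the gate does
not change, and on `C` only `cycDist` does. -/
lemma dist_eq (hG : G.Connected) {x y : V} (hxy : lab x ≠ lab y) :
    G.dist x y = G.dist x (f (lab x)) + cycDist g (lab x) (lab y) + G.dist (f (lab y)) y := by
  classical
  have h3 := h.three_le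
  refine le_antisymm ?_ ?_
  · have h1 := hG.dist_triangle (u := x) (v := f (lab x)) (w := y)
    have h2 := hG.dist_triangle (u := f (lab x)) (v := f (lab y)) (w := y)
    have := h.dist_le (h.lt x) (h.lt y)
    omega
  set i := lab x with hi
  set F : V → ℕ := fun z => if lab z = i then G.dist x z
    else G.dist x (f i) + cycDist g i (lab z) + G.dist (f (lab z)) z with hF
  have hFf : ∀ j < g, F (f j) = G.dist x (f i) + cycDist g i j := by
    intro j hj
    simp only [hF, h.lab_f hj]
    split_ifs with h1
    · simp [h1]
    · simp
  have hi' := h.lt x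
  have := le_dist_of_lipschitz hG F (x := x) (by simp [hF, hi]) ?_ y
  · simpa [hF, hxy.symm] using this
  intro a b hab
  by_cases he : s(a, b) ∈ C.edgeSet
  · obtain ⟨j, hj, he', hl⟩ := h.edge_cases he
    have h4 : F (f (j + 1)) = G.dist x (f i) + cycDist g i (if j + 1 < g then j + 1 else 0) := by
      split_ifs with h1
      · exact hFf _ h1
      · rw [show j + 1 = g by omega, h.wrap, hFf _ (by omega)]
    rw [← hi] at hi'
    rcases Sym2.eq_iff.1 he' with ⟨rfl, rfl⟩ | ⟨rfl, rfl⟩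
    · rw [hFf j hj, h4]
      simp only [cycDist]
      split_ifs <;> omega
    · rw [hFf j hj, h4]
      simp only [cycDist]
      split_ifs <;> omega
  · have := h.lab_eq_of_adj hab he
    simp only [hF, this]
    split_ifs
    · exact hG.dist_le_add_one x hab
    · have := hG.dist_le_add_one (f (lab a)) hab
      omega

lemma dist_f (hG : G.Connected) {i j : ℕ} (hi : i < g) (hj : j < g) :
    G.dist (f i) (f j) = cycDist g i j := by
  by_cases hij : i = j
  · simp [hij]
  · have := h.dist_eq hG (x := f i) (y := f j) (by rwa [h.lab_f hi, h.lab_f hj])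
    rw [h.lab_f hi, h.lab_f hj] at this
    simpa using this

lemma dist_f_right (hG : G.Connected) (x : V) {j : ℕ} (hj : j < g) :
    G.dist x (f j) = G.dist x (f (lab x)) + cycDist g (lab x) j := by
  by_cases hij : lab x = j
  · simp [hij]
  · have := h.dist_eq hG (x := x) (y := f j) (by rwa [h.lab_f hj])
    rw [h.lab_f hj] at this
    simpa using this

lemma isSActive_iff {S : Finset V} {i : ℕ} (hi : i < g) :
    G.IsSActive S C (f i) ↔ ∃ s ∈ S, lab s = i := by
  rw [IsSActive]
  constructor
  · rintro ⟨-, s, hs, h1⟩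
    exact ⟨s, hs, (h.mem_iff s i hi).1 h1⟩
  · rintro ⟨s, hs, h1⟩
    exact ⟨h.mem_verts hi.le, s, hs, (h.mem_iff s i hi).2 h1⟩

end Gates

end Cycles

/-! ### The parts of the graph that hang at the vertices of a cycle -/

section Hanging

variable {V : Type*} {G : SimpleGraph V} {C C' : G.Subgraph}

lemma exists_gates (hG : G.IsCactus) (hC : C ∈ G.cycleSubgraphs) :
    ∃ g f lab, Gates G C g f lab := by
  obtain ⟨g, f, h⟩ := exists_cycLab hC
  obtain ⟨lab, h⟩ := h.exists_gates hG
  exact ⟨g, f, lab, h⟩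

lemma exists_gates_zero (hG : G.IsCactus) (hC : C ∈ G.cycleSubgraphs) {r : V} (hr : r ∈ C.verts) :
    ∃ g f lab, Gates G C g f lab ∧ f 0 = r := by
  obtain ⟨g, f, h, h0⟩ := exists_cycLab_zero hC hr
  obtain ⟨lab, h⟩ := h.exists_gates hG
  exact ⟨g, f, lab, h, h0⟩

lemma mem_hangingPart_self (C : G.Subgraph) (r : V) : r ∈ G.hangingPart C r := Reachable.refl _

lemma mem_hangingPart_of_adj {r x y : V} (hx : x ∈ G.hangingPart C r) (h : G.Adj x y)
    (he : s(x, y) ∉ C.edgeSet) : y ∈ G.hangingPart C r :=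
  Reachable.trans hx (Adj.reachable (deleteEdges_adj.2 ⟨h, he⟩))

lemma hangingPart_induction {r : V} {p : ∀ x, x ∈ G.hangingPart C r → Prop}
    (self : p r (mem_hangingPart_self C r))
    (step : ∀ x y hx (hxy : G.Adj x y) (he : s(x, y) ∉ C.edgeSet), p x hx →
      p y (mem_hangingPart_of_adj hx hxy he)) {x : V} (hx : x ∈ G.hangingPart C r) : p x hx := by
  have key : ∀ {a b : V} (w : (G.deleteEdges C.edgeSet).Walk a b), (∃ h, p a h) → ∃ h, p b h := by
    intro a b w
    induction w with
    | nil => exact id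
    | cons h w ih =>
      rintro ⟨ha, hpa⟩
      rw [deleteEdges_adj] at h
      exact ih ⟨_, step _ _ ha h.1 h.2 hpa⟩
  obtain ⟨w⟩ := id hx
  exact (key w ⟨_, self⟩).2

lemma hangingPart_unique (hG : G.IsCactus) (hC : C ∈ G.cycleSubgraphs) {r r' x : V}
    (hr : r ∈ C.verts) (hr' : r' ∈ C.verts) (hx : x ∈ G.hangingPart C r)
    (hx' : x ∈ G.hangingPart C r') : r = r' := by
  obtain ⟨g, f, lab, h⟩ := exists_gates hG hC
  obtain ⟨i, hi, rfl⟩ := (h.verts r).1 hr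
  obtain ⟨j, hj, rfl⟩ := (h.verts r').1 hr'
  rw [← (h.mem_iff x i hi).1 hx, (h.mem_iff x j hj).1 hx']

lemma exists_mem_hangingPart (hG : G.IsCactus) (hC : C ∈ G.cycleSubgraphs) (x : V) :
    ∃ r ∈ C.verts, x ∈ G.hangingPart C r := by
  obtain ⟨g, f, lab, h⟩ := exists_gates hG hC
  exact ⟨f (lab x), h.mem_verts (h.lt x).le, h.mem_self x⟩

/-- Different vertices of `C` have disjoint hanging parts, so `r` is the only vertex of this one
that is incident with edges of `C`. -/
lemma isSepAt_hangingPart (hG : G.IsCactus) (hC : C ∈ G.cycleSubgraphs) {r : V}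
    (hr : r ∈ C.verts) : G.IsSepAt (G.hangingPart C r \ {r}) r := by
  refine ⟨by simp, ?_⟩
  rintro z ⟨hz, hzr⟩ z' hzz'
  by_cases he : s(z, z') ∈ C.edgeSet
  · exact absurd (hangingPart_unique hG hC (C.mem_verts_of_mem_edge he (Sym2.mem_mk_left _ _)) hr
      (mem_hangingPart_self C z) hz) hzr
  · by_cases h : z' = r
    · exact Or.inr h
    · exact Or.inl ⟨mem_hangingPart_of_adj hz hzz' he, h⟩

lemma isSepAt_compl_hangingPart (hG : G.IsCactus) (hC : C ∈ G.cycleSubgraphs) {r : V}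
    (hr : r ∈ C.verts) : G.IsSepAt (G.hangingPart C r)ᶜ r := by
  refine ⟨fun h => h (mem_hangingPart_self C r), ?_⟩
  intro z hz z' hzz'
  by_cases hz' : z' ∈ G.hangingPart C r
  · by_cases he : s(z, z') ∈ C.edgeSet
    · exact Or.inr (hangingPart_unique hG hC (C.mem_verts_of_mem_edge he (Sym2.mem_mk_right _ _)) hr
        (mem_hangingPart_self C z') hz')
    · exact absurd (mem_hangingPart_of_adj hz' hzz'.symm (by rwa [Sym2.eq_swap])) hz
  · exact Or.inl hz'

lemma branch_subset_hangingPart (hG : G.IsCactus) (hC : C ∈ G.cycleSubgraphs) {r b : V}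
    (hr : r ∈ C.verts) (hb : G.Adj r b) (he : s(r, b) ∉ C.edgeSet) :
    G.branch r b ⊆ G.hangingPart C r \ {r} :=
  (isSepAt_hangingPart hG hC hr).branch_subset
    ⟨mem_hangingPart_of_adj (mem_hangingPart_self C r) hb he, hb.ne'⟩

lemma hangingPart_cases {r x : V} (hx : x ∈ G.hangingPart C r) :
    x = r ∨ ∃ b, G.Adj r b ∧ s(r, b) ∉ C.edgeSet ∧ x ∈ G.branch r b := by
  induction hx using hangingPart_induction with
  | self => exact Or.inl rfl
  | step x y _ hxy he hx =>
    by_cases hy : y = r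
    · exact Or.inl hy
    rcases hx with rfl | ⟨b, hb, hbe, hx⟩
    · exact Or.inr ⟨y, hxy, he, mem_branch_self _ _⟩
    · exact Or.inr ⟨b, hb, hbe, mem_branch_of_adj hx hxy
        (fun h => notMem_branch hb.ne' (h ▸ hx)) hy⟩

lemma exists_nbrs (hC : C ∈ G.cycleSubgraphs) {r : V} (hr : r ∈ C.verts) :
    ∃ c₁ c₂, c₁ ≠ c₂ ∧ s(r, c₁) ∈ C.edgeSet ∧ s(r, c₂) ∈ C.edgeSet ∧
      ∀ b, s(r, b) ∈ C.edgeSet → b = c₁ ∨ b = c₂ := by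
  obtain ⟨g, f, h, rfl⟩ := exists_cycLab_zero hC hr
  have h3 := h.three_le
  have hlast : s(f 0, f (g - 1)) = s(f (g - 1), f (g - 1 + 1)) := by
    rw [show g - 1 + 1 = g by omega, h.wrap, Sym2.eq_swap]
  refine ⟨f 1, f (g - 1), ?_, h.mem_edgeSet (by omega), hlast ▸ h.mem_edgeSet (by omega), ?_⟩
  · intro h1
    have := h.inj 1 (by omega) (g - 1) (by omega) h1
    have := h.inj_le (i := 0) (j := 2) (by omega) (by omega)
    omega
  · intro b hb
    obtain ⟨i, hi, he⟩ := (h.edges _).1 hb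
    rcases Sym2.eq_iff.1 he with ⟨h1, h2⟩ | ⟨h1, h2⟩
    · have := h.inj i hi 0 (by omega) h1
      subst this
      exact Or.inl h2.symm
    · have := h.inj_le (by omega) (by omega) h2
      have : i = g - 1 := by omega
      subst this
      exact Or.inr h1.symm

/-- A path from `b₁` to `b₂` that avoids `r` closes up through `r`. This is how edges off all cycles
are recognised as bridges. -/
lemma exists_cycle_of_mem_branch {r b₁ b₂ : V} (h1 : G.Adj r b₁) (h2 : G.Adj r b₂) (hne : b₁ ≠ b₂)
    (h : b₂ ∈ G.branch r b₁) : ∃ C ∈ G.cycleSubgraphs, s(r, b₁) ∈ C.edgeSet := by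
  have hr : ∀ y ∈ G.branch r b₁, (G.deleteEdges {s(r, b₁)}).Reachable b₁ y := by
    intro y hy
    induction hy with
    | refl => exact Reachable.refl _
    | @tail x y _ hxy ih =>
      refine ih.trans (Adj.reachable (deleteEdges_adj.2 ⟨hxy.1, ?_⟩))
      simp [hxy.2.1, hxy.2.2]
  have h3 : (G.deleteEdges {s(r, b₁)}).Adj b₂ r := by
    rw [deleteEdges_adj]
    refine ⟨h2.symm, ?_⟩
    simp [hne.symm, h2.ne']
  obtain ⟨u, p, hp, hpe⟩ := adj_and_reachable_delete_edges_iff_exists_cycle.1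
    ⟨h1, ((hr _ h).trans h3.reachable).symm⟩
  exact ⟨_, ⟨u, p, hp, rfl⟩, by rwa [Walk.mem_edges_toSubgraph]⟩

/-- The rest of the cycle without `r` is a path that contains `a`, so the branch towards `a`
swallows it with everything that hangs there. -/
lemma hangingPart_subset_branch (hG : G.IsCactus) (hC : C ∈ G.cycleSubgraphs) {r a u : V}
    (ha : s(r, a) ∈ C.edgeSet) (hu : u ∈ C.verts) (hur : u ≠ r) :
    G.hangingPart C u ⊆ G.branch r a := by
  obtain ⟨g, f, lab, h, rfl⟩ := exists_gates_zero hG hC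
    (C.mem_verts_of_mem_edge ha (Sym2.mem_mk_left _ _))
  have h3 := h.three_le
  have har : a ≠ f 0 := (C.edgeSet_subset ha : G.Adj _ _).ne'
  have hne : ∀ j < g, j ≠ 0 → f j ≠ f 0 := fun j hj h0 h' =>
    h0 (h.inj j hj 0 (by omega) h')
  have hall : ∀ j < g, j ≠ 0 → (f j ∈ G.branch (f 0) a ↔ f 1 ∈ G.branch (f 0) a) := by
    intro j
    induction j with
    | zero => simp
    | succ j ih =>
      intro hj _
      rcases Nat.eq_zero_or_pos j with rfl | hj0
      · rfl
      rw [← ih (by omega) (by omega)]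
      have hadj := h.adj (show j < g by omega)
      exact ⟨fun h' => mem_branch_of_adj h' hadj.symm (hne _ hj (by omega))
        (hne _ (by omega) (by omega)), fun h' => mem_branch_of_adj h' hadj
        (hne _ (by omega) (by omega)) (hne _ hj (by omega))⟩
  have h1 : f 1 ∈ G.branch (f 0) a := by
    obtain ⟨m, hm, rfl⟩ := (h.verts a).1 (C.mem_verts_of_mem_edge ha (Sym2.mem_mk_right _ _))
    exact (hall m hm (fun h0 => har (by rw [h0]))).1 (mem_branch_self _ _)
  obtain ⟨j, hj, rfl⟩ := (h.verts u).1 hu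
  have hj0 : j ≠ 0 := fun h0 => hur (by rw [h0])
  intro x hx
  induction hx using hangingPart_induction with
  | self => exact (hall j hj hj0).2 h1
  | step x y hx hxy he ih =>
    rcases (isSepAt_branch har).2 x ih y hxy with h' | h'
    · exact h'
    · have := mem_hangingPart_of_adj hx hxy he
      rw [h', h.mem_iff _ _ hj, h.lab_f (by omega)] at this
      omega

/-- All vertices of a cycle hang at the same vertex of any other cycle. -/
lemma verts_subset_hangingPart (hG : G.IsCactus) (hC : C ∈ G.cycleSubgraphs)
    (hC' : C' ∈ G.cycleSubgraphs) (hne : C ≠ C') :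
    ∃ r ∈ C.verts, C'.verts ⊆ G.hangingPart C r := by
  obtain ⟨g, f, h⟩ := exists_cycLab hC'
  obtain ⟨r, hr, h0⟩ := exists_mem_hangingPart hG hC (f 0)
  refine ⟨r, hr, ?_⟩
  have key : ∀ i < g, f i ∈ G.hangingPart C r := by
    intro i
    induction i with
    | zero => exact fun _ => h0
    | succ i ih =>
      intro hi
      -- No edge of `C'` is an edge of `C`, so a walk around `C'` stays in one component of `G -
      -- E(C)`.
      refine mem_hangingPart_of_adj (ih (by omega)) (h.adj (by omega)) fun he => ?_
      exact Set.disjoint_left.1 (hG.2 hC hC' hne) he (h.mem_edgeSet (by omega))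
  intro x hx
  obtain ⟨i, hi, rfl⟩ := (h.verts x).1 hx
  exact key i hi

lemma exists_ne_mem_verts (hC : C ∈ G.cycleSubgraphs) (r : V) : ∃ u ∈ C.verts, u ≠ r := by
  obtain ⟨g, f, h⟩ := exists_cycLab hC
  have h3 := h.three_le
  by_cases h0 : f 0 = r
  · exact ⟨f 1, h.mem_verts (by omega), (h.adj (by omega)).ne' |> fun h' => h0 ▸ h'⟩
  · exact ⟨f 0, h.mem_verts (by omega), h0⟩

/-- If `C'` hangs at `r` on `C` and `C` hangs at `r'` on `C'`, then what hangs on `C` away from `r`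
hangs on `C'` at `r'`. -/
lemma hangingPart_subset_hangingPart (hG : G.IsCactus) (hC : C ∈ G.cycleSubgraphs) {r r' u : V}
    (hr : r ∈ C.verts) (h1 : C'.verts ⊆ G.hangingPart C r)
    (h2 : C.verts ⊆ G.hangingPart C' r') (hu : u ∈ C.verts) (hur : u ≠ r) :
    G.hangingPart C u ⊆ G.hangingPart C' r' := by
  intro x hx
  induction hx using hangingPart_induction with
  | self => exact h2 hu
  | step x y hx hxy he ih =>
    -- An edge of `C'` here would make one of its vertices hang at both `u` and `r`.
    refine mem_hangingPart_of_adj ih hxy fun he' => hur ?_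
    exact hangingPart_unique hG hC hu hr hx
      (h1 (C'.mem_verts_of_mem_edge he' (Sym2.mem_mk_left _ _)))

end Hanging

/-! ### Branch-active vertices, and BBR sets as hitting sets -/

section Branching

variable {V : Type*} [Fintype V] {G : SimpleGraph V} [DecidableRel G.Adj] {C C' : G.Subgraph}
  {S : Finset V}

lemma three_le_degree {r a b c : V} (ha : G.Adj r a) (hb : G.Adj r b) (hc : G.Adj r c)
    (hab : a ≠ b) (hac : a ≠ c) (hbc : b ≠ c) : 3 ≤ G.degree r := by
  classical
  have : ({a, b, c} : Finset V) ⊆ G.neighborFinset r := by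
    intro x hx
    simp only [Finset.mem_insert, Finset.mem_singleton] at hx
    rcases hx with rfl | rfl | rfl <;> simpa
  have h1 := Finset.card_le_card this
  rwa [card_neighborFinset_eq_degree, Finset.card_eq_three.2 ⟨a, b, c, hab, hac, hbc, rfl⟩] at h1

lemma four_le_degree {r a b c d : V} (ha : G.Adj r a) (hb : G.Adj r b) (hc : G.Adj r c)
    (hd : G.Adj r d) (hab : a ≠ b) (hac : a ≠ c) (had : a ≠ d) (hbc : b ≠ c) (hbd : b ≠ d)
    (hcd : c ≠ d) : 4 ≤ G.degree r := by
  classical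
  have : ({a, b, c, d} : Finset V) ⊆ G.neighborFinset r := by
    intro x hx
    simp only [Finset.mem_insert, Finset.mem_singleton] at hx
    rcases hx with rfl | rfl | rfl | rfl <;> simpa
  have h1 := Finset.card_le_card this
  rw [card_neighborFinset_eq_degree] at h1
  have h2 : ({a, b, c, d} : Finset V).card = 4 := by
    rw [Finset.card_insert_of_notMem (by simp [hab, hac, had]),
      Finset.card_eq_three.2 ⟨b, c, d, hbc, hbd, hcd, rfl⟩]
  omega

lemma degree_le_three {r a b c : V} (h : ∀ x, G.Adj r x → x = a ∨ x = b ∨ x = c) :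
    G.degree r ≤ 3 := by
  classical
  have : G.neighborFinset r ⊆ {a, b, c} := by
    intro x hx
    simpa using h x (by simpa using hx)
  have h1 := Finset.card_le_card this
  rw [card_neighborFinset_eq_degree] at h1
  exact h1.trans Finset.card_le_three

lemma degree_le_two {r a b : V} (h : ∀ x, G.Adj r x → x = a ∨ x = b) : G.degree r ≤ 2 := by
  classical
  have : G.neighborFinset r ⊆ {a, b} := by
    intro x hx
    simpa using h x (by simpa using hx)
  have h1 := Finset.card_le_card this
  rw [card_neighborFinset_eq_degree] at h1
  exact h1.trans Finset.card_le_two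

lemma three_le_degree_of_mem_verts (hC : C ∈ G.cycleSubgraphs) {r b : V} (hr : r ∈ C.verts)
    (hb : G.Adj r b) (he : s(r, b) ∉ C.edgeSet) : 3 ≤ G.degree r := by
  obtain ⟨c₁, c₂, hne, h1, h2, -⟩ := exists_nbrs hC hr
  exact three_le_degree (C.edgeSet_subset h1) (C.edgeSet_subset h2) hb hne
    (fun h => he (h ▸ h1)) (fun h => he (h ▸ h2))

lemma four_le_degree_of_mem_verts (hC : C ∈ G.cycleSubgraphs) {r b b' : V} (hr : r ∈ C.verts)
    (hb : G.Adj r b) (he : s(r, b) ∉ C.edgeSet) (hb' : G.Adj r b') (he' : s(r, b') ∉ C.edgeSet)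
    (hbb' : b ≠ b') : 4 ≤ G.degree r := by
  obtain ⟨c₁, c₂, hne, h1, h2, -⟩ := exists_nbrs hC hr
  exact four_le_degree (C.edgeSet_subset h1) (C.edgeSet_subset h2) hb hb' hne
    (fun h => he (h ▸ h1)) (fun h => he' (h ▸ h1)) (fun h => he (h ▸ h2)) (fun h => he' (h ▸ h2))
    hbb'

lemma four_le_degree_of_two_cycles (hG : G.IsCactus) (hC : C ∈ G.cycleSubgraphs)
    (hC' : C' ∈ G.cycleSubgraphs) (hne : C ≠ C') {r : V} (hr : r ∈ C.verts) (hr' : r ∈ C'.verts) :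
    4 ≤ G.degree r := by
  obtain ⟨c₁, c₂, hc, h1, h2, -⟩ := exists_nbrs hC' hr'
  have hd := Set.disjoint_right.1 (hG.2 hC hC' hne)
  exact four_le_degree_of_mem_verts hC hr (C'.edgeSet_subset h1) (hd h1) (C'.edgeSet_subset h2)
    (hd h2) hc

/-- A leaf is on no cycle. By induction from the leaf, an inner vertex of degree two has a neighbour
off the cycle, whereas a vertex of the cycle with such a neighbour has degree at least three. -/
lemma Tail.notMem_verts {v : V} {P : List V} (h : G.Tail v P) (hC : C ∈ G.cycleSubgraphs) {x : V}
    (hx : x ∈ P) : x ∉ C.verts := by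
  induction h generalizing x with
  | @leaf _ a h1 h2 =>
    intro hxC
    simp only [List.mem_singleton] at hx
    subst hx
    obtain ⟨c₁, c₂, hc, h3, h4, -⟩ := exists_nbrs hC hxC
    exact hc ((eq_of_degree_eq_one h1 h2 (C.edgeSet_subset h3)).trans
      (eq_of_degree_eq_one h1 h2 (C.edgeSet_subset h4)).symm)
  | @snoc _ a P h1 h2 h3 h4 ih =>
    simp only [List.mem_append, List.mem_singleton] at hx
    rcases hx with hx | rfl
    · exact ih hx
    · intro hxC
      obtain ⟨c₁, c₂, hc, h5, h6, -⟩ := exists_nbrs hC hxC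
      obtain ⟨u, hu, hu'⟩ := h1.exists_adj
      have := ih hu
      by_cases hcu : s(x, u) ∈ C.edgeSet
      · exact this (C.mem_verts_of_mem_edge hcu (Sym2.mem_mk_right _ _))
      · have := three_le_degree_of_mem_verts hC hxC hu'.symm hcu
        omega

lemma Tail.mem_hangingPart_iff {v : V} {P : List V} (h : G.Tail v P) (hC : C ∈ G.cycleSubgraphs)
    {x r : V} (hx : x ∈ P) : x ∈ G.hangingPart C r ↔ v ∈ G.hangingPart C r := by
  have hP : ∀ {a b : V}, a ∈ P → s(a, b) ∉ C.edgeSet := fun ha he =>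
    h.notMem_verts hC ha (C.mem_verts_of_mem_edge he (Sym2.mem_mk_left _ _))
  have key : ∀ {y}, y ∈ P → (y ∈ G.hangingPart C r ↔ v ∈ G.hangingPart C r) := by
    clear hx
    intro y hy
    induction h with
    | leaf h1 h2 =>
      simp only [List.mem_singleton] at hy
      subst hy
      exact ⟨fun h => mem_hangingPart_of_adj h h2 (hP (by simp)),
        fun h => mem_hangingPart_of_adj h h2.symm (by rw [Sym2.eq_swap]; exact hP (by simp))⟩
    | @snoc v a P h1 h2 h3 h4 ih =>
      have ha : a ∈ G.hangingPart C r ↔ v ∈ G.hangingPart C r :=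
        ⟨fun h => mem_hangingPart_of_adj h h3 (hP (by simp)),
          fun h => mem_hangingPart_of_adj h h3.symm (by rw [Sym2.eq_swap]; exact hP (by simp))⟩
      simp only [List.mem_append, List.mem_singleton] at hy
      rcases hy with hy | rfl
      · rw [ih (fun ha => hP (List.mem_append_left _ ha)) hy, ha]
      · exact ha
  exact key hx

lemma Tail.eq_of_free (hS : G.IsBranchResolving S) {v : V} {P Q : List V} (hv : 3 ≤ G.degree v)
    (hP : G.Tail v P) (hQ : G.Tail v Q) (hPS : ∀ x ∈ P, x ∉ S) (hQS : ∀ x ∈ Q, x ∉ S) : P = Q :=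
  hS v P Q ⟨isThread_iff.2 ⟨hv, hP⟩, hPS⟩ ⟨isThread_iff.2 ⟨hv, hQ⟩, hQS⟩

/-- If all branches off the cycle `C` at `u` are free tails, then `u` is not branch-active. -/
lemma not_isBranchActive (hC : C ∈ G.cycleSubgraphs) (hS : G.IsBranchResolving S) {u : V}
    (hu : u ∈ C.verts) (h : ∀ b, G.Adj u b → s(u, b) ∉ C.edgeSet →
      ∃ P, G.Tail u P ∧ b ∈ P ∧ ∀ x ∈ P, x ∉ S) : ¬ G.IsBranchActive C u := by
  rintro ⟨-, h4⟩
  -- Two branches off `C` would be two free threads at `u`.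
  have huniq : ∀ b b', G.Adj u b → s(u, b) ∉ C.edgeSet → G.Adj u b' → s(u, b') ∉ C.edgeSet →
      b = b' := by
    intro b b' hb he hb' he'
    obtain ⟨P, hP, hbP, hPS⟩ := h b hb he
    obtain ⟨Q, hQ, hbQ, hQS⟩ := h b' hb' he'
    obtain rfl := hP.eq_of_free hS (three_le_degree_of_mem_verts hC hu hb he) hQ hPS hQS
    exact hP.adj_unique hbP hbQ hb.symm hb'.symm
  obtain ⟨c₁, c₂, hc, h1, h2, h3⟩ := exists_nbrs hC hu
  rcases h4 with h4 | ⟨x, hx, hxu, hx3⟩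
  · have : ∃ b, ∀ x, G.Adj u x → s(u, x) ∉ C.edgeSet → x = b := by
      by_cases hb : ∃ b, G.Adj u b ∧ s(u, b) ∉ C.edgeSet
      · obtain ⟨b, hb, he⟩ := hb
        exact ⟨b, fun x hx hxe => huniq _ _ hx hxe hb he⟩
      · push Not at hb
        exact ⟨u, fun x hx hxe => absurd (hb x hx) hxe⟩
    obtain ⟨b, hb⟩ := this
    have := degree_le_three (G := G) (r := u) (a := c₁) (b := c₂) (c := b) fun x hx => by
      by_cases he : s(u, x) ∈ C.edgeSet
      · rcases h3 x he with h | h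
        · exact Or.inl h
        · exact Or.inr (Or.inl h)
      · exact Or.inr (Or.inr (hb x hx he))
    omega
  · rcases hangingPart_cases hx with rfl | ⟨b, hb, he, hxb⟩
    · exact hxu rfl
    · obtain ⟨P, hP, hbP, -⟩ := h b hb he
      have := hP.degree_le (hP.isSepAt.branch_subset hbP hxb)
      omega

/-- The part of `G` that hangs at those vertices of `C` which are not branch-active. -/
def privatePart (G : SimpleGraph V) [DecidableRel G.Adj] (C : G.Subgraph) : Set V :=
  {x | ∃ u ∈ C.verts, ¬ G.IsBranchActive C u ∧ x ∈ G.hangingPart C u}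

/-- Branch-resolving sets which meet the private part of every end-cycle. -/
def IsHitting (G : SimpleGraph V) [DecidableRel G.Adj] (S : Finset V) : Prop :=
  G.IsBranchResolving S ∧ ∀ C, G.IsEndCycle C → ∃ s ∈ S, s ∈ G.privatePart C

/-- Either the two cycles meet in `r`, which then has degree at least four, or the vertex of `C'` at
which `C` hangs has two neighbours on `C'` and a third one towards `C`. -/
lemma isBranchActive_of_subset (hG : G.IsCactus) (hC : C ∈ G.cycleSubgraphs)
    (hC' : C' ∈ G.cycleSubgraphs) (hne : C ≠ C') {r : V} (hr : r ∈ C.verts)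
    (hsub : C'.verts ⊆ G.hangingPart C r) : G.IsBranchActive C r := by
  refine ⟨hr, ?_⟩
  by_cases hrC : r ∈ C'.verts
  · exact Or.inl (four_le_degree_of_two_cycles hG hC hC' hne hr hrC)
  · obtain ⟨r', hr', hsub'⟩ := verts_subset_hangingPart hG hC' hC hne.symm
    refine Or.inr ⟨r', hsub hr', fun h => hrC (h ▸ hr'), ?_⟩
    obtain ⟨u, hu, hur⟩ := exists_ne_mem_verts hC r'
    rcases hangingPart_cases (hsub' hu) with h | ⟨b, hb, he, -⟩
    · exact absurd h hur
    · exact three_le_degree_of_mem_verts hC' hr' hb he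

lemma exists_isBranchActive (hG : G.IsCactus) (hc : 2 ≤ G.cycleSubgraphs.ncard)
    (hC : C ∈ G.cycleSubgraphs) : ∃ v, G.IsBranchActive C v := by
  obtain ⟨C', hC', hne⟩ := Set.exists_ne_of_one_lt_ncard (a := C) (s := G.cycleSubgraphs)
    (by omega)
  obtain ⟨r, hr, hsub⟩ := verts_subset_hangingPart hG hC hC' hne.symm
  exact ⟨r, isBranchActive_of_subset hG hC hC' hne.symm hr hsub⟩

/-- A branch which contains no vertex of a hitting set is a tail. -/
theorem IsHitting.exists_tail (hG : G.IsCactus) (hc : 2 ≤ G.cycleSubgraphs.ncard)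
    (hS : G.IsHitting S) {r a : V} (hra : G.Adj r a) (hfree : ∀ s ∈ S, s ∉ G.branch r a) :
    ∃ P, G.Tail r P ∧ a ∈ P ∧ ∀ x ∈ P, x ∈ G.branch r a := by
  induction hn : (G.branch r a).ncard using Nat.strong_induction_on generalizing r a with
  | _ n ih =>
  subst hn
  have hsmall : ∀ {u b : V}, G.Adj u b → G.branch u b ⊆ G.branch r a → u ∈ G.branch r a →
      ∃ P, G.Tail u P ∧ b ∈ P ∧ ∀ x ∈ P, x ∈ G.branch u b := fun {u b} hub hsub hu =>
    ih _ (Set.ncard_lt_ncard ⟨hsub, fun h => notMem_branch hub.ne' (h hu)⟩ (Set.toFinite _)) hub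
      (fun s hs hsb => hfree s hs (hsub hsb)) rfl
  by_cases hcyc : ∃ C ∈ G.cycleSubgraphs, s(r, a) ∈ C.edgeSet
  -- On a cycle through `r` and `a`, the branches off the other vertices are smaller, hence free
  -- tails, and these vertices are not branch-active. So the cycle is an end-cycle whose private
  -- part lies in the branch, although a hitting set meets it.
  · exfalso
    obtain ⟨C, hC, hraC⟩ := hcyc
    have hsub := fun {u} hu hur => hangingPart_subset_branch hG hC (u := u) hraC hu hur
    have hnba : ∀ u ∈ C.verts, u ≠ r → ¬ G.IsBranchActive C u := by
      intro u hu hur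
      refine not_isBranchActive hC hS.1 hu fun b hb he => ?_
      have hbs : G.branch u b ⊆ G.branch r a :=
        (branch_subset_hangingPart hG hC hu hb he).trans (Set.sdiff_subset.trans (hsub hu hur))
      obtain ⟨P, hP, hbP, hPb⟩ := hsmall hb hbs (hsub hu hur (mem_hangingPart_self C u))
      exact ⟨P, hP, hbP, fun x hx hxS => hfree x hxS (hbs (hPb x hx))⟩
    obtain ⟨v, hv⟩ := exists_isBranchActive hG hc hC
    have hend : G.IsEndCycle C := by
      refine ⟨hC, Set.ncard_eq_one.2 ⟨r, ?_⟩⟩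
      ext x
      simp only [Set.mem_ofPred_eq, Set.mem_singleton_iff]
      constructor
      · intro hx
        by_contra hxr
        exact hnba x hx.1 hxr hx
      · rintro rfl
        by_contra hx
        exact hnba v hv.1 (fun h => hx (h ▸ hv)) hv
    obtain ⟨s, hs, u, hu, hub, hsu⟩ := hS.2 C hend
    have hur : u ≠ r := by
      rintro rfl
      obtain ⟨x, hx⟩ := Set.ncard_eq_one.1 hend.2
      have h1 : v ∈ {v | G.IsBranchActive C v} := hv
      by_cases hvu : v = u
      · exact hub (hvu ▸ hv)
      · exact hnba v hv.1 hvu hv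
    exact hfree s hs (hsub hu hur hsu)
  -- Now the edge from `r` to `a` is a bridge. The further branches at `a` are free tails by
  -- induction; two of them would be two free threads at `a`, so there is at most one, and `a`
  -- prolongs it.
  · have hrb : ∀ b, G.Adj a b → b ≠ r → r ∉ G.branch a b := by
      intro b hb hbr hr
      obtain ⟨C, hC, he⟩ := exists_cycle_of_mem_branch hra.symm hb hbr.symm (branch_symm hr)
      exact hcyc ⟨C, hC, by rwa [Sym2.eq_swap]⟩
    have hbs : ∀ b, G.Adj a b → b ≠ r → G.branch a b ⊆ G.branch r a := by
      intro b hb hbr x hx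
      induction hx with
      | refl => exact mem_branch_of_adj (mem_branch_self _ _) hb hra.ne' hbr
      | @tail x y hx hxy ih' =>
        have hy : y ∈ G.branch a b := mem_branch_of_adj hx hxy.1 hxy.2.1 hxy.2.2
        exact mem_branch_of_adj ih' hxy.1 (fun h => hrb b hb hbr (h ▸ hx))
          (fun h => hrb b hb hbr (h ▸ hy))
    have ht : ∀ b, G.Adj a b → b ≠ r → ∃ P, G.Tail a P ∧ b ∈ P ∧ ∀ x ∈ P, x ∈ G.branch a b :=
      fun b hb hbr => hsmall hb (hbs b hb hbr) (mem_branch_self _ _)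
    by_cases hb : ∃ b, G.Adj a b ∧ b ≠ r
    · obtain ⟨b, hb, hbr⟩ := hb
      obtain ⟨P, hP, hbP, hPb⟩ := ht b hb hbr
      have hPS : ∀ x ∈ P, x ∉ S := fun x hx hxS => hfree x hxS (hbs b hb hbr (hPb x hx))
      have hdeg : G.degree a = 2 := by
        refine le_antisymm (degree_le_two (a := b) (b := r) fun x hx => ?_) ?_
        · by_contra! hne
          obtain ⟨Q, hQ, hxQ, hQb⟩ := ht x hx hne.2
          obtain rfl := hP.eq_of_free hS.1 (three_le_degree hb hx hra.symm (Ne.symm hne.1) hbr hne.2)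
            hQ hPS (fun y hy hyS => hfree y hyS (hbs x hx hne.2 (hQb y hy)))
          exact hne.1 (hP.adj_unique hxQ hbP hx.symm hb.symm)
        · by_contra! hlt
          have : G.degree a = 1 := by
            have : 0 < G.degree a := G.degree_pos_iff_exists_adj a |>.2 ⟨r, hra.symm⟩
            omega
          exact hbr (eq_of_degree_eq_one this hra.symm hb)
      refine ⟨P ++ [a], .snoc hP hdeg hra.symm fun h => hrb b hb hbr (hPb r h), by simp, ?_⟩
      intro x hx
      simp only [List.mem_append, List.mem_singleton] at hx
      rcases hx with hx | rfl
      · exact hbs b hb hbr (hPb x hx)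
      · exact mem_branch_self _ _
    · push Not at hb
      refine ⟨[a], .leaf ?_ hra.symm, by simp, by simp [mem_branch_self]⟩
      exact G.degree_eq_one_iff_existsUnique_adj.2 ⟨r, hra.symm, hb⟩

lemma IsHitting.exists_mem_hangingPart (hG : G.IsCactus) (hc : 2 ≤ G.cycleSubgraphs.ncard)
    (hS : G.IsHitting S) (hC : C ∈ G.cycleSubgraphs) {v : V} (hv : G.IsBranchActive C v) :
    ∃ s ∈ S, s ∈ G.hangingPart C v := by
  by_contra! hno
  refine not_isBranchActive hC hS.1 hv.1 (fun b hb he => ?_) hv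
  have hsub := branch_subset_hangingPart hG hC hv.1 hb he
  obtain ⟨P, hP, hbP, hPb⟩ := hS.exists_tail hG hc hb fun s hs hsb => hno s hs (hsub hsb).1
  exact ⟨P, hP, hbP, fun x hx hxS => hno x hxS (hsub (hPb x hx)).1⟩

lemma IsHitting.isSActive (hG : G.IsCactus) (hc : 2 ≤ G.cycleSubgraphs.ncard)
    (hS : G.IsHitting S) (hC : C ∈ G.cycleSubgraphs) {v : V} (hv : G.IsBranchActive C v) :
    G.IsSActive S C v := ⟨hv.1, hS.exists_mem_hangingPart hG hc hC hv⟩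

lemma IsBBR.isHitting (hS : G.IsBBR S) : G.IsHitting S := by
  refine ⟨hS.2, fun C hC => ?_⟩
  have h2 := hS.1 C hC.1
  rw [numSActive] at h2
  obtain ⟨x, hx⟩ := Set.ncard_eq_one.1 hC.2
  obtain ⟨u, ⟨hu, s, hs, hsu⟩, hne⟩ := Set.exists_ne_of_one_lt_ncard h2 x
  refine ⟨s, hs, u, hu, fun hub => hne ?_, hsu⟩
  have : u ∈ {v | G.IsBranchActive C v} := hub
  rwa [hx] at this

/-- A hitting set makes all branch-active vertices active. Only a cycle with a single branch-active
vertex needs more, and these are the end-cycles. -/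
lemma IsHitting.isBBR (hG : G.IsCactus) (hc : 2 ≤ G.cycleSubgraphs.ncard) (hS : G.IsHitting S) :
    G.IsBBR S := by
  refine ⟨fun C hC => ?_, hS.1⟩
  obtain ⟨v, hv⟩ := exists_isBranchActive hG hc hC
  have key : ∃ u, u ≠ v ∧ G.IsSActive S C u := by
    by_cases hend : G.IsEndCycle C
    · obtain ⟨s, hs, u, hu, hub, hsu⟩ := hS.2 C hend
      exact ⟨u, fun h => hub (h ▸ hv), hu, s, hs, hsu⟩
    · have hne : {v | G.IsBranchActive C v}.ncard ≠ 1 := fun h => hend ⟨hC, h⟩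
      have hpos : 0 < {v | G.IsBranchActive C v}.ncard :=
        (Set.ncard_pos (Set.toFinite _)).2 ⟨v, hv⟩
      obtain ⟨u, hu, huv⟩ := Set.exists_ne_of_one_lt_ncard
        (show 1 < {v | G.IsBranchActive C v}.ncard by omega) v
      exact ⟨u, huv, hS.isSActive hG hc hC hu⟩
  obtain ⟨u, huv, hu⟩ := key
  exact (Set.one_lt_ncard (Set.toFinite _)).2 ⟨u, hu, v, hS.isSActive hG hc hC hv, huv⟩

end Branching

/-! ### `S`-paths and distances along a labelled cycle -/

section Labellings

variable {V : Type*} {G : SimpleGraph V} {C : G.Subgraph} {S : Finset V}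

lemma exists_isActiveLabelling {v : V} {w : G.Walk v v} (hw : w.IsCycle)
    (hv : G.IsSActive S w.toSubgraph v) : ∃ k, G.IsActiveLabelling S w.toSubgraph w k := by
  have hne : {i | i < w.length ∧ G.IsSActive S w.toSubgraph (w.getVert i)}.Nonempty :=
    ⟨0, by have := hw.three_le_length; exact ⟨by omega, by rwa [w.getVert_zero]⟩⟩
  have hfin : {i | i < w.length ∧ G.IsSActive S w.toSubgraph (w.getVert i)}.Finite :=
    (Set.finite_lt_nat w.length).subset fun i hi => hi.1
  obtain ⟨k, hk, hmax⟩ := Set.exists_max_image _ id hfin hne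
  exact ⟨k, hw, rfl, hv, hk, fun j hj => hmax j hj⟩

lemma exists_isSPathLabelling (hC : C ∈ G.cycleSubgraphs) {x : V} (hx : G.IsSActive S C x) :
    ∃ (v : V) (w : G.Walk v v) (k : ℕ), G.IsSPathLabelling S C w k := by
  classical
  have hex : ∃ k, ∃ (v : V) (w : G.Walk v v), G.IsActiveLabelling S C w k := by
    obtain ⟨v, w, hw, rfl⟩ := hC
    obtain ⟨a, ha, rfl⟩ := ((cycLab_getVert hw).verts x).1 hx.1
    obtain ⟨w', hw', h1, -⟩ := exists_getVert_rotate hw ha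
    rw [← h1] at hx ⊢
    obtain ⟨k, hk⟩ := exists_isActiveLabelling hw' hx
    exact ⟨k, _, w', hk⟩
  obtain ⟨v, w, hw⟩ := Nat.find_spec hex
  exact ⟨v, w, _, hw, fun v' w' k' h => Nat.find_min' hex ⟨v', w', h⟩⟩

namespace IsSPathLabelling

variable {v : V} {w : G.Walk v v} {k : ℕ} (hL : G.IsSPathLabelling S C w k)
include hL

lemma cycLab : CycLab G C w.length w.getVert := hL.1.2.1 ▸ cycLab_getVert hL.1.1

/-- An arc of length `r` that starts at `a` covers all active vertices. The labelling that starts at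
the first of them competes with `w`. -/
lemma le_of_arc {a r : ℕ} (ha : a < w.length)
    (h : ∀ j < w.length, G.IsSActive S C (w.getVert j) →
      (if a ≤ j then j - a else j + w.length - a) ≤ r) : k ≤ r := by
  obtain ⟨⟨hw, rfl, hv, -⟩, hmin⟩ := hL
  have hC := cycLab_getVert hw
  have key : ∀ {b}, b < w.length → G.IsSActive S w.toSubgraph (w.getVert b) →
      (∀ j < w.length, G.IsSActive S w.toSubgraph (w.getVert j) →
      (if b ≤ j then j - b else j + w.length - b) ≤ r) → k ≤ r := by
    intro b hb hab h
    obtain ⟨w', hw', h1, h2, h3⟩ := exists_getVert_rotate hw hb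
    obtain ⟨k', hk'⟩ := exists_isActiveLabelling hw' (h1 ▸ hab)
    refine (hmin _ w' k' (h1 ▸ hk')).trans ?_
    obtain ⟨hk1, hk2⟩ := hk'.2.2.2.1
    rw [h2] at hk1
    rw [h3 k' hk1, h1] at hk2
    have := h _ (by split_ifs <;> omega) hk2
    split_ifs at this <;> omega
  obtain ⟨b, ⟨hb, hab⟩, hbmin⟩ := Set.exists_min_image
    {j | j < w.length ∧ G.IsSActive S w.toSubgraph (w.getVert j)}
    (fun j => if a ≤ j then j - a else j + w.length - a)
    ((Set.finite_lt_nat w.length).subset fun i hi => hi.1) ⟨0, by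
      have := hw.three_le_length; exact ⟨by omega, by rwa [w.getVert_zero]⟩⟩
  refine key hb hab fun j hj haj => ?_
  have h1 := hbmin j ⟨hj, haj⟩
  have h2 := h j hj haj
  split_ifs at h1 h2 ⊢ <;> omega

lemma lt_length : k < w.length := hL.1.2.2.2.1.1

variable {lab : V → ℕ} (h : Gates G C w.length w.getVert lab)
include h

lemma lab_le {s : V} (hs : s ∈ S) : lab s ≤ k :=
  hL.1.2.2.2.2 ⟨h.lt s, (h.isSActive_iff (h.lt s)).2 ⟨s, hs, rfl⟩⟩

lemma exists_lab_zero : ∃ s ∈ S, lab s = 0 := by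
  have h3 := h.three_le
  have := hL.1.2.2.1
  rw [← w.getVert_zero] at this
  exact (h.isSActive_iff (by omega)).1 this

lemma exists_lab_eq : ∃ s ∈ S, lab s = k :=
  (h.isSActive_iff (hL.lt_length)).1 hL.1.2.2.2.1.2

lemma le_of_lab {a r : ℕ} (ha : a < w.length)
    (hr : ∀ s ∈ S, (if a ≤ lab s then lab s - a else lab s + w.length - a) ≤ r) : k ≤ r := by
  refine hL.le_of_arc ha fun j hj hj' => ?_
  obtain ⟨s, hs, rfl⟩ := (h.isSActive_iff hj).1 hj'
  exact hr s hs

end IsSPathLabelling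

lemma Gates.lab_eq_or_eq [Finite V] {g : ℕ} {f : ℕ → V} {lab : V → ℕ} (h : Gates G C g f lab)
    (h2 : G.numSActive S C = 2) {s t u : V} (hs : s ∈ S) (ht : t ∈ S) (hu : u ∈ S)
    (hst : lab s ≠ lab t) : lab u = lab s ∨ lab u = lab t := by
  have hact : ∀ {x}, x ∈ S → f (lab x) ∈ {v | G.IsSActive S C v} := fun {x} hx =>
    (h.isSActive_iff (h.lt x)).2 ⟨x, hx, rfl⟩
  by_contra! hne
  have hf : ∀ {x y}, lab x ≠ lab y → f (lab x) ≠ f (lab y) := fun {x y} hxy hxy' =>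
    hxy (h.inj _ (h.lt x) _ (h.lt y) hxy')
  have := (Set.two_lt_ncard (Set.toFinite _)).2
    ⟨_, hact hs, _, hact ht, _, hact hu, hf hst, hf hne.1.symm, hf hne.2.symm⟩
  rw [numSActive] at h2
  omega

/-- The distance of the vertex with label `j` to the edge `r, r + 1` on a cycle of length `g`. -/
def cycEdgeDist (g j r : ℕ) : ℕ :=
  min (cycDist g j r) (cycDist g j (if r + 1 < g then r + 1 else 0))

lemma cycDist_cases {g i j : ℕ} (hi : i < g) (hj : j < g) :
    (i ≤ j ∧ 2 * j ≤ 2 * i + g ∧ cycDist g i j + i = j) ∨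
    (i ≤ j ∧ 2 * i + g ≤ 2 * j ∧ cycDist g i j + j = g + i) ∨
    (j ≤ i ∧ 2 * i ≤ 2 * j + g ∧ cycDist g i j + j = i) ∨
    (j ≤ i ∧ 2 * j + g ≤ 2 * i ∧ cycDist g i j + i = g + j) := by
  simp only [cycDist]
  rcases le_total i j with h | h
  · rw [max_eq_right h, min_eq_left h]
    omega
  · rw [max_eq_left h, min_eq_right h]
    omega

lemma cycEdgeDist_cases {g j r : ℕ} (hj : j < g) (hr : r < g) :
    (j ≤ r ∧ 2 * r + 1 ≤ 2 * j + g ∧ cycEdgeDist g j r + j = r) ∨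
    (j ≤ r ∧ 2 * j + g ≤ 2 * r + 1 ∧ cycEdgeDist g j r + r + 1 = g + j) ∨
    (r < j ∧ 2 * j ≤ 2 * r + g + 1 ∧ cycEdgeDist g j r + r + 1 = j) ∨
    (r < j ∧ 2 * r + g + 1 ≤ 2 * j ∧ cycEdgeDist g j r + j = g + r) := by
  simp only [cycEdgeDist]
  have h1 := cycDist_cases hj hr
  split_ifs with h
  · have h2 := cycDist_cases hj h
    omega
  · have h2 := cycDist_cases hj (show 0 < g by omega)
    omega

lemma Gates.vertexEdgeDist_edge (hG : G.Connected) {g : ℕ} {f : ℕ → V} {lab : V → ℕ}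
    (h : Gates G C g f lab) (x : V) {r : ℕ} (hr : r < g) :
    G.vertexEdgeDist x s(f r, f (r + 1)) =
      G.dist x (f (lab x)) + cycEdgeDist g (lab x) r := by
  have h3 := h.three_le
  have : G.dist x (f (r + 1)) =
      G.dist x (f (lab x)) + cycDist g (lab x) (if r + 1 < g then r + 1 else 0) := by
    split_ifs with h1
    · exact h.dist_f_right hG x h1
    · rw [show r + 1 = g by omega, h.wrap, h.dist_f_right hG x (by omega)]
  rw [vertexEdgeDist_mk, this, h.dist_f_right hG x hr, cycEdgeDist]
  omega

end Labellings

/-! ### Necessity: pairs of edges that cannot be distinguished -/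

section Necessity

variable {V : Type*} [Fintype V] {G : SimpleGraph V} [DecidableRel G.Adj] {C C' : G.Subgraph}
  {T : Finset V}

/-- If all of `T` hangs at one vertex of `C`, the two edges of `C` at this vertex have the same
distances. -/
lemma IsEdgeMetricGenerator.isBiactive (hG : G.IsCactus) (hT : G.IsEdgeMetricGenerator T) :
    G.IsBiactive T := by
  intro C hC
  by_contra hlt
  have hr : ∃ r ∈ C.verts, ∀ s ∈ T, s ∈ G.hangingPart C r := by
    have hact : ∀ s ∈ T, ∃ r, G.IsSActive T C r ∧ s ∈ G.hangingPart C r := by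
      intro s hs
      obtain ⟨r, hr, hsr⟩ := exists_mem_hangingPart hG hC s
      exact ⟨r, ⟨hr, s, hs, hsr⟩, hsr⟩
    have hle : {v | G.IsSActive T C v}.ncard ≤ 1 := by
      rw [numSActive] at hlt
      omega
    rcases T.eq_empty_or_nonempty with rfl | ⟨t, ht⟩
    · obtain ⟨u, hu, -⟩ := exists_ne_mem_verts hC (exists_ne_mem_verts hC hG.1.nonempty.some).choose
      exact ⟨u, hu, by simp⟩
    · obtain ⟨r, hr, htr⟩ := hact t ht
      refine ⟨r, hr.1, fun s hs => ?_⟩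
      obtain ⟨r', hr', hsr'⟩ := hact s hs
      have := (Set.ncard_le_one (Set.toFinite _)).1 hle r hr r' hr'
      rwa [this]
  obtain ⟨r, hr, hrT⟩ := hr
  obtain ⟨g, f, lab, h, rfl⟩ := exists_gates_zero hG hC hr
  have h3 := h.three_le
  obtain ⟨s, hs, hne⟩ := hT s(f 0, f (0 + 1)) (C.edgeSet_subset (h.mem_edgeSet (by omega)))
    s(f (g - 1), f (g - 1 + 1)) (C.edgeSet_subset (h.mem_edgeSet (by omega)))
    (fun h' => by have := h.edge_inj (by omega) (by omega) h'; omega)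
  apply hne
  rw [h.vertexEdgeDist_edge hG.1 s (by omega), h.vertexEdgeDist_edge hG.1 s (by omega),
    (h.mem_iff s 0 (by omega)).1 (hrT s hs)]
  have h4 := cycEdgeDist_cases (show 0 < g by omega) (show 0 < g by omega)
  have h5 := cycEdgeDist_cases (show 0 < g by omega) (show g - 1 < g by omega)
  omega

lemma Tail.edge_ne {v v' : V} {P P' : List V} {e e' : Sym2 V} {t : ℕ} (hP : G.Tail v P)
    (he : G.IsTailEdge P t e) (hP' : ∀ x ∈ P, x ∉ P') (hv' : v' ∉ P)
    (he' : ∀ x ∈ e', x ∈ P' ∨ x = v') : e ≠ e' := by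
  rintro rfl
  obtain ⟨a, ha, hae⟩ := (hP.edge_mem he).2.1
  rcases he' a hae with h | rfl
  · exact hP' a ha h
  · exact hv' ha

lemma Tail.notMem_of_degree {v v' : V} {P : List V} (hP : G.Tail v P) (h : 3 ≤ G.degree v') :
    v' ∉ P := fun hv => by
  have := hP.degree_le hv
  omega

/-- The edges at `v` of two free threads are both at distance `d(s, v)` from every `s ∈ T`. -/
lemma IsEdgeMetricGenerator.isBranchResolving (hG : G.IsCactus)
    (hT : G.IsEdgeMetricGenerator T) : G.IsBranchResolving T := by
  rintro v P Q ⟨hP, hPT⟩ ⟨hQ, hQT⟩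
  rw [isThread_iff] at hP hQ
  by_contra hne
  have hd : ∀ x ∈ P, x ∉ Q := fun x hx hx' =>
    hne (hP.2.unique hQ.2 (hQ.2.notMem) hP.2.notMem hx hx').2
  obtain ⟨e, he⟩ := hP.2.exists_edge (List.length_pos_of_ne_nil hP.2.ne_nil)
  obtain ⟨e', he'⟩ := hQ.2.exists_edge (List.length_pos_of_ne_nil hQ.2.ne_nil)
  obtain ⟨s, hs, hse⟩ := hT e (hP.2.edge_mem he).1 e' (hQ.2.edge_mem he').1
    (hP.2.edge_ne he hd hP.2.notMem (hQ.2.edge_mem he').2.2)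
  apply hse
  rw [hP.2.vertexEdgeDist hG.1 he (fun h => hPT s h hs),
    hQ.2.vertexEdgeDist hG.1 he' (fun h => hQT s h hs)]

lemma IsEdgeMetricGenerator.isBBR (hG : G.IsCactus) (hT : G.IsEdgeMetricGenerator T) :
    G.IsBBR T := ⟨hT.isBiactive hG, hT.isBranchResolving hG⟩

section Gates

variable {g : ℕ} {f : ℕ → V} {lab : V → ℕ} (h : Gates G C g f lab)
include h

lemma Tail.vertexEdgeDist_gates (hG : G.Connected) {i t : ℕ} (hi : i < g) {P : List V} {e : Sym2 V}
    (hP : G.Tail (f i) P) (he : G.IsTailEdge P t e) {s : V} (hs : s ∉ P) :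
    G.vertexEdgeDist s e = G.dist s (f (lab s)) + (cycDist g (lab s) i + t) := by
  rw [hP.vertexEdgeDist hG he hs, h.dist_f_right hG s hi, add_assoc]

lemma Gates.edge_subset {r : ℕ} (hr : r < g) : ∀ x ∈ s(f r, f (r + 1)), x ∈ C.verts := by
  intro x hx
  exact C.mem_verts_of_mem_edge (h.mem_edgeSet hr) hx

lemma IsEdgeMetricGenerator.false_of_edge_edge (hG : G.IsCactus) (hT : G.IsEdgeMetricGenerator T)
    {r r' : ℕ} (hr : r < g) (hr' : r' < g) (hne : r ≠ r')
    (heq : ∀ s ∈ T, cycEdgeDist g (lab s) r = cycEdgeDist g (lab s) r') : False := by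
  obtain ⟨s, hs, hse⟩ := hT _ (C.edgeSet_subset (h.mem_edgeSet hr)) _
    (C.edgeSet_subset (h.mem_edgeSet hr')) (fun h' => hne (h.edge_inj hr hr' h'))
  apply hse
  rw [h.vertexEdgeDist_edge hG.1 s hr, h.vertexEdgeDist_edge hG.1 s hr', heq s hs]

lemma IsEdgeMetricGenerator.false_of_thread_edge (hG : G.IsCactus)
    (hT : G.IsEdgeMetricGenerator T) {i t r : ℕ} {P : List V} (hi : i < g)
    (hP : G.IsFreeThread T (f i) P) (ht : t < P.length) (hr : r < g)
    (heq : ∀ s ∈ T, cycDist g (lab s) i + t = cycEdgeDist g (lab s) r) : False := by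
  obtain ⟨hP, hPT⟩ := hP
  rw [isThread_iff] at hP
  obtain ⟨e, he⟩ := hP.2.exists_edge ht
  obtain ⟨s, hs, hse⟩ := hT e (hP.2.edge_mem he).1 _ (C.edgeSet_subset (h.mem_edgeSet hr)) (by
    rintro rfl
    obtain ⟨a, ha, hae⟩ := (hP.2.edge_mem he).2.1
    exact hP.2.notMem_verts h.mem ha (h.edge_subset hr a hae))
  apply hse
  rw [hP.2.vertexEdgeDist_gates h hG.1 hi he (fun h => hPT s h hs),
    h.vertexEdgeDist_edge hG.1 s hr, heq s hs]

lemma IsEdgeMetricGenerator.false_of_thread_thread (hG : G.IsCactus)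
    (hT : G.IsEdgeMetricGenerator T) {i t i' t' : ℕ} {P P' : List V} (hi : i < g)
    (hP : G.IsFreeThread T (f i) P) (ht : t < P.length) (hi' : i' < g)
    (hP' : G.IsFreeThread T (f i') P') (ht' : t' < P'.length) (hne : i ≠ i')
    (heq : ∀ s ∈ T, cycDist g (lab s) i + t = cycDist g (lab s) i' + t') : False := by
  obtain ⟨hP, hPT⟩ := hP
  obtain ⟨hP', hPT'⟩ := hP'
  rw [isThread_iff] at hP hP'
  obtain ⟨e, he⟩ := hP.2.exists_edge ht
  obtain ⟨e', he'⟩ := hP'.2.exists_edge ht'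
  have h1 := hP.2.notMem_of_degree hP'.1
  have h2 := hP'.2.notMem_of_degree hP.1
  obtain ⟨s, hs, hse⟩ := hT e (hP.2.edge_mem he).1 e' (hP'.2.edge_mem he').1
    (hP.2.edge_ne he (fun x hx hx' => hne
      (h.inj _ hi _ hi' (hP.2.unique hP'.2 h2 h1 hx hx').1)) h1 (hP'.2.edge_mem he').2.2)
  apply hse
  rw [hP.2.vertexEdgeDist_gates h hG.1 hi he (fun h => hPT s h hs),
    hP'.2.vertexEdgeDist_gates h hG.1 hi' he' (fun h => hPT' s h hs), heq s hs]

end Gates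

/-- Each configuration hides a pair of edges. For A these are the two edges of the cycle at `v₀`,
which lie symmetrically to the axis through the two active vertices. For D they are the thread edge
at `v_i` and the cycle edge at `v_i` that points away from the active vertices. For E they are the
thread edge of depth `⌊g/2⌋ - k` at `v_i` and the thread edge at `v_j` if `g` is even, a cycle edge
if `g` is odd. -/
lemma IsEdgeMetricGenerator.not_containsADE (hG : G.IsCactus) (hT : G.IsEdgeMetricGenerator T)
    (C : G.Subgraph) : ¬ G.ContainsADE T C := by
  rintro ⟨v, w, k, hL, hADE⟩
  obtain ⟨lab, h⟩ := hL.cycLab.exists_gates hG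
  have h3 := h.three_le
  set g := w.length with hg
  have hkg : k < g := hL.lt_length
  have hle := fun s (hs : s ∈ T) => hL.lab_le h hs
  obtain ⟨s₀, hs₀, hl0⟩ := hL.exists_lab_zero h
  obtain ⟨s₁, hs₁, hl1⟩ := hL.exists_lab_eq h
  have h2 : G.numSActive T C = 2 → k ≠ 0 → ∀ s ∈ T, lab s = 0 ∨ lab s = k := by
    intro h2 hk s hs
    rw [← hl1, ← hl0]
    exact h.lab_eq_or_eq h2 hs₀ hs₁ hs (by omega)
  have hA : G.numSActive T C = 2 → Even g → k = g / 2 → False := by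
    rintro hn ⟨m, hm⟩ hk
    refine hT.false_of_edge_edge h hG (r := 0) (r' := g - 1) (by omega) (by omega) (by omega) ?_
    intro s hs
    have := h2 hn (by omega) s hs
    have h4 := cycEdgeDist_cases (h.lt s) (show 0 < g by omega)
    have h5 := cycEdgeDist_cases (h.lt s) (show g - 1 < g by omega)
    omega
  rcases hADE with ⟨hn, he, hk⟩ | ⟨hk, i, P, hP, hi⟩ | ⟨hn, i, hik, ⟨P, hP, hPl⟩, hQ⟩
  · exact hA hn he hk
  · have hPl : 0 < P.length := List.length_pos_of_ne_nil (isThread_iff.1 hP.1).2.ne_nil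
    rw [← hg] at hk
    rcases hi with hi | hi | rfl
    · rw [Set.mem_Icc, ← hg] at hi
      refine hT.false_of_thread_edge h hG (by omega) hP hPl (r := i) (by omega) fun s hs => ?_
      have := hle s hs
      have h4 := cycEdgeDist_cases (h.lt s) (show i < g by omega)
      have h5 := cycDist_cases (h.lt s) (show i < g by omega)
      omega
    · rw [Set.mem_Icc, ← hg] at hi
      refine hT.false_of_thread_edge h hG (by omega) hP hPl (r := i - 1) (by omega) fun s hs => ?_
      have := hle s hs
      have h4 := cycEdgeDist_cases (h.lt s) (show i - 1 < g by omega)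
      have h5 := cycDist_cases (h.lt s) (show i < g by omega)
      omega
    · refine hT.false_of_thread_edge h hG (by omega) hP hPl (r := g - 1) (by omega) fun s hs => ?_
      have := hle s hs
      have h4 := cycEdgeDist_cases (h.lt s) (show g - 1 < g by omega)
      have h5 := cycDist_cases (h.lt s) (show 0 < g by omega)
      omega
  · rw [← hg] at hPl hQ
    have hk0 : k ≠ 0 := by
      rintro rfl
      have : {v | G.IsSActive T C v} ⊆ {w.getVert 0} := by
        intro x hx
        obtain ⟨j, hj, rfl⟩ := (h.verts x).1 hx.1
        obtain ⟨s, hs, rfl⟩ := (h.isSActive_iff hj).1 hx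
        have := hle s hs
        rw [Set.mem_singleton_iff, show lab s = 0 by omega]
      have := Set.ncard_le_ncard this
      rw [Set.ncard_singleton] at this
      rw [numSActive] at hn
      omega
    have h2 := h2 hn hk0
    -- The complementary arc from `v_k` back to `v₀` covers both active vertices as well.
    have hkk : k ≤ g - k := by
      refine hL.le_of_lab h (a := k) hkg fun s hs => ?_
      rcases h2 s hs with h' | h' <;> rw [h'] <;> split_ifs <;> omega
    rcases Nat.even_or_odd' g with ⟨m, hm | hm⟩
    · obtain ⟨Q, hQ⟩ := hQ ⟨m, by omega⟩
      have hk2 : k ≠ g / 2 := fun h' => hA hn ⟨m, by omega⟩ h'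
      rw [Nat.mod_eq_of_lt (by omega)] at hQ
      refine hT.false_of_thread_thread h hG (t := g / 2 - k) (t' := 0) (by omega) hP (by omega)
        (by omega) hQ (List.length_pos_of_ne_nil (isThread_iff.1 hQ.1).2.ne_nil) (by omega) ?_
      intro s hs
      have h4 := cycDist_cases (h.lt s) (show i < g by omega)
      have h5 := cycDist_cases (h.lt s) (show g / 2 + (k - i) < g by omega)
      have := h2 s hs
      omega
    -- For odd `g` the index of the cycle edge is `⌊g/2⌋ + k - i`: this edge takes over the role of
    -- `v_j`.
    · refine hT.false_of_thread_edge h hG (t := g / 2 - k) (by omega) hP (by omega)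
        (r := g - (i + (g / 2 - k)) - 1) (by omega) ?_
      intro s hs
      have h4 := cycDist_cases (h.lt s) (show i < g by omega)
      have h5 := cycEdgeDist_cases (h.lt s) (show g - (i + (g / 2 - k)) - 1 < g by omega)
      have := h2 s hs
      omega

/-- The edge of `C` at `x` that is not on the `S`-path. The bound on `k` means that its other end is
nowhere closer to an active vertex than `x`. -/
lemma exists_edge_of_isEdgeCritical (hG : G.IsCactus) {x : V} (hx : G.IsEdgeCritical T C x) :
    ∃ e ∈ C.edgeSet, ∀ s ∈ T, G.vertexEdgeDist s e = G.dist s x := by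
  obtain ⟨v, w, k, hL, hxk, hk⟩ := hx
  obtain ⟨lab, h⟩ := hL.cycLab.exists_gates hG
  have h3 := h.three_le
  set g := w.length with hg
  have hkg : k < g := hL.lt_length
  have hle := fun s (hs : s ∈ T) => hL.lab_le h hs
  rcases hxk with rfl | rfl
  · refine ⟨_, h.mem_edgeSet (i := g - 1) (by omega), fun s hs => ?_⟩
    have := hle s hs
    rw [h.vertexEdgeDist_edge hG.1 s (by omega), h.dist_f_right hG.1 s (show 0 < g by omega)]
    have h4 := cycEdgeDist_cases (h.lt s) (show g - 1 < g by omega)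
    have h5 := cycDist_cases (h.lt s) (show 0 < g by omega)
    omega
  · refine ⟨_, h.mem_edgeSet (i := k) (by omega), fun s hs => ?_⟩
    have := hle s hs
    rw [h.vertexEdgeDist_edge hG.1 s (by omega), h.dist_f_right hG.1 s (show k < g by omega)]
    have h4 := cycEdgeDist_cases (h.lt s) (show k < g by omega)
    have h5 := cycDist_cases (h.lt s) (show k < g by omega)
    omega

lemma IsEdgeMetricGenerator.not_incident (hG : G.IsCactus) (hT : G.IsEdgeMetricGenerator T)
    (C C' : G.Subgraph) : ¬ (G.edgeCriticalIncidence T).Adj C C' := by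
  rintro ⟨hne, hC, hC', x, -, -, hx, hx'⟩
  obtain ⟨e, he, h1⟩ := exists_edge_of_isEdgeCritical hG hx
  obtain ⟨e', he', h2⟩ := exists_edge_of_isEdgeCritical hG hx'
  obtain ⟨s, hs, hse⟩ := hT e (C.edgeSet_subset he) e' (C'.edgeSet_subset he') (by
    rintro rfl
    exact Set.disjoint_left.1 (hG.2 hC hC' hne) he he')
  exact hse (by rw [h1 s hs, h2 s hs])

end Necessity

/-! ### The kinds of edges with respect to a BBR set -/

section Classification

variable {V : Type*} [Fintype V] {G : SimpleGraph V} [DecidableRel G.Adj] {C C' : G.Subgraph}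
  {S : Finset V}

/-- Every tail that avoids `S` extends to one which ends at a vertex of `S` or of degree at
least three. -/
lemma Tail.exists_extension (hG : G.IsCactus) (hC : C ∈ G.cycleSubgraphs) {b : V} {P : List V}
    (hP : G.Tail b P) (hPS : ∀ x ∈ P, x ∉ S) :
    ∃ q R, G.Tail q (P ++ R) ∧ (∀ x ∈ P ++ R, x ∉ S) ∧ (q ∈ S ∨ 3 ≤ G.degree q) := by
  induction hn : Fintype.card V - P.length using Nat.strong_induction_on generalizing b P with
  | _ n ih =>
  subst hn
  by_cases hb : b ∈ S ∨ 3 ≤ G.degree b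
  · exact ⟨b, [], by simpa using hP, by simpa using hPS, hb⟩
  push Not at hb
  obtain ⟨u, hu, hub⟩ := hP.exists_adj
  have hex : ∃ b', G.Adj b b' ∧ b' ≠ u := by
    by_contra! hno
    have hall := hG.1.mem_of_closed (K := {x | x ∈ P ∨ x = b}) (x := b) (Or.inr rfl) (by
      rintro z (hz | rfl) z' hzz'
      · exact hP.mem_or_eq hz hzz'
      · exact Or.inl (hno z' hzz' ▸ hu))
    obtain ⟨x, hx, hxb⟩ := exists_ne_mem_verts hC b
    rcases hall x with h | h
    · exact hP.notMem_verts hC h hx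
    · exact hxb h
  obtain ⟨b', hbb', hne⟩ := hex
  have hdeg : G.degree b = 2 := by
    refine le_antisymm (by omega) ?_
    by_contra! hlt
    have : 0 < G.degree b := (G.degree_pos_iff_exists_adj b).2 ⟨u, hub.symm⟩
    exact hne (eq_of_degree_eq_one (by omega) hub.symm hbb')
  have hP' : G.Tail b' (P ++ [b]) :=
    .snoc hP hdeg hbb' fun h => hne (hP.adj_unique h hu hbb'.symm hub)
  have hlen : (P ++ [b]).length ≤ Fintype.card V := hP'.nodup.length_le_card
  rw [List.length_append, List.length_singleton] at hlen
  obtain ⟨q, R, hq⟩ := ih _ (by simp only [List.length_append, List.length_singleton]; omega) hP'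
    (by
      intro x hx
      simp only [List.mem_append, List.mem_singleton] at hx
      rcases hx with hx | rfl
      · exact hPS x hx
      · exact hb.1) rfl
  exact ⟨q, b :: R, by simpa using hq⟩

/-- The vertex `q` is on a shortest path from every edge to some vertex of `S`, and it is
`S`-active on all the cycles that contain it. -/
def IsAnchor (G : SimpleGraph V) [DecidableRel G.Adj] (S : Finset V) (q : V) : Prop :=
  (q ∈ S ∨ 3 ≤ G.degree q) ∧ (∀ C ∈ G.cycleSubgraphs, q ∈ C.verts → G.IsSActive S C q) ∧
    ∀ e ∈ G.edgeSet, ∃ s ∈ S, ∀ x ∈ e, G.dist s x = G.dist s q + G.dist q x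

/-- No edge meets both `K₁` and `K₂`, so from one of `s₁`, `s₂` it can be reached only through `q`.
-/
lemma isAnchor_of_isSepAt (hG : G.IsCactus) {q : V} (hq : 3 ≤ G.degree q)
    (hC : ∀ C ∈ G.cycleSubgraphs, q ∈ C.verts → G.IsSActive S C q) {K₁ K₂ : Set V}
    (h1 : G.IsSepAt K₁ q) (h2 : G.IsSepAt K₂ q) (hd : Disjoint K₁ K₂) {s₁ s₂ : V} (hs₁ : s₁ ∈ S)
    (hs₂ : s₂ ∈ S) (hsK₁ : s₁ ∈ K₁) (hsK₂ : s₂ ∈ K₂) : G.IsAnchor S q := by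
  refine ⟨Or.inr hq, hC, fun e he => ?_⟩
  by_cases h : ∃ x ∈ e, x ∈ K₁
  · obtain ⟨x, hx, hxK⟩ := h
    refine ⟨s₂, hs₂, fun y hy => h2.dist_eq hG.1 hsK₂ fun hyK => ?_⟩
    have hxy : x ≠ y := fun h => Set.disjoint_left.1 hd hxK (h ▸ hyK)
    have he' : e = s(x, y) := (Sym2.mem_and_mem_iff hxy).1 ⟨hx, hy⟩
    rcases h1.2 x hxK y (show s(x, y) ∈ G.edgeSet from he' ▸ he) with h | rfl
    · exact Set.disjoint_left.1 hd h hyK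
    · exact h2.1 hyK
  · push Not at h
    exact ⟨s₁, hs₁, fun x hx => h1.dist_eq hG.1 hsK₁ (h x hx)⟩

/-- If `q` is not in `S`, two sides of `q` meet `S`. On a cycle they are the part that hangs at `q`
and the rest, as a second vertex is active. Off all cycles they are two branches other than the
tail: a branch that misses `S` is a tail, and there is only one free thread at `q`. -/
lemma IsBBR.isAnchor (hG : G.IsCactus) (hc : 2 ≤ G.cycleSubgraphs.ncard) (hS : G.IsBBR S)
    {q : V} {P : List V} (hP : G.Tail q P) (hPS : ∀ x ∈ P, x ∉ S) (hq : q ∈ S ∨ 3 ≤ G.degree q)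
    (hC : ∀ C ∈ G.cycleSubgraphs, q ∈ C.verts → G.IsSActive S C q) : G.IsAnchor S q := by
  classical
  by_cases hqS : q ∈ S
  · exact ⟨hq, hC, fun e _ => ⟨q, hqS, fun x _ => by simp⟩⟩
  replace hq := hq.resolve_left hqS
  by_cases hcyc : ∃ C ∈ G.cycleSubgraphs, q ∈ C.verts
  · obtain ⟨C, hCC, hqC⟩ := hcyc
    obtain ⟨-, s, hs, hsq⟩ := hC C hCC hqC
    have h2 := hS.1 C hCC
    rw [numSActive] at h2
    obtain ⟨u, ⟨hu, s', hs', hsu⟩, hne⟩ := Set.exists_ne_of_one_lt_ncard h2 q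
    refine isAnchor_of_isSepAt hG hq hC (isSepAt_hangingPart hG hCC hqC)
      (isSepAt_compl_hangingPart hG hCC hqC) ?_ hs hs' ⟨hsq, fun h => hqS (h ▸ hs)⟩
      (fun h => hne (hangingPart_unique hG hCC hu hqC hsu h))
    exact Set.disjoint_left.2 fun x hx hx' => hx' hx.1
  · obtain ⟨u, hu, huq⟩ := hP.exists_adj
    have hcard : 1 < ((G.neighborFinset q).erase u).card := by
      rw [Finset.card_erase_of_mem (by simpa using huq.symm), card_neighborFinset_eq_degree]
      omega
    obtain ⟨b₁, hb₁, b₂, hb₂, hne⟩ := Finset.one_lt_card.1 hcard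
    simp only [Finset.mem_erase, mem_neighborFinset] at hb₁ hb₂
    have hmeet : ∀ {b}, b ≠ u → G.Adj q b → ∃ s ∈ S, s ∈ G.branch q b := by
      intro b hbu hb
      by_contra! hno
      obtain ⟨Q, hQ, hbQ, hQb⟩ := hS.isHitting.exists_tail hG hc hb hno
      obtain rfl := hP.eq_of_free hS.2 hq hQ hPS fun x hx hxS => hno x hxS (hQb x hx)
      exact hbu (hP.adj_unique hbQ hu hb.symm huq)
    obtain ⟨s₁, hs₁, hsb₁⟩ := hmeet hb₁.1 hb₁.2
    obtain ⟨s₂, hs₂, hsb₂⟩ := hmeet hb₂.1 hb₂.2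
    refine isAnchor_of_isSepAt hG hq hC (isSepAt_branch hb₁.2.ne') (isSepAt_branch hb₂.2.ne')
      (Set.disjoint_left.2 fun x hx hx' => hcyc ?_) hs₁ hs₂ hsb₁ hsb₂
    obtain ⟨C, hCC, he⟩ := exists_cycle_of_mem_branch hb₁.2 hb₂.2 hne
      ((isSepAt_branch hb₁.2.ne').branch_subset hx (branch_symm hx'))
    exact ⟨C, hCC, C.mem_verts_of_mem_edge he (Sym2.mem_mk_left _ _)⟩

/-- The kinds of edges with respect to a BBR set `S`. -/
inductive EdgeKind (G : SimpleGraph V) [DecidableRel G.Adj] (S : Finset V) (e : Sym2 V) : Prop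
  | bridge : (∀ e' ∈ G.edgeSet, e ≠ e' → ∃ s ∈ S, G.vertexEdgeDist s e < G.vertexEdgeDist s e') →
      EdgeKind G S e
  | anchored {q : V} {P : List V} {t : ℕ} : G.Tail q P → (∀ x ∈ P, x ∉ S) → G.IsTailEdge P t e →
      G.IsAnchor S q → EdgeKind G S e
  | edge {C : G.Subgraph} : C ∈ G.cycleSubgraphs → e ∈ C.edgeSet → EdgeKind G S e
  | thread {C : G.Subgraph} {q : V} {P : List V} {t : ℕ} : C ∈ G.cycleSubgraphs → q ∈ C.verts →
      ¬ G.IsSActive S C q → G.IsFreeThread S q P → G.IsTailEdge P t e → EdgeKind G S e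

lemma IsBBR.edgeKind_of_branch (hG : G.IsCactus) (hc : 2 ≤ G.cycleSubgraphs.ncard)
    (hS : G.IsBBR S) {a b : V} (hab : G.Adj b a) (hfree : ∀ s ∈ S, s ∉ G.branch b a) :
    EdgeKind G S s(a, b) := by
  obtain ⟨P, hP, haP, hPb⟩ := hS.isHitting.exists_tail hG hc hab hfree
  obtain ⟨C, hC⟩ := Set.nonempty_of_ncard_ne_zero (s := G.cycleSubgraphs) (by omega)
  obtain ⟨q, R, hPR, hPRS, hq⟩ := hP.exists_extension (S := S) hG hC
    fun x hx hxS => hfree x hxS (hPb x hx)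
  have he : G.IsTailEdge (P ++ R) R.length s(a, b) :=
    ⟨P, R, a, b, rfl, rfl, hP, haP, hab.symm, rfl⟩
  by_cases hcyc : ∀ C ∈ G.cycleSubgraphs, q ∈ C.verts → G.IsSActive S C q
  · exact .anchored hPR hPRS he (hS.isAnchor hG hc hPR hPRS hq hcyc)
  · push Not at hcyc
    obtain ⟨C, hC, hqC, hact⟩ := hcyc
    have hqS : q ∉ S := fun h => hact ⟨hqC, q, h, mem_hangingPart_self _ _⟩
    exact .thread hC hqC hact ⟨isThread_iff.2 ⟨hq.resolve_left hqS, hPR⟩, hPRS⟩ he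

theorem IsBBR.edgeKind (hG : G.IsCactus) (hc : 2 ≤ G.cycleSubgraphs.ncard) (hS : G.IsBBR S)
    {e : Sym2 V} (he : e ∈ G.edgeSet) : EdgeKind G S e := by
  by_cases hcyc : ∃ C ∈ G.cycleSubgraphs, e ∈ C.edgeSet
  · obtain ⟨C, hC, heC⟩ := hcyc
    exact .edge hC heC
  induction e using Sym2.ind with
  | _ a b =>
  have hab : G.Adj a b := he
  by_cases h1 : ∀ s ∈ S, s ∉ G.branch b a
  · exact hS.edgeKind_of_branch hG hc hab.symm h1
  by_cases h2 : ∀ s ∈ S, s ∉ G.branch a b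
  · rw [Sym2.eq_swap]
    exact hS.edgeKind_of_branch hG hc hab h2
  push Not at h1 h2
  obtain ⟨s₁, hs₁, h1⟩ := h1
  obtain ⟨s₂, hs₂, h2⟩ := h2
  have hsep₁ := isSepAt_branch (G := G) hab.ne
  have hsep₂ := isSepAt_branch (G := G) hab.ne'
  have hcover : ∀ x, x ∈ G.branch b a ∨ x ∈ G.branch a b := by
    refine hG.1.mem_of_closed (K := {x | x ∈ G.branch b a ∨ x ∈ G.branch a b}) (x := a)
      (Or.inl (mem_branch_self _ _)) ?_
    rintro z (hz | hz) z' hzz'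
    · rcases hsep₁.2 z hz z' hzz' with h | rfl
      · exact Or.inl h
      · exact Or.inr (mem_branch_self _ _)
    · rcases hsep₂.2 z hz z' hzz' with h | rfl
      · exact Or.inr h
      · exact Or.inl (mem_branch_self _ _)
  have hdisj : ∀ x, x ∈ G.branch b a → x ∉ G.branch a b := by
    intro x hx hx'
    have key : ∀ y ∈ G.branch a b, y ∉ G.branch b a := by
      intro y hy
      induction hy with
      | refl => exact hsep₁.1
      | @tail x y hx hxy ih =>
        intro hy
        rcases hsep₁.2 y hy x hxy.1.symm with h | rfl
        · exact ih h
        · obtain ⟨C, hC, he⟩ := exists_cycle_of_mem_branch hab.symm hxy.1 hxy.2.2.symm hy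
          exact hcyc ⟨C, hC, by rwa [Sym2.eq_swap]⟩
    exact key x hx' hx
  have hs₁' : s₁ ∉ G.branch a b := hdisj s₁ h1
  have hs₂' : s₂ ∉ G.branch b a := fun h => hdisj _ h h2
  refine .bridge fun e' he' hne => ?_
  induction e' using Sym2.ind with
  | _ x y =>
  -- Any edge other than this bridge lies on one side of it, and is strictly farther than the bridge
  -- from a vertex of `S` on the other side.
  have key : ∀ {a b s : V} {K : Set V}, G.IsSepAt K b → s ∉ K → x ∈ K → y ∈ K →
      G.vertexEdgeDist s s(a, b) < G.vertexEdgeDist s s(x, y) := by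
    intro a b s K hK hs hx hy
    have h3 := hK.dist_eq hG.1 hx hs
    have h4 := hK.dist_eq hG.1 hy hs
    have h5 := hG.1.pos_dist_of_ne (fun h : x = b => hK.1 (h ▸ hx))
    have h6 := hG.1.pos_dist_of_ne (fun h : y = b => hK.1 (h ▸ hy))
    rw [vertexEdgeDist_mk, vertexEdgeDist_mk, dist_comm (u := s) (v := x),
      dist_comm (u := s) (v := y), dist_comm (u := s) (v := b)]
    omega
  have hxy : G.Adj x y := he'
  rcases hcover x with hx | hx <;> rcases hcover y with hy | hy
  · exact ⟨s₂, hs₂, key hsep₁ hs₂' hx hy⟩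
  · rcases hsep₁.2 x hx y hxy with h | rfl
    · exact absurd hy (hdisj y h)
    · rcases hsep₂.2 _ hy x hxy.symm with h | rfl
      · exact absurd h (hdisj x hx)
      · exact absurd rfl hne
  · rcases hsep₁.2 y hy x hxy.symm with h | rfl
    · exact absurd hx (hdisj x h)
    · rcases hsep₂.2 _ hx y hxy with h | rfl
      · exact absurd h (hdisj y hy)
      · exact absurd Sym2.eq_swap hne
  · refine ⟨s₁, hs₁, ?_⟩
    rw [Sym2.eq_swap (a := a)]
    exact key hsep₂ hs₁' hx hy

end Classification

/-! ### Arithmetic of undistinguished positions on a cycle -/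

section CycleArithmetic

/-- The vertex `i` is on the axis of the reflection that exchanges the two edges: `2i ≡ r + r' + 1`
modulo `g`, written out for labels below `g`. -/
lemma two_mul_add_eq_of_edge_edge {g i r r' : ℕ} (hi : i < g) (hr : r < g) (hr' : r' < g)
    (hne : r ≠ r') (h : cycEdgeDist g i r = cycEdgeDist g i r') :
    2 * i = r + r' + 1 ∨ 2 * i + g = r + r' + 1 ∨ 2 * i + 2 * g = r + r' + 1 ∨
      2 * i = r + r' + 1 + g := by
  have h1 := cycEdgeDist_cases hi hr
  have h2 := cycEdgeDist_cases hi hr'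
  omega

/-- The label of the vertex with label `i` when the labels start at `p`. -/
def cycShift (g p i : ℕ) : ℕ := if p ≤ i then i - p else i + g - p

lemma cycShift_cases {g p i : ℕ} (hp : p < g) (hi : i < g) :
    cycShift g p i < g ∧ (cycShift g p i + p = i ∨ cycShift g p i + p = i + g) := by
  rw [cycShift]
  split_ifs <;> omega

/-- Rotating one of the positions to the label `0` reduces the cases left to `omega`. -/
lemma cycDist_cycShift {g p i j : ℕ} (hp : p < g) (hi : i < g) (hj : j < g) :
    cycDist g (cycShift g p i) (cycShift g p j) = cycDist g i j := by
  obtain ⟨h1, h2⟩ := cycShift_cases hp hi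
  obtain ⟨h3, h4⟩ := cycShift_cases hp hj
  have e1 := cycDist_cases h1 h3
  have e2 := cycDist_cases hi hj
  rcases h2 with h2 | h2 <;> rcases h4 with h4 | h4 <;> omega

lemma cycEdgeDist_cycShift {g p i j : ℕ} (hp : p < g) (hi : i < g) (hj : j < g) :
    cycEdgeDist g (cycShift g p i) (cycShift g p j) = cycEdgeDist g i j := by
  obtain ⟨h1, h2⟩ := cycShift_cases hp hi
  obtain ⟨h3, h4⟩ := cycShift_cases hp hj
  have e1 := cycEdgeDist_cases h1 h3
  have e2 := cycEdgeDist_cases hi hj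
  rcases h2 with h2 | h2 <;> rcases h4 with h4 | h4 <;> omega

lemma cycShift_self (g p : ℕ) : cycShift g p p = 0 := by simp [cycShift]

lemma cycDist_zero_cases {g i : ℕ} (hi : i < g) :
    (2 * i ≤ g ∧ cycDist g i 0 = i) ∨ (g ≤ 2 * i ∧ cycDist g i 0 + i = g) := by
  have := cycDist_cases hi (show 0 < g by omega)
  omega

/-- On the cycle the difference of the distances to the edge `r` and to the vertex `0` falls along
one arc, rises along the opposite one and is constant in between. A value `t ≥ 0` other than the
maximum, which is the distance from `0` to the edge, is taken at most once on each arc, and the two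
positions have the sum `r + (g + 1)/2` modulo `g`. -/
lemma add_eq_of_thread_edge_zero {g i j r t : ℕ} (hi : i < g) (hj : j < g)
    (hr : r < g) (hij : i ≠ j) (ht : cycEdgeDist g 0 r ≠ t)
    (h1 : cycDist g i 0 + t = cycEdgeDist g i r) (h2 : cycDist g j 0 + t = cycEdgeDist g j r) :
    2 * (i + j) = 2 * r + g + 1 ∨ 2 * (i + j) + 2 * g = 2 * r + g + 1 ∨
      2 * (i + j) = 2 * r + g + 1 + 2 * g := by
  have e1 := cycDist_zero_cases hi
  have e2 := cycDist_zero_cases hj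
  have e3 := cycEdgeDist_cases hi hr
  have e4 := cycEdgeDist_cases hj hr
  have e5 := cycEdgeDist_cases (show 0 < g by omega) hr
  rcases e1 with e1 | e1 <;> rcases e3 with e3 | e3 | e3 | e3 <;> omega

lemma add_eq_of_thread_edge {g i j p r t : ℕ} (hi : i < g) (hj : j < g) (hp : p < g) (hr : r < g)
    (hij : i ≠ j) (ht : cycEdgeDist g p r ≠ t) (h1 : cycDist g i p + t = cycEdgeDist g i r)
    (h2 : cycDist g j p + t = cycEdgeDist g j r) :
    2 * (i + j) = 2 * (p + r) + g + 1 ∨ 2 * (i + j) + 2 * g = 2 * (p + r) + g + 1 ∨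
      2 * (i + j) + 4 * g = 2 * (p + r) + g + 1 ∨ 2 * (i + j) = 2 * (p + r) + g + 1 + 2 * g := by
  obtain ⟨hi', ei⟩ := cycShift_cases hp hi
  obtain ⟨hj', ej⟩ := cycShift_cases hp hj
  obtain ⟨hr', er⟩ := cycShift_cases hp hr
  rw [← cycDist_cycShift hp hi hp, ← cycEdgeDist_cycShift hp hi hr, cycShift_self] at h1
  rw [← cycDist_cycShift hp hj hp, ← cycEdgeDist_cycShift hp hj hr, cycShift_self] at h2
  rw [← cycEdgeDist_cycShift hp hp hr, cycShift_self] at ht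
  have := add_eq_of_thread_edge_zero hi' hj' hr' (by omega) ht h1 h2
  clear h1 h2 ht
  omega

/-- The same with a vertex `p` in place of the edge; `ht` and `ht'` exclude the two extreme values
of the difference. -/
lemma add_eq_of_thread_thread_zero {g i j p t t' : ℕ} (hi : i < g) (hj : j < g)
    (hp : p < g) (hij : i ≠ j) (ht : cycDist g p 0 + t' ≠ t) (ht' : cycDist g p 0 + t ≠ t')
    (h1 : cycDist g i 0 + t = cycDist g i p + t') (h2 : cycDist g j 0 + t = cycDist g j p + t') :
    2 * (i + j) = 2 * p + g ∨ 2 * (i + j) + 2 * g = 2 * p + g ∨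
      2 * (i + j) = 2 * p + g + 2 * g := by
  have e1 := cycDist_zero_cases hi
  have e2 := cycDist_zero_cases hj
  have e3 := cycDist_cases hi hp
  have e4 := cycDist_cases hj hp
  have e5 := cycDist_zero_cases hp
  rcases e1 with e1 | e1 <;> rcases e3 with e3 | e3 | e3 | e3 <;> omega

lemma add_eq_of_thread_thread {g i j p p' t t' : ℕ} (hi : i < g) (hj : j < g) (hp : p < g)
    (hp' : p' < g) (hij : i ≠ j) (ht : cycDist g p p' + t' ≠ t) (ht' : cycDist g p' p + t ≠ t')
    (h1 : cycDist g i p + t = cycDist g i p' + t') (h2 : cycDist g j p + t = cycDist g j p' + t') :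
    2 * (i + j) = 2 * (p + p') + g ∨ 2 * (i + j) + 2 * g = 2 * (p + p') + g ∨
      2 * (i + j) + 4 * g = 2 * (p + p') + g ∨ 2 * (i + j) = 2 * (p + p') + g + 2 * g := by
  obtain ⟨hi', ei⟩ := cycShift_cases hp hi
  obtain ⟨hj', ej⟩ := cycShift_cases hp hj
  obtain ⟨hr', er⟩ := cycShift_cases hp hp'
  rw [← cycDist_cycShift hp hi hp, ← cycDist_cycShift hp hi hp', cycShift_self] at h1
  rw [← cycDist_cycShift hp hj hp, ← cycDist_cycShift hp hj hp', cycShift_self] at h2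
  rw [cycDist_comm, ← cycDist_cycShift hp hp' hp, cycShift_self] at ht
  rw [← cycDist_cycShift hp hp' hp, cycShift_self] at ht'
  have := add_eq_of_thread_thread_zero hi' hj' hr' (by omega) ht ht' h1 h2
  clear h1 h2 ht ht'
  omega

/-- Here `0` and `k` are the only two active positions. The conclusion is configuration E for odd
`g`, with `t = ⌊g/2⌋ - k`. -/
lemma le_of_thread_edge {g k p r t : ℕ} (hk0 : k ≠ 0) (hk : 2 * k ≤ g) (hp : p < g) (hr : r < g)
    (ht : cycEdgeDist g p r ≠ t) (h1 : cycDist g 0 p + t = cycEdgeDist g 0 r)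
    (h2 : cycDist g k p + t = cycEdgeDist g k r) : p ≤ k ∧ g = 2 * (t + k) + 1 := by
  have e1 := cycDist_zero_cases hp
  rw [cycDist_comm] at e1
  have e2 := cycDist_cases (show k < g by omega) hp
  have e3 := cycEdgeDist_cases (show 0 < g by omega) hr
  have e4 := cycEdgeDist_cases (show k < g by omega) hr
  have e5 := cycEdgeDist_cases hp hr
  rcases e1 with e1 | e1 <;> rcases e3 with e3 | e3 | e3 | e3 <;>
    rcases e2 with e2 | e2 | e2 | e2 <;> omega

/-- Configuration E for even `g`: the deeper of the two edges hangs on the `S`-path, at depth at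
least `g/2 - k`, and `p' = g/2 + k - p`. -/
lemma le_of_thread_thread {g k p p' t t' : ℕ} (hk0 : k ≠ 0) (hk : 2 * k < g) (hp : p < g)
    (hp' : p' < g) (htt : t' ≤ t) (ht : cycDist g p p' + t' ≠ t)
    (h1 : cycDist g 0 p + t = cycDist g 0 p' + t')
    (h2 : cycDist g k p + t = cycDist g k p' + t') :
    p ≤ k ∧ g ≤ 2 * (t + k) ∧ 2 * p' + 2 * p = g + 2 * k := by
  have e1 := cycDist_zero_cases hp
  have e3 := cycDist_zero_cases hp'
  rw [cycDist_comm] at e1 e3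
  have e2 := cycDist_cases (show k < g by omega) hp
  have e4 := cycDist_cases (show k < g by omega) hp'
  have e5 := cycDist_cases hp hp'
  rcases e1 with e1 | e1 <;> rcases e3 with e3 | e3 <;>
    rcases e2 with e2 | e2 | e2 | e2 <;> omega

end CycleArithmetic
end SimpleGraph

namespace SimpleGraph

/-! ### Undistinguished edges at one cycle force A, D or E -/

section Profiles

variable {V : Type*} {G : SimpleGraph V} {C : G.Subgraph} {S : Finset V}

section SPath

variable {v : V} {w : G.Walk v v} {k : ℕ} {lab : V → ℕ}

/-- If all active vertices are on one of the two half cycles at the label `a`, then the `S`-path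
is on this half cycle. -/
lemma IsSPathLabelling.of_half (hL : G.IsSPathLabelling S C w k)
    (h : Gates G C w.length w.getVert lab) {a : ℕ} (ha : a < w.length)
    (hs : (∀ s ∈ S, (if a ≤ lab s then lab s - a else lab s + w.length - a) ≤ (w.length - 1) / 2) ∨
      ∀ s ∈ S, (if lab s ≤ a then a - lab s else a + w.length - lab s) ≤ (w.length - 1) / 2) :
    k ≤ (w.length + 1) / 2 - 1 ∧ (a ∈ Set.Icc k ((w.length + 1) / 2 - 1) ∨
      a ∈ Set.Icc (w.length / 2 + k + 1) (w.length - 1) ∨ a = 0) := by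
  have h3 := h.three_le
  obtain ⟨s₀, hs₀, hl0⟩ := hL.exists_lab_zero h
  obtain ⟨s₁, hs₁, hl1⟩ := hL.exists_lab_eq h
  have hk := hL.lt_length
  rw [Set.mem_Icc, Set.mem_Icc]
  set g := w.length with hg
  rcases hs with hs | hs
  · have hkr : k ≤ (g - 1) / 2 := hL.le_of_lab h ha hs
    have h0 := hs s₀ hs₀
    have h1 := hs s₁ hs₁
    rw [hl0] at h0
    rw [hl1] at h1
    split_ifs at h0 h1 <;> omega
  · have hkr : k ≤ (g - 1) / 2 := by
      -- The half cycle that ends at `a` begins `(g - 1)/2` steps before it.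
      refine hL.le_of_lab h (a := if (g - 1) / 2 ≤ a then a - (g - 1) / 2
        else a + g - (g - 1) / 2) (by split_ifs <;> omega) fun s hsS => ?_
      have := hs s hsS
      have := h.lt s
      split_ifs at * <;> omega
    have h0 := hs s₀ hs₀
    have h1 := hs s₁ hs₁
    rw [hl0] at h0
    rw [hl1] at h1
    split_ifs at h0 h1 <;> omega

/-- All active vertices see the edge `r` through `a`, so they are on the half cycle at `a` that
leads away from the edge. The conclusion is the range of D. -/
lemma IsSPathLabelling.of_edge (hL : G.IsSPathLabelling S C w k)
    (h : Gates G C w.length w.getVert lab) {a r : ℕ} (ha : a < w.length) (hr : r < w.length)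
    (hs : ∀ s ∈ S, cycEdgeDist w.length (lab s) r =
      cycDist w.length (lab s) a + cycEdgeDist w.length a r) :
    k ≤ (w.length + 1) / 2 - 1 ∧ (a ∈ Set.Icc k ((w.length + 1) / 2 - 1) ∨
      a ∈ Set.Icc (w.length / 2 + k + 1) (w.length - 1) ∨ a = 0) := by
  apply hL.of_half h ha
  have e3 := cycEdgeDist_cases ha hr
  by_cases hd : (a ≤ r ∧ r - a ≤ (w.length - 1) / 2) ∨
      (r < a ∧ r + w.length - a ≤ (w.length - 1) / 2)
  · refine Or.inr fun s hsS => ?_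
    have e0 := hs s hsS
    have e1 := cycEdgeDist_cases (h.lt s) hr
    have e2 := cycDist_cases (h.lt s) ha
    have := h.lt s
    split_ifs <;> omega
  · refine Or.inl fun s hsS => ?_
    have e0 := hs s hsS
    have e1 := cycEdgeDist_cases (h.lt s) hr
    have e2 := cycDist_cases (h.lt s) ha
    have := h.lt s
    split_ifs <;> omega

lemma IsSPathLabelling.of_thread (hL : G.IsSPathLabelling S C w k)
    (h : Gates G C w.length w.getVert lab) {a p : ℕ} (ha : a < w.length) (hp : p < w.length)
    (hap : a ≠ p) (hs : ∀ s ∈ S, cycDist w.length (lab s) p =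
      cycDist w.length (lab s) a + cycDist w.length a p) :
    k ≤ (w.length + 1) / 2 - 1 ∧ (a ∈ Set.Icc k ((w.length + 1) / 2 - 1) ∨
      a ∈ Set.Icc (w.length / 2 + k + 1) (w.length - 1) ∨ a = 0) := by
  apply hL.of_half h ha
  have e3 := cycDist_cases ha hp
  by_cases hd : (a ≤ p ∧ p - a ≤ w.length / 2) ∨ (p < a ∧ p + w.length - a ≤ w.length / 2)
  · refine Or.inr fun s hsS => ?_
    have e0 := hs s hsS
    have e1 := cycDist_cases (h.lt s) hp
    have e2 := cycDist_cases (h.lt s) ha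
    have := h.lt s
    split_ifs <;> omega
  · refine Or.inl fun s hsS => ?_
    have e0 := hs s hsS
    have e1 := cycDist_cases (h.lt s) hp
    have e2 := cycDist_cases (h.lt s) ha
    have := h.lt s
    split_ifs <;> omega

lemma IsSPathLabelling.eq_zero_or_eq (hL : G.IsSPathLabelling S C w k)
    (h : Gates G C w.length w.getVert lab) {a : ℕ} (hact : ∃ s ∈ S, lab s = a)
    (ha : a ∈ Set.Icc k ((w.length + 1) / 2 - 1) ∨
      a ∈ Set.Icc (w.length / 2 + k + 1) (w.length - 1) ∨ a = 0) : a = 0 ∨ a = k := by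
  obtain ⟨s, hs, rfl⟩ := hact
  have := hL.lab_le h hs
  rw [Set.mem_Icc, Set.mem_Icc] at ha
  omega

lemma Gates.numSActive_eq_two [Finite V] {g : ℕ} {f : ℕ → V} (h : Gates G C g f lab) {i j : ℕ}
    (hij : i ≠ j) (hi : ∃ s ∈ S, lab s = i) (hj : ∃ s ∈ S, lab s = j)
    (hs : ∀ s ∈ S, lab s = i ∨ lab s = j) : G.numSActive S C = 2 := by
  have hi' : i < g := by obtain ⟨s, -, rfl⟩ := hi; exact h.lt s
  have hj' : j < g := by obtain ⟨s, -, rfl⟩ := hj; exact h.lt s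
  have : {v | G.IsSActive S C v} = {f i, f j} := by
    ext x
    simp only [Set.mem_ofPred_eq, Set.mem_insert_iff, Set.mem_singleton_iff]
    constructor
    · intro hx
      obtain ⟨l, hl, rfl⟩ := (h.verts x).1 hx.1
      obtain ⟨s, hsS, rfl⟩ := (h.isSActive_iff hl).1 hx
      rcases hs s hsS with h | h <;> simp [h]
    · rintro (rfl | rfl)
      · exact (h.isSActive_iff hi').2 hi
      · exact (h.isSActive_iff hj').2 hj
  rw [numSActive, this, Set.ncard_pair fun h' => hij (h.inj _ hi' _ hj' h')]

lemma Gates.exists_lab_ne (h : Gates G C w.length w.getVert lab) (h2 : 2 ≤ G.numSActive S C)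
    (a : ℕ) : ∃ s ∈ S, lab s ≠ a := by
  by_contra! hno
  have h3 := h.three_le
  have : {v | G.IsSActive S C v} ⊆ {w.getVert a} := by
    intro x hx
    obtain ⟨l, hl, rfl⟩ := (h.verts x).1 hx.1
    obtain ⟨s, hsS, rfl⟩ := (h.isSActive_iff hl).1 hx
    rw [hno s hsS]
    rfl
  have := Set.ncard_le_ncard this
  rw [Set.ncard_singleton] at this
  rw [numSActive] at h2
  omega

end SPath

end Profiles

section SameCycle

variable {V : Type*} [Fintype V] {G : SimpleGraph V} [DecidableRel G.Adj] {C : G.Subgraph}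
  {S : Finset V} {v : V} {w : G.Walk v v} {k : ℕ} {lab : V → ℕ}

lemma IsSPathLabelling.ne_zero (hL : G.IsSPathLabelling S C w k)
    (h : Gates G C w.length w.getVert lab) (h2 : 2 ≤ G.numSActive S C) : k ≠ 0 := by
  rintro rfl
  obtain ⟨s, hs, hne⟩ := h.exists_lab_ne h2 0
  have := hL.lab_le h hs
  omega

/-- The labels `0` and `k` satisfy the same congruence for `2i`, hence `2k = g`. Every other active
label satisfies it too, so there is none, and this is A. -/
lemma IsSPathLabelling.false_of_edge_edge (hL : G.IsSPathLabelling S C w k)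
    (h : Gates G C w.length w.getVert lab) (h2 : 2 ≤ G.numSActive S C)
    (hADE : ¬ G.ContainsADE S C) {r r' : ℕ} (hr : r < w.length) (hr' : r' < w.length)
    (hne : r ≠ r')
    (hs : ∀ s ∈ S, cycEdgeDist w.length (lab s) r = cycEdgeDist w.length (lab s) r') : False := by
  have h3 := h.three_le
  have hk0 := hL.ne_zero h h2
  have hk := hL.lt_length
  obtain ⟨s₀, hs₀, hl0⟩ := hL.exists_lab_zero h
  obtain ⟨s₁, hs₁, hl1⟩ := hL.exists_lab_eq h
  have key := fun s hsS => two_mul_add_eq_of_edge_edge (h.lt s) hr hr' hne (hs s hsS)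
  have e0 := key s₀ hs₀
  have e1 := key s₁ hs₁
  rw [hl0] at e0
  rw [hl1] at e1
  have hkg : 2 * k = w.length := by omega
  refine hADE ⟨v, w, k, hL, Or.inl ⟨?_, ⟨k, by omega⟩, by omega⟩⟩
  refine h.numSActive_eq_two (Ne.symm hk0) ⟨s₀, hs₀, hl0⟩ ⟨s₁, hs₁, hl1⟩ fun s hsS => ?_
  have := key s hsS
  have := hL.lab_le h hsS
  omega

lemma IsSPathLabelling.le_sub (hL : G.IsSPathLabelling S C w k)
    (h : Gates G C w.length w.getVert lab) (hs : ∀ s ∈ S, lab s = 0 ∨ lab s = k) :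
    k ≤ w.length - k := by
  have hk := hL.lt_length
  refine hL.le_of_lab h (a := k) hk fun s hsS => ?_
  rcases hs s hsS with h' | h' <;> rw [h'] <;> split_ifs <;> omega

/-- If the thread edge is as deep as `p` is far from the cycle edge, all active vertices see the
latter through `p`, which gives D. Otherwise `0` determines the only other possible active label,
and E results. -/
lemma IsSPathLabelling.false_of_thread_edge (hL : G.IsSPathLabelling S C w k)
    (h : Gates G C w.length w.getVert lab) (h2 : 2 ≤ G.numSActive S C)
    (hADE : ¬ G.ContainsADE S C) {p r t : ℕ} {P : List V} (hp : p < w.length) (hr : r < w.length)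
    (hP : G.IsFreeThread S (w.getVert p) P) (ht : t < P.length)
    (hs : ∀ s ∈ S, cycDist w.length (lab s) p + t = cycEdgeDist w.length (lab s) r) : False := by
  have h3 := h.three_le
  have hk0 := hL.ne_zero h h2
  have hk := hL.lt_length
  by_cases htr : cycEdgeDist w.length p r = t
  · have := hL.of_edge h hp hr fun s hsS => by rw [← hs s hsS, htr]
    exact hADE ⟨v, w, k, hL, Or.inr (Or.inl ⟨this.1, p, P, hP, this.2⟩)⟩
  obtain ⟨s₀, hs₀, hl0⟩ := hL.exists_lab_zero h
  obtain ⟨s₁, hs₁, hl1⟩ := hL.exists_lab_eq h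
  have e0 := hs s₀ hs₀
  have e1 := hs s₁ hs₁
  rw [hl0] at e0
  rw [hl1] at e1
  have ek := add_eq_of_thread_edge (by omega) hk hp hr (Ne.symm hk0) htr e0 e1
  have hlab : ∀ s ∈ S, lab s = 0 ∨ lab s = k := by
    intro s hsS
    by_contra! hne
    have e2 := add_eq_of_thread_edge (by omega) (h.lt s) hp hr (Ne.symm hne.1) htr e0 (hs s hsS)
    have := h.lt s
    omega
  have hkk := hL.le_sub h hlab
  obtain ⟨hpk', hg⟩ := le_of_thread_edge hk0 (by omega) hp hr htr e0 e1
  refine hADE ⟨v, w, k, hL, Or.inr (Or.inr ⟨?_, p, hpk', ⟨P, hP, by omega⟩, fun he => ?_⟩)⟩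
  · exact h.numSActive_eq_two (Ne.symm hk0) ⟨s₀, hs₀, hl0⟩ ⟨s₁, hs₁, hl1⟩ hlab
  · obtain ⟨m, hm⟩ := he
    omega

/-- If one of the threads is seen through the anchor of the other, D occurs at that anchor.
Otherwise there are only two active vertices, and A or E results. -/
lemma IsSPathLabelling.false_of_thread_thread (hL : G.IsSPathLabelling S C w k)
    (h : Gates G C w.length w.getVert lab) (h2 : 2 ≤ G.numSActive S C)
    (hADE : ¬ G.ContainsADE S C) {p p' t t' : ℕ} {P P' : List V} (hp : p < w.length)
    (hp' : p' < w.length) (hpp' : p ≠ p')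
    (hP : G.IsFreeThread S (w.getVert p) P) (ht : t < P.length)
    (hP' : G.IsFreeThread S (w.getVert p') P') (ht' : t' < P'.length)
    (hs : ∀ s ∈ S, cycDist w.length (lab s) p + t = cycDist w.length (lab s) p' + t') : False := by
  wlog htt : t' ≤ t generalizing p p' t t' P P'
  · exact this hp' hp hpp'.symm hP' ht' hP ht (fun s hsS => (hs s hsS).symm) (by omega)
  have h3 := h.three_le
  have hk0 := hL.ne_zero h h2
  have hk := hL.lt_length
  by_cases htr : cycDist w.length p p' + t' = t
  · have := hL.of_thread h hp hp' hpp' fun s hsS => by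
      have := hs s hsS
      omega
    exact hADE ⟨v, w, k, hL, Or.inr (Or.inl ⟨this.1, p, P, hP, this.2⟩)⟩
  by_cases htr' : cycDist w.length p' p + t = t'
  · have := hL.of_thread h hp' hp hpp'.symm fun s hsS => by
      have := hs s hsS
      omega
    exact hADE ⟨v, w, k, hL, Or.inr (Or.inl ⟨this.1, p', P', hP', this.2⟩)⟩
  obtain ⟨s₀, hs₀, hl0⟩ := hL.exists_lab_zero h
  obtain ⟨s₁, hs₁, hl1⟩ := hL.exists_lab_eq h
  have e0 := hs s₀ hs₀
  have e1 := hs s₁ hs₁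
  rw [hl0] at e0
  rw [hl1] at e1
  have ek := add_eq_of_thread_thread (by omega) hk hp hp' (Ne.symm hk0) htr htr' e0 e1
  have hlab : ∀ s ∈ S, lab s = 0 ∨ lab s = k := by
    intro s hsS
    by_contra! hne
    have e2 := add_eq_of_thread_thread (by omega) (h.lt s) hp hp' (Ne.symm hne.1) htr htr' e0
      (hs s hsS)
    have := h.lt s
    omega
  have h2' := h.numSActive_eq_two (Ne.symm hk0) ⟨s₀, hs₀, hl0⟩ ⟨s₁, hs₁, hl1⟩ hlab
  have hkk := hL.le_sub h hlab
  have heven : Even w.length := Nat.even_iff.2 (by omega)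
  have hkA : k ≠ w.length / 2 := fun h' => hADE ⟨v, w, k, hL, Or.inl ⟨h2', heven, h'⟩⟩
  obtain ⟨m, hm⟩ := heven
  obtain ⟨hpk', hg, hpp⟩ := le_of_thread_thread hk0 (by omega) hp hp' htt htr e0 e1
  refine hADE ⟨v, w, k, hL, Or.inr (Or.inr ⟨h2', p, hpk', ⟨P, hP, by omega⟩, fun _ => ?_⟩)⟩
  rw [show w.length / 2 + (k - p) = p' by omega, Nat.mod_eq_of_lt hp']
  exact ⟨P', hP'⟩

end SameCycle

/-! ### Sufficiency: comparing edges of all kinds -/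

section Sufficiency

variable {V : Type*} [Fintype V] {G : SimpleGraph V} [DecidableRel G.Adj] {C C' : G.Subgraph}
  {S : Finset V}

/-- The distances from the vertices of the cycle to the edge `e`, which is on the cycle or on a
free thread that hangs at an inactive vertex of the cycle. -/
inductive IsProfile (G : SimpleGraph V) [DecidableRel G.Adj] (S : Finset V) (g : ℕ) (f : ℕ → V)
    (lab : V → ℕ) (e : Sym2 V) : (ℕ → ℕ) → Prop
  | edge {r : ℕ} : r < g → e = s(f r, f (r + 1)) → IsProfile G S g f lab e (cycEdgeDist g · r)
  | thread {p t : ℕ} {P : List V} : p < g → (∀ s ∈ S, lab s ≠ p) → G.IsFreeThread S (f p) P →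
      G.IsTailEdge P t e → IsProfile G S g f lab e (cycDist g · p + t)

namespace IsProfile

variable {g : ℕ} {f : ℕ → V} {lab : V → ℕ} {e e' : Sym2 V} {F F' : ℕ → ℕ}

/-- The hypothesis on `z` keeps it off the thread, which is free and has only vertices of degree at
most two. -/
lemma dist_eq (hF : IsProfile G S g f lab e F) (hG : G.Connected) (h : Gates G C g f lab) {z : V}
    (hz : z ∈ S ∨ 3 ≤ G.degree z) : G.vertexEdgeDist z e = G.dist z (f (lab z)) + F (lab z) := by
  rcases hF with ⟨hr, rfl⟩ | @⟨p, t, P, hp, hpS, hP, he⟩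
  · exact h.vertexEdgeDist_edge hG z hr
  · have hT := (isThread_iff.1 hP.1).2
    exact hT.vertexEdgeDist_gates h hG hp he
      (hz.elim (fun hz hzP => hP.2 z hzP hz) fun hz => hT.notMem_of_degree hz)

lemma le_add (hF : IsProfile G S g f lab e F) {j a : ℕ} (hj : j < g) (ha : a < g) :
    F j ≤ cycDist g j a + F a := by
  rcases hF with ⟨hr, rfl⟩ | @⟨p, t, P, hp, hpS, hP, he⟩
  · have h1 := cycEdgeDist_cases hj hr
    have h2 := cycEdgeDist_cases ha hr
    have h3 := cycDist_cases hj ha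
    simp only
    omega
  · have h1 := cycDist_cases hj hp
    have h2 := cycDist_cases ha hp
    have h3 := cycDist_cases hj ha
    simp only
    omega

variable {v : V} {w : G.Walk v v} {k : ℕ}

/-- If all of `S` sees `e` through the active vertex `a`, then `a` is in the range of D. Being
active, it is an end of the `S`-path by `eq_zero_or_eq`. -/
lemma critical (hF : IsProfile G S w.length w.getVert lab e F) (hL : G.IsSPathLabelling S C w k)
    (h : Gates G C w.length w.getVert lab) {a : ℕ} (hact : ∃ s ∈ S, lab s = a)
    (hs : ∀ s ∈ S, F (lab s) = cycDist w.length (lab s) a + F a) :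
    k ≤ (w.length + 1) / 2 - 1 ∧ (a ∈ Set.Icc k ((w.length + 1) / 2 - 1) ∨
      a ∈ Set.Icc (w.length / 2 + k + 1) (w.length - 1) ∨ a = 0) := by
  have ha : a < w.length := by obtain ⟨s, -, rfl⟩ := hact; exact h.lt s
  rcases hF with ⟨hr, rfl⟩ | @⟨p, t, P, hp, hpS, hP, he⟩
  · exact hL.of_edge h ha hr hs
  · refine hL.of_thread h ha hp ?_ fun s hsS => by have := hs s hsS; simp only at this; omega
    rintro rfl
    obtain ⟨s, hsS, hsa⟩ := hact
    exact hpS s hsS hsa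

lemma false_of_eq (hF : IsProfile G S w.length w.getVert lab e F)
    (hF' : IsProfile G S w.length w.getVert lab e' F') (hL : G.IsSPathLabelling S C w k)
    (h : Gates G C w.length w.getVert lab) (hS : G.IsBBR S) (hADE : ¬ G.ContainsADE S C)
    (hne : e ≠ e') (hs : ∀ s ∈ S, F (lab s) = F' (lab s)) : False := by
  have h2 := hS.1 C h.mem
  rcases hF with @⟨r, hr, rfl⟩ | @⟨p, t, P, hp, hpS, hP, he⟩ <;>
    rcases hF' with @⟨r', hr', rfl⟩ | @⟨p', t', P', hp', hpS', hP', he'⟩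
  · exact hL.false_of_edge_edge h h2 hADE hr hr' (fun h => hne (h ▸ rfl)) hs
  · exact hL.false_of_thread_edge h h2 hADE hp' hr hP'
      ((isThread_iff.1 hP'.1).2.edge_lt he') fun s hsS => (hs s hsS).symm
  · exact hL.false_of_thread_edge h h2 hADE hp hr' hP
      ((isThread_iff.1 hP.1).2.edge_lt he) hs
  · by_cases hpp : p = p'
    · subst hpp
      obtain rfl := hS.2 _ _ _ hP hP'
      obtain ⟨s, hsS, -⟩ := h.exists_lab_ne h2 0
      have := hs s hsS
      simp only at this
      obtain rfl : t = t' := by omega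
      exact hne (Tail.edge_unique he he')
    · exact hL.false_of_thread_thread h h2 hADE hp hp' hpp hP
        ((isThread_iff.1 hP.1).2.edge_lt he) hP' ((isThread_iff.1 hP'.1).2.edge_lt he') hs

end IsProfile

lemma IsAnchor.vertexEdgeDist_eq {q : V} (hq : G.IsAnchor S q) {e : Sym2 V} (he : e ∈ G.edgeSet) :
    ∃ s ∈ S, G.vertexEdgeDist s e = G.dist s q + G.vertexEdgeDist q e := by
  obtain ⟨s, hs, h⟩ := hq.2.2 e he
  refine ⟨s, hs, ?_⟩
  induction e using Sym2.ind with
  | _ x y =>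
  rw [vertexEdgeDist_mk, vertexEdgeDist_mk, h x (by simp), h y (by simp)]
  omega

lemma IsAnchor.notMem_tail {q q' : V} {P : List V} (hq : G.IsAnchor S q) (hP : G.Tail q' P)
    (hPS : ∀ x ∈ P, x ∉ S) : q ∉ P :=
  hq.1.elim (fun h hqP => hPS q hqP h) fun h => hP.notMem_of_degree h

/-- The anchor `q` is on a shortest path from some `s` to `e'`, so `t = d(q, q') + t'`. By symmetry
`q = q'` and `t = t'`. Two different tails at `q` are excluded by branch resolution if `q` has
degree at least three; otherwise they would exhaust `G`, which has a cycle. -/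
lemma IsBBR.false_of_anchored_anchored (hG : G.IsCactus) (hC : C ∈ G.cycleSubgraphs)
    (hS : G.IsBBR S) {q q' : V} {P P' : List V} {t t' : ℕ} {e e' : Sym2 V} (hP : G.Tail q P)
    (hPS : ∀ x ∈ P, x ∉ S) (he : G.IsTailEdge P t e) (hq : G.IsAnchor S q) (hP' : G.Tail q' P')
    (hPS' : ∀ x ∈ P', x ∉ S) (he' : G.IsTailEdge P' t' e') (hq' : G.IsAnchor S q') (hne : e ≠ e')
    (heq : ∀ s ∈ S, G.vertexEdgeDist s e = G.vertexEdgeDist s e') : False := by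
  have hqP' := hq.notMem_tail hP' hPS'
  have hqP := hq'.notMem_tail hP hPS
  obtain ⟨s, hs, h1⟩ := hq.vertexEdgeDist_eq (hP'.edge_mem he').1
  obtain ⟨s', hs', h2⟩ := hq'.vertexEdgeDist_eq (hP.edge_mem he).1
  rw [← heq s hs, hP.vertexEdgeDist hG.1 he fun h => hPS s h hs,
    hP'.vertexEdgeDist hG.1 he' hqP'] at h1
  rw [heq s' hs', hP'.vertexEdgeDist hG.1 he' fun h => hPS' s' h hs',
    hP.vertexEdgeDist hG.1 he hqP] at h2
  obtain rfl : q = q' := (hG.1.dist_eq_zero_iff).1 (by omega)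
  obtain rfl : t = t' := by rw [dist_self] at h1; omega
  by_cases hPP : P = P'
  · subst hPP
    exact hne (Tail.edge_unique he he')
  by_cases hd : 3 ≤ G.degree q
  · exact hPP (Tail.eq_of_free hS.2 hd hP hP' hPS hPS')
  obtain ⟨u, hu, huq⟩ := hP.exists_adj
  obtain ⟨u', hu', huq'⟩ := hP'.exists_adj
  have huu : u ≠ u' := by
    rintro rfl
    exact hPP (hP.unique hP' hqP' hqP hu hu').2
  have hpos : 0 < G.degree q := (G.degree_pos_iff_exists_adj q).2 ⟨u, huq.symm⟩
  have hd2 : G.degree q = 2 := by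
    by_contra h
    exact huu (eq_of_degree_eq_one (by omega) huq'.symm huq.symm)
  have hall := hG.1.mem_of_closed (K := {x | x ∈ P ∨ x ∈ P' ∨ x = q}) (x := q) (by simp) (by
    rintro z (hz | hz | rfl) z' hzz'
    · exact (hP.mem_or_eq hz hzz').imp_right Or.inr
    · exact Or.inr (hP'.mem_or_eq hz hzz')
    · rcases eq_or_eq_of_degree_eq_two hd2 huu huq.symm huq'.symm hzz' with rfl | rfl
      · exact Or.inl hu
      · exact Or.inr (Or.inl hu'))
  obtain ⟨x, hx, hxq⟩ := exists_ne_mem_verts hC q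
  rcases hall x with h | h | h
  · exact hP.notMem_verts hC h hx
  · exact hP'.notMem_verts hC h hx
  · exact hxq h

section Gates

variable {v : V} {w : G.Walk v v} {k : ℕ} {lab : V → ℕ} {e e' : Sym2 V} {F F' : ℕ → ℕ}

/-- The anchor property expresses `t` through the distance from `q` to `e'`. A vertex of `S` with
another gate than `q` would then see `e'` from farther than a detour through the gate of `q` allows,
unless `q` itself is on `C`. In that case `S` sees `e'` through `q`, and the free tail at `q` gives
D. -/
lemma IsBBR.false_of_anchored_profile (hG : G.IsCactus) (hS : G.IsBBR S)
    (hADE : ¬ G.ContainsADE S C) (hL : G.IsSPathLabelling S C w k)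
    (h : Gates G C w.length w.getVert lab) (hF : IsProfile G S w.length w.getVert lab e' F)
    (he' : e' ∈ G.edgeSet) {q : V} {P : List V} {t : ℕ} (hP : G.Tail q P)
    (hPS : ∀ x ∈ P, x ∉ S) (he : G.IsTailEdge P t e) (hq : G.IsAnchor S q)
    (heq : ∀ s ∈ S, G.vertexEdgeDist s e = G.vertexEdgeDist s e') : False := by
  have hk : ∀ s ∈ S, G.dist s q + t = G.dist s (w.getVert (lab s)) + F (lab s) := by
    intro s hs
    rw [← hF.dist_eq hG.1 h (Or.inl hs), ← heq s hs,
      hP.vertexEdgeDist hG.1 he fun h => hPS s h hs]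
  obtain ⟨s, hs, h1⟩ := hq.vertexEdgeDist_eq he'
  rw [hF.dist_eq hG.1 h (Or.inl hs), hF.dist_eq hG.1 h hq.1, ← hk s hs] at h1
  have h2 : ∀ s ∈ S, lab s ≠ lab q → F (lab s) =
      cycDist w.length (lab s) (lab q) + 2 * G.dist q (w.getVert (lab q)) + F (lab q) := by
    intro s hs hne
    have := hk s hs
    rw [h.dist_eq hG.1 hne, dist_comm (v := q)] at this
    omega
  obtain ⟨s₁, hs₁, hne₁⟩ := h.exists_lab_ne (hS.1 C h.mem) (lab q)
  have h3 := hF.le_add (h.lt s₁) (h.lt q)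
  have h4 := h2 s₁ hs₁ hne₁
  have h0 : G.dist q (w.getVert (lab q)) = 0 := by omega
  have hqf : q = w.getVert (lab q) := (hG.1.dist_eq_zero_iff).1 h0
  have hqC : q ∈ C.verts := hqf ▸ h.mem_verts (h.lt q).le
  have hact := hq.2.1 C h.mem hqC
  rw [hqf, h.isSActive_iff (h.lt q)] at hact
  have hcr := hF.critical hL h hact fun s hs => by
    by_cases hne : lab s = lab q
    · rw [hne, cycDist_self, zero_add]
    · rw [h2 s hs hne, h0]
      omega
  obtain ⟨u, hu, huq⟩ := hP.exists_adj
  have hd : 3 ≤ G.degree q := three_le_degree_of_mem_verts h.mem hqC huq.symm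
    fun hh => hP.notMem_verts h.mem hu (C.mem_verts_of_mem_edge hh (Sym2.mem_mk_right _ _))
  exact hADE ⟨v, w, k, hL, Or.inr (Or.inl ⟨hcr.1, lab q, P,
    by rw [← hqf]; exact ⟨isThread_iff.2 ⟨hd, hP⟩, hPS⟩, hcr.2⟩)⟩

/-- A vertex of `S` that does not hang at `r` on `C` sees `C'` through `r` and then `r'`. -/
lemma Gates.profile_eq_of_ne (hG : G.IsCactus) {g g' : ℕ} {f f' : ℕ → V} {lab lab' : V → ℕ}
    (h : Gates G C g f lab) (h' : Gates G C' g' f' lab') {r r' : V} (hr : r ∈ C.verts)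
    (hr' : r' ∈ C'.verts) (h1 : C'.verts ⊆ G.hangingPart C r) (h2 : C.verts ⊆ G.hangingPart C' r')
    (hF : IsProfile G S g f lab e F) (hF' : IsProfile G S g' f' lab' e' F')
    (heq : ∀ s ∈ S, G.vertexEdgeDist s e = G.vertexEdgeDist s e') {s : V} (hs : s ∈ S)
    (hne : lab s ≠ lab r) : lab' s = lab' r' ∧
      F (lab s) = cycDist g (lab s) (lab r) + G.dist r r' + F' (lab' r') := by
  have hfr := h.f_lab hr
  have hfr' := h'.f_lab hr'
  have hls : lab' s = lab' r' := by
    refine (h'.mem_iff s _ (h'.lt r')).1 ?_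
    rw [hfr']
    refine hangingPart_subset_hangingPart hG h.mem hr h1 h2 (h.mem_verts (h.lt s).le) ?_
      (h.mem_self s)
    rintro rfl
    exact hne (h.lab_f (h.lt s)).symm
  refine ⟨hls, ?_⟩
  have hlr : lab r' = lab r := by
    refine (h.mem_iff r' _ (h.lt r)).1 ?_
    rw [hfr]
    exact h1 hr'
  have e1 := heq s hs
  rw [hF.dist_eq hG.1 h (Or.inl hs), hF'.dist_eq hG.1 h' (Or.inl hs), hls, hfr',
    h.dist_eq hG.1 (x := s) (y := r') (by rwa [hlr]), hlr, hfr] at e1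
  omega

lemma IsProfile.isEdgeCritical (hF : IsProfile G S w.length w.getVert lab e F)
    (hL : G.IsSPathLabelling S C w k) (h : Gates G C w.length w.getVert lab) {r : V}
    (hr : r ∈ C.verts) (hact : ∃ s ∈ S, lab s = lab r)
    (hs : ∀ s ∈ S, F (lab s) = cycDist w.length (lab s) (lab r) + F (lab r)) :
    G.IsEdgeCritical S C r := by
  have hcr := hF.critical hL h hact hs
  refine ⟨v, w, k, hL, ?_, hcr.1⟩
  rw [← h.f_lab hr]
  rcases hL.eq_zero_or_eq h hact hcr.2 with h | h <;> simp [h]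

/-- By biactivity each cycle has a vertex of `S` beyond it as seen from the other. The two resulting
inequalities between `F` at `r` and `F'` at `r'` both contain `d(r, r')` on the larger side's
expense, so `r = r'`. All of `S` then sees both edges through this vertex. -/
lemma IsBBR.incident_of_profile (hG : G.IsCactus) (hS : G.IsBBR S) {v' : V} {w' : G.Walk v' v'}
    {k' : ℕ} {lab' : V → ℕ} (hne : C ≠ C') (hL : G.IsSPathLabelling S C w k)
    (h : Gates G C w.length w.getVert lab) (hL' : G.IsSPathLabelling S C' w' k')
    (h' : Gates G C' w'.length w'.getVert lab') (hF : IsProfile G S w.length w.getVert lab e F)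
    (hF' : IsProfile G S w'.length w'.getVert lab' e' F')
    (heq : ∀ s ∈ S, G.vertexEdgeDist s e = G.vertexEdgeDist s e') :
    (G.edgeCriticalIncidence S).Adj C C' := by
  obtain ⟨r, hr, h1⟩ := verts_subset_hangingPart hG h.mem h'.mem hne
  obtain ⟨r', hr', h2⟩ := verts_subset_hangingPart hG h'.mem h.mem hne.symm
  have k1 := fun s hs => h.profile_eq_of_ne hG h' hr hr' h1 h2 hF hF' heq (s := s) hs
  have k2 := fun s hs => h'.profile_eq_of_ne hG h hr' hr h2 h1 hF' hF
    (fun s hs => (heq s hs).symm) (s := s) hs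
  obtain ⟨s₁, hs₁, hn₁⟩ := h.exists_lab_ne (hS.1 C h.mem) (lab r)
  obtain ⟨s₂, hs₂, hn₂⟩ := h'.exists_lab_ne (hS.1 C' h'.mem) (lab' r')
  have l1 := hF.le_add (h.lt s₁) (h.lt r)
  have l2 := hF'.le_add (h'.lt s₂) (h'.lt r')
  have d1 := k1 s₁ hs₁ hn₁
  have d2 := k2 s₂ hs₂ hn₂
  have hcomm := G.dist_comm (u := r) (v := r')
  have h0 : G.dist r r' = 0 := by omega
  obtain rfl : r = r' := (hG.1.dist_eq_zero_iff).1 h0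
  refine ⟨hne, h.mem, h'.mem, r, hr, hr', ?_, ?_⟩
  · refine hF.isEdgeCritical hL h hr ⟨s₂, hs₂, d2.1⟩ fun s hs => ?_
    by_cases hn : lab s = lab r
    · rw [hn, cycDist_self, zero_add]
    · have := k1 s hs hn
      omega
  · refine hF'.isEdgeCritical hL' h' hr' ⟨s₁, hs₁, d1.1⟩ fun s hs => ?_
    by_cases hn : lab' s = lab' r
    · rw [hn, cycDist_self, zero_add]
    · have := k2 s hs hn
      omega

end Gates

lemma EdgeKind.profile {e : Sym2 V} (he : EdgeKind G S e) :
    (∀ e' ∈ G.edgeSet, e ≠ e' → ∃ s ∈ S, G.vertexEdgeDist s e < G.vertexEdgeDist s e') ∨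
    (∃ q P t, G.Tail q P ∧ (∀ x ∈ P, x ∉ S) ∧ G.IsTailEdge P t e ∧ G.IsAnchor S q) ∨
    ∃ C ∈ G.cycleSubgraphs, ∀ g f lab, Gates G C g f lab → ∃ F, IsProfile G S g f lab e F := by
  rcases he with h | @⟨q, P, t, h1, h2, h3, h4⟩ | @⟨C, hC, heC⟩ | @⟨C, q, P, t, hC, hq, ha, hP, he⟩
  · exact Or.inl h
  · exact Or.inr (Or.inl ⟨q, P, t, h1, h2, h3, h4⟩)
  · refine Or.inr (Or.inr ⟨C, hC, fun g f lab h => ?_⟩)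
    obtain ⟨r, hr, rfl⟩ := (h.edges e).1 heC
    exact ⟨_, .edge hr rfl⟩
  · refine Or.inr (Or.inr ⟨C, hC, fun g f lab h => ?_⟩)
    obtain ⟨p, hp, rfl⟩ := (h.verts q).1 hq
    refine ⟨_, .thread hp (fun s hs hsp => ha ?_) hP he⟩
    exact (h.isSActive_iff hp).2 ⟨s, hs, hsp⟩

theorem IsBBR.isEdgeMetricGenerator (hG : G.IsCactus) (hc : 2 ≤ G.cycleSubgraphs.ncard)
    (hS : G.IsBBR S) (hADE : ∀ C ∈ G.cycleSubgraphs, ¬ G.ContainsADE S C)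
    (hinc : ∀ C C', ¬ (G.edgeCriticalIncidence S).Adj C C') : G.IsEdgeMetricGenerator S := by
  intro e he e' he' hne
  by_contra! heq
  have hlab : ∀ C ∈ G.cycleSubgraphs, ∃ (v : V) (w : G.Walk v v) (k : ℕ) (lab : V → ℕ),
      G.IsSPathLabelling S C w k ∧ Gates G C w.length w.getVert lab := by
    intro C hC
    have h2 := hS.1 C hC
    rw [numSActive] at h2
    obtain ⟨x, hx⟩ := Set.nonempty_of_ncard_ne_zero (s := {v | G.IsSActive S C v}) (by omega)
    obtain ⟨v, w, k, hL⟩ := exists_isSPathLabelling hC hx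
    obtain ⟨lab, h⟩ := hL.cycLab.exists_gates hG
    exact ⟨v, w, k, lab, hL, h⟩
  rcases (hS.edgeKind hG hc he).profile with h1 | ⟨q, P, t, hP, hPS, hte, hq⟩ | ⟨C, hC, hF⟩
  · obtain ⟨s, hs, hlt⟩ := h1 e' he' hne
    exact hlt.ne (heq s hs)
  · rcases (hS.edgeKind hG hc he').profile with h1 | ⟨q', P', t', hP', hPS', hte', hq'⟩ | ⟨C, hC, hF⟩
    · obtain ⟨s, hs, hlt⟩ := h1 e he hne.symm
      exact hlt.ne (heq s hs).symm
    · obtain ⟨C, hC⟩ := Set.nonempty_of_ncard_ne_zero (s := G.cycleSubgraphs) (by omega)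
      exact hS.false_of_anchored_anchored hG hC hP hPS hte hq hP' hPS' hte' hq' hne heq
    · obtain ⟨v, w, k, lab, hL, h⟩ := hlab C hC
      obtain ⟨F, hF⟩ := hF _ _ _ h
      exact hS.false_of_anchored_profile hG (hADE C hC) hL h hF he' hP hPS hte hq heq
  · obtain ⟨v, w, k, lab, hL, h⟩ := hlab C hC
    obtain ⟨F, hF⟩ := hF _ _ _ h
    rcases (hS.edgeKind hG hc he').profile with
      h1 | ⟨q', P', t', hP', hPS', hte', hq'⟩ | ⟨C', hC', hF'⟩
    · obtain ⟨s, hs, hlt⟩ := h1 e he hne.symm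
      exact hlt.ne (heq s hs).symm
    · exact hS.false_of_anchored_profile hG (hADE C hC) hL h hF he hP' hPS' hte' hq'
        fun s hs => (heq s hs).symm
    · by_cases hCC : C = C'
      · subst hCC
        obtain ⟨F', hF'⟩ := hF' _ _ _ h
        refine hF.false_of_eq hF' hL h hS (hADE C hC) hne fun s hs => ?_
        have := heq s hs
        rw [hF.dist_eq hG.1 h (Or.inl hs), hF'.dist_eq hG.1 h (Or.inl hs)] at this
        omega
      · obtain ⟨v', w', k', lab', hL', h'⟩ := hlab C' hC'
        obtain ⟨F', hF'⟩ := hF' _ _ _ h'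
        exact hinc C C' (hS.incident_of_profile hG hCC hL h hL' h' hF hF' heq)

end Sufficiency

/-! ### Changing the set: transfer of configurations, and wide cycles -/

section Transfer

variable {V : Type*} {G : SimpleGraph V} {C C' : G.Subgraph} {S T : Finset V} {v : V}
  {w : G.Walk v v} {k : ℕ}

lemma IsActiveLabelling.congr (h : ∀ x, G.IsSActive S C x ↔ G.IsSActive T C x)
    (hL : G.IsActiveLabelling S C w k) : G.IsActiveLabelling T C w k := by
  obtain ⟨h1, h2, h3, h4⟩ := hL
  refine ⟨h1, h2, (h v).1 h3, ?_⟩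
  have : {i | i < w.length ∧ G.IsSActive T C (w.getVert i)} =
      {i | i < w.length ∧ G.IsSActive S C (w.getVert i)} := by
    ext i
    simp [h]
  rwa [this]

lemma IsSPathLabelling.congr (h : ∀ x, G.IsSActive S C x ↔ G.IsSActive T C x)
    (hL : G.IsSPathLabelling S C w k) : G.IsSPathLabelling T C w k :=
  ⟨hL.1.congr h, fun v' w' k' h' => hL.2 v' w' k' (h'.congr fun x => (h x).symm)⟩

lemma IsEdgeCritical.congr (h : ∀ x, G.IsSActive S C x ↔ G.IsSActive T C x) {x : V}
    (hx : G.IsEdgeCritical S C x) : G.IsEdgeCritical T C x := by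
  obtain ⟨v, w, k, hL, hx⟩ := hx
  exact ⟨v, w, k, hL.congr h, hx⟩

lemma numSActive_congr (h : ∀ x, G.IsSActive S C x ↔ G.IsSActive T C x) :
    G.numSActive S C = G.numSActive T C := by
  rw [numSActive, numSActive]
  congr 1
  ext x
  exact h x

lemma IsEdgeCritical.isSActive {x : V} (hx : G.IsEdgeCritical S C x) : G.IsSActive S C x := by
  obtain ⟨v, w, k, hL, rfl | rfl, -⟩ := hx
  · rw [w.getVert_zero]
    exact hL.1.2.2.1
  · exact hL.1.2.2.2.1.2

lemma CycLab.ncard_verts {g : ℕ} {f : ℕ → V} (h : CycLab G C g f) : C.verts.ncard = g := by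
  have : C.verts = f '' (Finset.range g : Set ℕ) := by
    ext x
    rw [h.verts]
    simp
  rw [this, Set.InjOn.ncard_image, Set.ncard_coe_finset, Finset.card_range]
  intro i hi j hj hij
  exact h.inj i (by simpa using hi) j (by simpa using hj) hij

end Transfer

section Monotone

variable {V : Type*} [Fintype V] {G : SimpleGraph V} [DecidableRel G.Adj] {C C' : G.Subgraph}
  {S T : Finset V}

lemma IsFreeThread.of_notMem_hangingPart {v : V} {P : List V} (hC : C ∈ G.cycleSubgraphs)
    (h : G.IsFreeThread S v P) (hv : ∀ s ∈ T, s ∉ G.hangingPart C v) : G.IsFreeThread T v P :=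
  ⟨h.1, fun _ hx hxT => hv _ hxT (((isThread_iff.1 h.1).2.mem_hangingPart_iff hC hx).2
    (mem_hangingPart_self C v))⟩

/-- On a cycle with two active vertices and without configuration `A` both of these are
edge-critical. -/
lemma isEdgeCritical_of_numSActive_eq_two (hG : G.IsCactus) (hC : C ∈ G.cycleSubgraphs)
    (h2 : G.numSActive S C = 2) (hADE : ¬ G.ContainsADE S C) {x : V} (hx : G.IsSActive S C x) :
    G.IsEdgeCritical S C x := by
  obtain ⟨v, w, k, hL⟩ := exists_isSPathLabelling hC hx
  obtain ⟨lab, h⟩ := hL.cycLab.exists_gates hG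
  have hk0 := hL.ne_zero h h2.ge
  obtain ⟨s₀, hs₀, hl0⟩ := hL.exists_lab_zero h
  obtain ⟨s₁, hs₁, hl1⟩ := hL.exists_lab_eq h
  have hlab : ∀ s ∈ S, lab s = 0 ∨ lab s = k := fun s hs => by
    have := h.lab_eq_or_eq h2 hs₀ hs₁ hs (by omega)
    rwa [hl0, hl1] at this
  have hkk := hL.le_sub h hlab
  refine ⟨v, w, k, hL, ?_, ?_⟩
  · obtain ⟨i, hi, rfl⟩ := (h.verts x).1 hx.1
    obtain ⟨s, hs, rfl⟩ := (h.isSActive_iff hi).1 hx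
    rcases hlab s hs with h | h <;> simp [h]
  · by_contra hlt
    have h3 := h.three_le
    exact hADE ⟨v, w, k, hL, Or.inl ⟨h2, Nat.even_iff.2 (by omega), by omega⟩⟩

/-- Neither set meets the part that hangs at an inactive vertex, so the threads there stay free. The
active vertices at which D or E asks for a thread are ends of the `S`-path, and these are
edge-critical: for D by its bound on `k`, for E because otherwise A occurs. -/
theorem ContainsADE.mono (hG : G.IsCactus) (hC : C ∈ G.cycleSubgraphs)
    (hact : ∀ x, G.IsSActive S C x ↔ G.IsSActive T C x)
    (hth : ∀ v P, G.IsEdgeCritical T C v → G.IsFreeThread S v P →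
      ∃ Q, G.IsFreeThread T v Q ∧ P.length ≤ Q.length) (hS : G.ContainsADE S C) :
    G.ContainsADE T C := by
  by_contra hT
  obtain ⟨v, w, k, hL, hADE⟩ := hS
  have hLT := hL.congr hact
  obtain ⟨lab, h⟩ := hLT.cycLab.exists_gates hG
  have hnum := numSActive_congr hact
  have hth' : ∀ i < w.length, ((∀ s ∈ T, lab s ≠ i) ∨ G.IsEdgeCritical T C (w.getVert i)) →
      ∀ P, G.IsFreeThread S (w.getVert i) P →
      ∃ Q, G.IsFreeThread T (w.getVert i) Q ∧ P.length ≤ Q.length := by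
    rintro i hi (hno | hi') P hP
    · refine ⟨P, hP.of_notMem_hangingPart hC fun s hs hs' => ?_, le_rfl⟩
      exact hno s hs ((h.mem_iff s i hi).1 hs')
    · exact hth _ P hi' hP
  have h3 := h.three_le
  have hk := hL.lt_length
  have hle := fun s (hs : s ∈ T) => hLT.lab_le h hs
  rcases hADE with ⟨h1, h2, h3⟩ | ⟨hkg, i, P, hP, hi⟩ | ⟨h2, i, hik, ⟨P, hP, hPl⟩, hQ⟩
  · exact hT ⟨v, w, k, hLT, Or.inl ⟨hnum ▸ h1, h2, h3⟩⟩
  · have hi' := hi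
    rw [Set.mem_Icc, Set.mem_Icc] at hi'
    obtain ⟨Q, hQ, -⟩ := hth' i (by omega) (by
      by_cases h0 : i = 0 ∨ i = k
      · exact Or.inr ⟨v, w, k, hLT, by rcases h0 with h | h <;> simp [h], hkg⟩
      · refine Or.inl fun s hs hsi => ?_
        have := hle s hs
        omega) P hP
    exact hT ⟨v, w, k, hLT, Or.inr (Or.inl ⟨hkg, i, Q, hQ, hi⟩)⟩
  · rw [hnum] at h2
    have hk0 := hLT.ne_zero h h2.ge
    obtain ⟨s₀, hs₀, hl0⟩ := hLT.exists_lab_zero h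
    obtain ⟨s₁, hs₁, hl1⟩ := hLT.exists_lab_eq h
    have hlab : ∀ s ∈ T, lab s = 0 ∨ lab s = k := fun s hs => by
      have := h.lab_eq_or_eq h2 hs₀ hs₁ hs (by omega)
      rwa [hl0, hl1] at this
    have hkk := hLT.le_sub h hlab
    obtain ⟨P', hP', hPP'⟩ := hth' i (by omega) (by
      by_cases h0 : i = 0 ∨ i = k
      · refine Or.inr (isEdgeCritical_of_numSActive_eq_two hG hC h2 hT ?_)
        rw [h.isSActive_iff (by omega)]
        rcases h0 with rfl | rfl
        · exact ⟨s₀, hs₀, hl0⟩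
        · exact ⟨s₁, hs₁, hl1⟩
      · refine Or.inl fun s hs hsi => ?_
        have := hlab s hs
        omega) P hP
    refine hT ⟨v, w, k, hLT, Or.inr (Or.inr ⟨h2, i, hik, ⟨P', hP', by omega⟩, fun he => ?_⟩)⟩
    obtain ⟨Q, hQ⟩ := hQ he
    have hkA : k ≠ w.length / 2 := fun h' => hT ⟨v, w, k, hLT, Or.inl ⟨h2, he, h'⟩⟩
    -- As `i ≤ k < g/2`, the index `j` is larger than `k` and less than `g`, so `v_j` is inactive.
    rw [Nat.mod_eq_of_lt (by omega)] at hQ ⊢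
    obtain ⟨Q', hQ', -⟩ := hth' _ (by omega) (Or.inl fun s hs hsi => by
      have := hlab s hs
      omega) Q hQ
    exact ⟨Q', hQ'⟩

/-- Three active vertices such that every half cycle contains one of them. -/
def IsWide (G : SimpleGraph V) (S : Finset V) (C : G.Subgraph) : Prop :=
  ∃ x y z, G.IsSActive S C x ∧ G.IsSActive S C y ∧ G.IsSActive S C z ∧ x ≠ y ∧ x ≠ z ∧ y ≠ z ∧
    G.dist x y + G.dist y z + G.dist z x = C.verts.ncard

/-- The three distances add up to `g` only if each arc between consecutive ones of these vertices
has length at most `g/2`. An `S`-path omits at most one such arc. -/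
lemma IsWide.lt (hG : G.IsCactus) (hS : IsWide G S C) {v : V} {w : G.Walk v v} {k : ℕ}
    (hL : G.IsSPathLabelling S C w k) : (w.length + 1) / 2 - 1 < k := by
  obtain ⟨x, y, z, hx, hy, hz, hxy, hxz, hyz, hd⟩ := hS
  obtain ⟨lab, h⟩ := hL.cycLab.exists_gates hG
  obtain ⟨i, hi, rfl⟩ := (h.verts x).1 hx.1
  obtain ⟨j, hj, rfl⟩ := (h.verts y).1 hy.1
  obtain ⟨l, hl, rfl⟩ := (h.verts z).1 hz.1
  rw [h.dist_f hG.1 hi hj, h.dist_f hG.1 hj hl, h.dist_f hG.1 hl hi, h.ncard_verts] at hd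
  have hi' : i ≤ k := hL.1.2.2.2.2 ⟨hi, hx⟩
  have hj' : j ≤ k := hL.1.2.2.2.2 ⟨hj, hy⟩
  have hl' : l ≤ k := hL.1.2.2.2.2 ⟨hl, hz⟩
  have hij : i ≠ j := fun h => hxy (h ▸ rfl)
  have hil : i ≠ l := fun h => hxz (h ▸ rfl)
  have hjl : j ≠ l := fun h => hyz (h ▸ rfl)
  have h1 := cycDist_cases hi hj
  have h2 := cycDist_cases hj hl
  have h3 := cycDist_cases hl hi
  have h4 := h.three_le
  omega

lemma IsWide.not_isEdgeCritical (hG : G.IsCactus) (hS : IsWide G S C) (x : V) :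
    ¬ G.IsEdgeCritical S C x := by
  rintro ⟨v, w, k, hL, -, hk⟩
  have := hS.lt hG hL
  omega

lemma IsWide.not_containsADE (hG : G.IsCactus) (hS : IsWide G S C) : ¬ G.ContainsADE S C := by
  have h3 : 2 < G.numSActive S C := by
    obtain ⟨x, y, z, hx, hy, hz, hxy, hxz, hyz, -⟩ := hS
    exact (Set.two_lt_ncard (Set.toFinite _)).2 ⟨x, hx, y, hy, z, hz, hxy, hxz, hyz⟩
  rintro ⟨v, w, k, hL, ⟨h2, -⟩ | ⟨hk, -⟩ | ⟨h2, -⟩⟩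
  · omega
  · have := hS.lt hG hL
    omega
  · omega

lemma exists_wide (hG : G.IsCactus) (hC : C ∈ G.cycleSubgraphs) (h2 : 2 ≤ G.numSActive S C) :
    ∃ z ∈ C.verts, ∀ S' : Finset V, S ⊆ S' → z ∈ S' → IsWide G S' C := by
  obtain ⟨x, hx, y, hy, hxy⟩ := (Set.one_lt_ncard (Set.toFinite _)).1 h2
  obtain ⟨g, f, lab, h, rfl⟩ := exists_gates_zero hG hC hx.1
  obtain ⟨i, hi, rfl⟩ := (h.verts y).1 hy.1
  have h3 := h.three_le
  have hi0 : i ≠ 0 := fun h => hxy (h ▸ rfl)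
  -- The third vertex is chosen opposite to `i`, or next to `i` if the opposite vertex is `0`.
  have hz : ∃ z < g, z ≠ 0 ∧ z ≠ i ∧ cycDist g 0 i + cycDist g i z + cycDist g z 0 = g := by
    by_cases hig : 2 * i ≤ g
    · by_cases h1 : i + g / 2 < g
      · refine ⟨i + g / 2, h1, by omega, by omega, ?_⟩
        have h4 := cycDist_cases (show 0 < g by omega) hi
        have h5 := cycDist_cases hi h1
        have h6 := cycDist_cases h1 (show 0 < g by omega)
        omega
      · have h7 : i + 1 < g := by omega
        refine ⟨i + 1, by omega, by omega, by omega, ?_⟩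
        have h4 := cycDist_cases (show 0 < g by omega) hi
        have h5 := cycDist_cases hi h7
        have h6 := cycDist_cases h7 (show 0 < g by omega)
        omega
    · have h7 : i - g / 2 < g := by omega
      by_cases h1 : i = g / 2
      · have h7 : 1 < g := by omega
        refine ⟨1, h7, by omega, by omega, ?_⟩
        have h4 := cycDist_cases (show 0 < g by omega) hi
        have h5 := cycDist_cases hi h7
        have h6 := cycDist_cases h7 (show 0 < g by omega)
        omega
      · refine ⟨i - g / 2, h7, by omega, by omega, ?_⟩
        have h4 := cycDist_cases (show 0 < g by omega) hi
        have h5 := cycDist_cases hi h7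
        have h6 := cycDist_cases h7 (show 0 < g by omega)
        omega
  obtain ⟨z, hz, hz0, hzi, hsum⟩ := hz
  refine ⟨f z, h.mem_verts hz.le, fun S' hSS hzS => ⟨f 0, f i, f z, ?_, ?_, ?_, hxy,
    fun h' => hz0 (h.inj _ hz _ (by omega) h'.symm), fun h' => hzi (h.inj _ hz _ hi h'.symm), ?_⟩⟩
  · obtain ⟨h1, s, hs, h2⟩ := hx
    exact ⟨h1, s, hSS hs, h2⟩
  · obtain ⟨h1, s, hs, h2⟩ := hy
    exact ⟨h1, s, hSS hs, h2⟩
  · exact ⟨h.mem_verts hz.le, _, hzS, mem_hangingPart_self _ _⟩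
  · rw [h.dist_f hG.1 (by omega) hi, h.dist_f hG.1 hi hz, h.dist_f hG.1 hz (by omega),
      h.ncard_verts, hsum]

/-- A second active vertex of `C'`, away from the one at which `C` hangs, provides a vertex of `S`,
and this hangs at `r` on `C`. -/
lemma IsBBR.exists_mem_of_subset (hG : G.IsCactus) (hS : G.IsBBR S) (hC : C ∈ G.cycleSubgraphs)
    (hC' : C' ∈ G.cycleSubgraphs) (hne : C ≠ C') {r : V}
    (hsub : C'.verts ⊆ G.hangingPart C r) : ∃ s ∈ S, s ∈ G.hangingPart C r := by
  obtain ⟨r', hr', h2⟩ := verts_subset_hangingPart hG hC' hC hne.symm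
  have hb := hS.1 C' hC'
  rw [numSActive] at hb
  obtain ⟨u, ⟨hu, s, hs, hsu⟩, hne⟩ := Set.exists_ne_of_one_lt_ncard hb r'
  exact ⟨s, hs, hangingPart_subset_hangingPart hG hC' hr' h2 hsub hu hne hsu⟩

lemma IsBBR.mono (hS : G.IsBBR S) (hST : S ⊆ T) : G.IsBBR T := by
  refine ⟨fun C hC => (hS.1 C hC).trans (Set.ncard_le_ncard ?_ (Set.toFinite _)),
    fun v P Q hP hQ => hS.2 v P Q ⟨hP.1, fun x hx h => hP.2 x hx (hST h)⟩
      ⟨hQ.1, fun x hx h => hQ.2 x hx (hST h)⟩⟩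
  rintro v ⟨hv, s, hs, h⟩
  exact ⟨hv, s, hST hs, h⟩

/-- The cycles in `X` become wide. For another cycle, an added vertex hangs where `S` already has
vertices, so its active vertices stay the same and it can only lose free threads. -/
theorem IsBBR.exists_isEdgeMetricGenerator (hG : G.IsCactus) (hc : 2 ≤ G.cycleSubgraphs.ncard)
    (hS : G.IsBBR S) (X : Finset G.Subgraph) (hX : ∀ C ∈ X, C ∈ G.cycleSubgraphs)
    (hADE : ∀ C ∈ G.cycleSubgraphs, C ∉ X → ¬ G.ContainsADE S C)
    (hinc : ∀ C C', C ∉ X → C' ∉ X → ¬ (G.edgeCriticalIncidence S).Adj C C') :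
    ∃ T : Finset V, G.IsEdgeMetricGenerator T ∧ T.card ≤ S.card + X.card := by
  classical
  have hex : ∀ C : G.Subgraph, ∃ z, C ∈ X →
      z ∈ C.verts ∧ ∀ S' : Finset V, S ⊆ S' → z ∈ S' → IsWide G S' C := by
    intro C
    by_cases hCX : C ∈ X
    · obtain ⟨z, hz⟩ := exists_wide hG (hX C hCX) (hS.1 C (hX C hCX))
      exact ⟨z, fun _ => hz⟩
    · exact ⟨hG.1.nonempty.some, fun h => absurd h hCX⟩
  choose z hz using hex
  set T := S ∪ X.image z with hT
  have hST : S ⊆ T := Finset.subset_union_left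
  have hwide : ∀ C ∈ X, IsWide G T C := fun C hC => (hz C hC).2 T hST
    (Finset.mem_union_right _ (Finset.mem_image_of_mem _ hC))
  have hact : ∀ C ∈ G.cycleSubgraphs, C ∉ X →
      ∀ x, G.IsSActive T C x ↔ G.IsSActive S C x := by
    intro C hC hCX x
    refine ⟨?_, fun ⟨h1, s, hs, h2⟩ => ⟨h1, s, hST hs, h2⟩⟩
    rintro ⟨hx, s, hs, hsx⟩
    rw [hT, Finset.mem_union, Finset.mem_image] at hs
    rcases hs with hs | ⟨C', hC', rfl⟩
    · exact ⟨hx, s, hs, hsx⟩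
    · have hne : C ≠ C' := fun h => hCX (h ▸ hC')
      obtain ⟨r, hr, hsub⟩ := verts_subset_hangingPart hG hC (hX C' hC') hne
      obtain rfl := hangingPart_unique hG hC hr hx (hsub (hz C' hC').1) hsx
      exact ⟨hx, hS.exists_mem_of_subset hG hC (hX C' hC') hne hsub⟩
  refine ⟨T, (hS.mono hST).isEdgeMetricGenerator hG hc ?_ ?_, ?_⟩
  · intro C hC
    by_cases hCX : C ∈ X
    · exact (hwide C hCX).not_containsADE hG
    · refine fun h => hADE C hC hCX (h.mono hG hC (hact C hC hCX) fun v P _ hP => ?_)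
      exact ⟨P, ⟨hP.1, fun x hx hxS => hP.2 x hx (hST hxS)⟩, le_rfl⟩
  · rintro C C' ⟨hne, hC, hC', x, hx, hx', h1, h2⟩
    have hCX : C ∉ X := fun h => (hwide C h).not_isEdgeCritical hG x h1
    have hCX' : C' ∉ X := fun h => (hwide C' h).not_isEdgeCritical hG x h2
    exact hinc C C' hCX hCX' ⟨hne, hC, hC', x, hx, hx', h1.congr (hact C hC hCX),
      h2.congr (hact C' hC' hCX')⟩
  · exact (Finset.card_union_le _ _).trans (Nat.add_le_add_left Finset.card_image_le _)

end Monotone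

/-! ### Disjoint regions and the size of a smallest BBR set -/

section Regions

variable {V : Type*} [Fintype V] {G : SimpleGraph V} [DecidableRel G.Adj] {C C' : G.Subgraph}
  {S T : Finset V}

/-- The vertex `v` is branch-active on all the cycles that contain it. -/
def IsJunction (G : SimpleGraph V) [DecidableRel G.Adj] (v : V) : Prop :=
  ∀ C ∈ G.cycleSubgraphs, v ∈ C.verts → G.IsBranchActive C v

/-- The pairwise disjoint sets which every small BBR set has to meet. -/
def region (G : SimpleGraph V) [DecidableRel G.Adj] : V ⊕ G.Subgraph → Set V
  | .inl v => {x | G.IsJunction v ∧ ∃ P, G.IsThread v P ∧ x ∈ P}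
  | .inr C => {x | G.IsEndCycle C ∧ x ∈ G.privatePart C}

lemma isJunction_of_isBranchActive (hG : G.IsCactus) (hC : C ∈ G.cycleSubgraphs) {v : V}
    (hv : G.IsBranchActive C v) : G.IsJunction v := by
  intro C' hC' hv'
  by_cases hne : C = C'
  · exact hne ▸ hv
  · exact ⟨hv', Or.inl (four_le_degree_of_two_cycles hG hC hC' hne hv.1 hv')⟩

lemma IsEndCycle.exists_unique (hC : G.IsEndCycle C) :
    ∃ x, G.IsBranchActive C x ∧ ∀ y, G.IsBranchActive C y → y = x := by
  obtain ⟨x, hx⟩ := Set.ncard_eq_one.1 hC.2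
  refine ⟨x, ?_, fun y hy => ?_⟩
  · exact (Set.ext_iff.1 hx x).2 rfl
  · exact (Set.ext_iff.1 hx y).1 hy

lemma IsEndCycle.exists_mem_privatePart (hC : G.IsEndCycle C) : ∃ x, x ∈ G.privatePart C := by
  obtain ⟨x, hx, huniq⟩ := hC.exists_unique
  obtain ⟨u, hu, hne⟩ := exists_ne_mem_verts hC.1 x
  exact ⟨u, u, hu, fun h => hne (huniq u h), mem_hangingPart_self _ _⟩

/-- The part of a cycle that is not behind its branch-active vertices does not meet any region,
except for its own. -/
lemma eq_of_mem_region (hG : G.IsCactus) (hC : C ∈ G.cycleSubgraphs) {x : V}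
    (hx : x ∈ G.privatePart C) {i : V ⊕ G.Subgraph} (hi : x ∈ G.region i) : i = .inr C := by
  obtain ⟨u, hu, hub, hxu⟩ := hx
  rcases i with v | C'
  · obtain ⟨hv, P, hP, hxP⟩ := hi
    rw [isThread_iff] at hP
    rw [hP.2.mem_hangingPart_iff hC hxP] at hxu
    by_cases hvu : v = u
    · subst hvu
      exact absurd (hv C hC hu) hub
    · exact absurd ⟨hu, Or.inr ⟨v, hxu, hvu, hP.1⟩⟩ hub
  · obtain ⟨hC', u', hu', hub', hxu'⟩ := hi
    by_contra hne
    replace hne : C ≠ C' := fun h => hne (h ▸ rfl)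
    obtain ⟨r, hr, h1⟩ := verts_subset_hangingPart hG hC hC'.1 hne
    obtain ⟨r', hr', h2⟩ := verts_subset_hangingPart hG hC'.1 hC hne.symm
    have hur : u ≠ r := by
      rintro rfl
      exact hub (isBranchActive_of_subset hG hC hC'.1 hne hr h1)
    have := hangingPart_subset_hangingPart hG hC hr h1 h2 hu hur hxu
    obtain rfl := hangingPart_unique hG hC'.1 hr' hu' this hxu'
    exact hub' (isBranchActive_of_subset hG hC'.1 hC (Ne.symm hne) hr' h2)

lemma thread_unique {v v' x : V} {P P' : List V} (hP : G.IsThread v P) (hP' : G.IsThread v' P')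
    (hx : x ∈ P) (hx' : x ∈ P') : v = v' ∧ P = P' := by
  rw [isThread_iff] at hP hP'
  exact hP.2.unique hP'.2 (hP'.2.notMem_of_degree hP.1) (hP.2.notMem_of_degree hP'.1) hx hx'

lemma region_unique (hG : G.IsCactus) {x : V} {i j : V ⊕ G.Subgraph} (hi : x ∈ G.region i)
    (hj : x ∈ G.region j) : i = j := by
  rcases i with v | C
  · rcases j with v' | C'
    · obtain ⟨-, P, hP, hx⟩ := hi
      obtain ⟨-, P', hP', hx'⟩ := hj
      rw [(thread_unique hP hP' hx hx').1]
    · exact eq_of_mem_region hG hj.1.1 hj.2 hi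
  · exact (eq_of_mem_region hG hi.1.1 hi.2 hj).symm

lemma finite_threads (v : V) : {P : List V | G.IsThread v P}.Finite := by
  classical
  have : Finite {P : List V // P.Nodup} := Finite.of_fintype _
  exact Set.Finite.subset (s := {P : List V | P.Nodup}) this fun P hP => hP.2.1

lemma four_le_degree_of_threads (hC : C ∈ G.cycleSubgraphs) {v : V} (hv : v ∈ C.verts)
    (h : 1 < G.numThreads v) : 4 ≤ G.degree v := by
  obtain ⟨P, hP, Q, hQ, hne⟩ := (Set.one_lt_ncard (finite_threads v)).1 h
  have hP' := (isThread_iff.1 hP).2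
  have hQ' := (isThread_iff.1 hQ).2
  obtain ⟨a, ha, hav⟩ := hP'.exists_adj
  obtain ⟨b, hb, hbv⟩ := hQ'.exists_adj
  refine four_le_degree_of_mem_verts hC hv hav.symm ?_ hbv.symm ?_ ?_
  · exact fun h => hP'.notMem_verts hC ha (C.mem_verts_of_mem_edge h (Sym2.mem_mk_right _ _))
  · exact fun h => hQ'.notMem_verts hC hb (C.mem_verts_of_mem_edge h (Sym2.mem_mk_right _ _))
  · rintro rfl
    exact hne (thread_unique hP hQ ha hb).2

/-- Thus `L(G)` only counts threads at junctions. The thread at a vertex that is no junction lies in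
the private part of a cycle. -/
lemma isJunction_of_numThreads {v : V} (h : 1 < G.numThreads v) : G.IsJunction v :=
  fun _ hC hv => ⟨hv, Or.inl (four_le_degree_of_threads hC hv h)⟩

open Classical in
/-- The number of vertices of `S` in a region. -/
noncomputable def regionCard (G : SimpleGraph V) [DecidableRel G.Adj] (S : Finset V)
    (i : V ⊕ G.Subgraph) : ℕ := (S.filter (· ∈ G.region i)).card

open Classical in
/-- The number of vertices that a BBR set has to have in a region. -/
noncomputable def regionBound (G : SimpleGraph V) [DecidableRel G.Adj] : V ⊕ G.Subgraph → ℕ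
  | .inl v => G.numThreads v - 1
  | .inr C => if G.IsEndCycle C then 1 else 0

noncomputable instance : Fintype G.Subgraph := Fintype.ofFinite _

lemma sum_regionBound : ∑ i, G.regionBound i = G.threadExcess + {C | G.IsEndCycle C}.ncard := by
  classical
  rw [Fintype.sum_sum_type]
  congr 1
  · rw [threadExcess, Finset.sum_filter]
    refine Finset.sum_congr rfl fun v _ => ?_
    simp only [regionBound]
    split_ifs <;> omega
  · simp only [regionBound]
    rw [← Finset.card_filter, ← Set.ncard_coe_finset]
    congr 1
    ext
    simp

lemma sum_regionCard_add (hG : G.IsCactus) (S : Finset V) [DecidablePred fun x => ∀ i, x ∉ G.region i] :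
    ∑ i, G.regionCard S i + (S.filter fun x => ∀ i, x ∉ G.region i).card = S.card := by
  classical
  have h1 : ∑ i, G.regionCard S i =
      (Finset.univ.biUnion fun i => S.filter (· ∈ G.region i)).card := by
    rw [Finset.card_biUnion]
    · rfl
    · intro i _ j _ hij
      rw [Function.onFun, Finset.disjoint_left]
      intro x hx hx'
      exact hij (region_unique hG (Finset.mem_filter.1 hx).2 (Finset.mem_filter.1 hx').2)
  rw [h1, ← Finset.card_union_of_disjoint]
  · congr 1
    ext x
    simp only [Finset.mem_union, Finset.mem_biUnion, Finset.mem_univ, Finset.mem_filter, true_and]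
    by_cases h : ∀ i, x ∉ G.region i
    · simp [h]
    · push Not at h
      obtain ⟨i, hi⟩ := h
      exact ⟨fun h => h.elim (fun h => h.choose_spec.1) fun h => h.1, fun hx => Or.inl ⟨i, hx, hi⟩⟩
  · rw [Finset.disjoint_left]
    intro x hx hx'
    simp only [Finset.mem_biUnion, Finset.mem_univ, Finset.mem_filter, true_and] at hx hx'
    obtain ⟨i, -, hi⟩ := hx
    exact hx'.2 i hi

lemma sum_le_card_of_le_regionCard (hG : G.IsCactus) {b : V ⊕ G.Subgraph → ℕ}
    (hb : ∀ i, b i ≤ G.regionCard S i) : ∑ i, b i ≤ S.card := by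
  classical
  have := sum_regionCard_add hG S
  have := Finset.sum_le_sum fun i (_ : i ∈ Finset.univ) => hb i
  omega

/-- The regions are disjoint, so a set no larger than the sum of the bounds has no slack in any
region and no vertex outside them. -/
lemma eq_regionCard_of_card_le (hG : G.IsCactus) {b : V ⊕ G.Subgraph → ℕ}
    (hb : ∀ i, b i ≤ G.regionCard S i) (hle : S.card ≤ ∑ i, b i) :
    (∀ i, G.regionCard S i = b i) ∧ ∀ x ∈ S, ∃ i, x ∈ G.region i := by
  classical
  have h1 := sum_regionCard_add hG S
  have h2 := Finset.sum_le_sum fun i (_ : i ∈ Finset.univ) => hb i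
  constructor
  · intro i
    exact ((Finset.sum_eq_sum_iff_of_le fun i _ => hb i).1 (by omega) i (Finset.mem_univ i)).symm
  · have h3 : (S.filter fun x => ∀ i, x ∉ G.region i).card = 0 := by omega
    intro x hx
    by_contra! hno
    exact Finset.notMem_empty x (Finset.card_eq_zero.1 h3 ▸ Finset.mem_filter.2 ⟨hx, hno⟩)

lemma ncard_nonfree_le_regionCard {v : V} (hv : G.IsJunction v) :
    {P | G.IsThread v P ∧ ¬ G.IsFreeThread S v P}.ncard ≤ G.regionCard S (.inl v) := by
  classical
  have hex : ∀ P, ∃ x, (G.IsThread v P ∧ ¬ G.IsFreeThread S v P) → x ∈ P ∧ x ∈ S := by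
    intro P
    by_cases h : G.IsThread v P ∧ ¬ G.IsFreeThread S v P
    · have : ∃ x ∈ P, x ∈ S := by
        by_contra! hno
        exact h.2 ⟨h.1, hno⟩
      obtain ⟨x, hx⟩ := this
      exact ⟨x, fun _ => hx⟩
    · exact ⟨v, fun h' => absurd h' h⟩
  choose x hx using hex
  rw [regionCard, ← Set.ncard_coe_finset]
  refine Set.ncard_le_ncard_of_injOn x (fun P hP => ?_) (fun P hP Q hQ hPQ => ?_) (Set.toFinite _)
  · simp only [Finset.coe_filter, Set.mem_ofPred_eq]
    exact ⟨(hx P hP).2, hv, P, hP.1, (hx P hP).1⟩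
  · exact (thread_unique hP.1 hQ.1 (hx P hP).1 (hPQ ▸ (hx Q hQ).1)).2

lemma numThreads_le_regionCard_add_one (hS : G.IsBranchResolving S) {v : V} (hv : G.IsJunction v) :
    G.numThreads v ≤ G.regionCard S (.inl v) + 1 := by
  have h1 := ncard_nonfree_le_regionCard (S := S) hv
  have h2 : {P | G.IsFreeThread S v P}.ncard ≤ 1 :=
    (Set.ncard_le_one ((finite_threads v).subset fun P hP => hP.1)).2
      fun P hP Q hQ => hS v P Q hP hQ
  have h3 : {P | G.IsThread v P} ⊆
      {P | G.IsThread v P ∧ ¬ G.IsFreeThread S v P} ∪ {P | G.IsFreeThread S v P} := by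
    intro P hP
    by_cases h : G.IsFreeThread S v P
    · exact Or.inr h
    · exact Or.inl ⟨hP, h⟩
  have h4 := Set.ncard_le_ncard h3 (((finite_threads v).subset fun P hP => hP.1).union
    ((finite_threads v).subset fun P hP => hP.1))
  have h5 := Set.ncard_union_le {P | G.IsThread v P ∧ ¬ G.IsFreeThread S v P}
    {P | G.IsFreeThread S v P}
  rw [numThreads]
  omega

lemma numThreads_le_regionCard {v : V} (hv : G.IsJunction v) (h : ∀ P, ¬ G.IsFreeThread S v P) :
    G.numThreads v ≤ G.regionCard S (.inl v) := by
  refine le_trans (le_of_eq ?_) (ncard_nonfree_le_regionCard (S := S) hv)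
  rw [numThreads]
  congr 1
  ext P
  simp [h]

lemma IsHitting.one_le_regionCard (hS : G.IsHitting S) (hC : G.IsEndCycle C) :
    1 ≤ G.regionCard S (.inr C) := by
  classical
  obtain ⟨s, hs, hsC⟩ := hS.2 C hC
  exact Finset.card_pos.2 ⟨s, Finset.mem_filter.2 ⟨hs, hC, hsC⟩⟩

lemma IsHitting.regionBound_le (hS : G.IsHitting S) (i : V ⊕ G.Subgraph) :
    G.regionBound i ≤ G.regionCard S i := by
  rcases i with v | C
  · simp only [regionBound]
    by_cases h : 1 < G.numThreads v
    · have := numThreads_le_regionCard_add_one hS.1 (isJunction_of_numThreads h)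
      omega
    · omega
  · simp only [regionBound]
    split_ifs with h
    · exact hS.one_le_regionCard h
    · exact Nat.zero_le _

theorem IsHitting.le_card (hG : G.IsCactus) (hS : G.IsHitting S) :
    G.threadExcess + {C | G.IsEndCycle C}.ncard ≤ S.card := by
  rw [← sum_regionBound]
  exact sum_le_card_of_le_regionCard hG hS.regionBound_le

/-- There is a smallest BBR set with prescribed free threads and prescribed vertices in the
private parts of the end-cycles. -/
theorem exists_isSmallestBBR (hG : G.IsCactus) (hc : 2 ≤ G.cycleSubgraphs.ncard)
    (F : V → List V) (hF : ∀ v P, G.IsThread v P → G.IsThread v (F v)) (t : G.Subgraph → V)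
    (ht : ∀ C, G.IsEndCycle C → t C ∈ G.privatePart C) :
    ∃ S, G.IsSmallestBBR S ∧ S.card = G.threadExcess + {C | G.IsEndCycle C}.ncard ∧
      (∀ v P, G.IsFreeThread S v P → P = F v) ∧ ∀ C, G.IsEndCycle C → t C ∈ S := by
  classical
  -- `A` contains the leaf of every thread other than the chosen `F v`. The default value of `headD`
  -- is never used, as threads are not empty.
  set A : Finset V := Finset.univ.biUnion fun v =>
    ((finite_threads (G := G) v).toFinset.erase (F v)).image fun P => P.headD v with hA
  set B : Finset V := (Finset.univ.filter fun C => G.IsEndCycle C).image t with hB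
  have hfree : ∀ v P, G.IsFreeThread (A ∪ B) v P → P = F v := by
    intro v P hP
    by_contra hne
    obtain ⟨l, R, rfl, -⟩ := (isThread_iff.1 hP.1).2.exists_cons
    refine hP.2 l (by simp) (Finset.mem_union_left _ ?_)
    rw [hA, Finset.mem_biUnion]
    refine ⟨v, Finset.mem_univ _, Finset.mem_image.2 ⟨l :: R, Finset.mem_erase.2 ⟨hne, ?_⟩, rfl⟩⟩
    simpa using hP.1
  have hend : ∀ C, G.IsEndCycle C → t C ∈ A ∪ B := fun C hC =>
    Finset.mem_union_right _ (Finset.mem_image_of_mem _ (by simpa using hC))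
  have hhit : G.IsHitting (A ∪ B) := by
    refine ⟨fun v P Q hP hQ => (hfree v P hP).trans (hfree v Q hQ).symm, fun C hC => ?_⟩
    exact ⟨t C, hend C hC, ht C hC⟩
  have hcard : (A ∪ B).card ≤ G.threadExcess + {C | G.IsEndCycle C}.ncard := by
    refine (Finset.card_union_le _ _).trans (Nat.add_le_add ?_ ?_)
    · refine Finset.card_biUnion_le.trans ?_
      rw [threadExcess, Finset.sum_filter]
      refine Finset.sum_le_sum fun v _ => Finset.card_image_le.trans ?_
      have hnum : (finite_threads (G := G) v).toFinset.card = G.numThreads v :=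
        (Set.ncard_eq_toFinset_card _ _).symm
      by_cases h : ∃ P, G.IsThread v P
      · obtain ⟨P, hP⟩ := h
        rw [Finset.card_erase_of_mem (by simpa using hF v P hP), hnum]
        split_ifs <;> omega
      · have : (finite_threads (G := G) v).toFinset = ∅ := by
          ext P
          simpa using fun hP => h ⟨P, hP⟩
        simp [this]
    · refine Finset.card_image_le.trans (le_of_eq ?_)
      rw [← Set.ncard_coe_finset]
      congr 1
      ext
      simp
  have hge := hhit.le_card hG
  exact ⟨A ∪ B, ⟨hhit.isBBR hG hc, fun T hT => hcard.trans (hT.isHitting.le_card hG)⟩,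
    le_antisymm hcard hge, hfree, hend⟩

lemma exists_threads (G : SimpleGraph V) [DecidableRel G.Adj] :
    ∃ F : V → List V, ∀ v P, G.IsThread v P →
      G.IsThread v (F v) ∧ (F v).length ≤ P.length := by
  classical
  have : ∀ v, ∃ Q, ∀ P, G.IsThread v P → G.IsThread v Q ∧ Q.length ≤ P.length := by
    intro v
    by_cases h : ∃ P, G.IsThread v P
    · obtain ⟨Q, hQ, hmin⟩ := Set.exists_min_image _ List.length (finite_threads (G := G) v) h
      exact ⟨Q, fun P hP => ⟨hQ, hmin P hP⟩⟩
    · exact ⟨[], fun P hP => absurd ⟨P, hP⟩ h⟩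
  choose F hF using this
  exact ⟨F, hF⟩

lemma exists_mem_privatePart [Nonempty V] (p : G.Subgraph → V → Prop)
    (hp : ∀ C, G.IsEndCycle C → ∃ x ∈ G.privatePart C, p C x) :
    ∃ t : G.Subgraph → V, ∀ C, G.IsEndCycle C → t C ∈ G.privatePart C ∧ p C (t C) := by
  classical
  have : ∀ C : G.Subgraph, ∃ x, G.IsEndCycle C → x ∈ G.privatePart C ∧ p C x := by
    intro C
    by_cases h : G.IsEndCycle C
    · obtain ⟨x, hx⟩ := hp C h
      exact ⟨x, fun _ => hx⟩
    · exact ⟨Classical.arbitrary V, fun h' => absurd h' h⟩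
  choose t ht using this
  exact ⟨t, ht⟩

theorem IsSmallestBBR.card_eq (hG : G.IsCactus) (hc : 2 ≤ G.cycleSubgraphs.ncard)
    (hS : G.IsSmallestBBR S) : S.card = G.threadExcess + {C | G.IsEndCycle C}.ncard := by
  have := hG.1.nonempty
  obtain ⟨F, hF⟩ := exists_threads G
  obtain ⟨t, ht⟩ := exists_mem_privatePart (G := G) (fun _ _ => True) fun C hC =>
    hC.exists_mem_privatePart.imp fun x hx => ⟨hx, trivial⟩
  obtain ⟨T, hT, hcard, -⟩ := exists_isSmallestBBR hG hc F (fun v P hP => (hF v P hP).1) t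
    fun C hC => (ht C hC).1
  exact le_antisymm ((hS.2 T hT.1).trans hcard.le) (hS.1.isHitting.le_card hG)

theorem IsSmallestBBR.regionCard_eq (hG : G.IsCactus) (hc : 2 ≤ G.cycleSubgraphs.ncard)
    (hS : G.IsSmallestBBR S) :
    (∀ i, G.regionCard S i = G.regionBound i) ∧ ∀ x ∈ S, ∃ i, x ∈ G.region i :=
  eq_regionCard_of_card_le hG hS.1.isHitting.regionBound_le
    (by rw [sum_regionBound, hS.card_eq hG hc])

lemma notMem_of_mem_privatePart (hG : G.IsCactus) (hS : ∀ x ∈ S, ∃ i, x ∈ G.region i)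
    (hC : C ∈ G.cycleSubgraphs) (hCe : ¬ G.IsEndCycle C) {x : V} (hx : x ∈ G.privatePart C) :
    x ∉ S := by
  intro hxS
  obtain ⟨i, hi⟩ := hS x hxS
  obtain rfl := eq_of_mem_region hG hC hx hi
  exact hCe hi.1

/-- Two sets with the same single vertex in the private part of an end-cycle. -/
lemma mem_iff_of_regionCard {t : V} (hC : G.IsEndCycle C) (ht : t ∈ G.privatePart C)
    (htS : t ∈ S) (hS : G.regionCard S (.inr C) = 1) {x : V} (hx : x ∈ G.privatePart C) :
    x ∈ S ↔ x = t := by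
  classical
  refine ⟨fun hxS => ?_, fun h => h ▸ htS⟩
  exact Finset.card_le_one.1 hS.le x (Finset.mem_filter.2 ⟨hxS, hC, hx⟩) t
    (Finset.mem_filter.2 ⟨htS, hC, ht⟩)

lemma IsHitting.isSActive_congr (hG : G.IsCactus) (hc : 2 ≤ G.cycleSubgraphs.ncard)
    (hS : G.IsHitting S) (hT : G.IsHitting T) (hC : C ∈ G.cycleSubgraphs)
    (h : ∀ x ∈ G.privatePart C, x ∈ S ↔ x ∈ T) (x : V) :
    G.IsSActive S C x ↔ G.IsSActive T C x := by
  by_cases hx : G.IsBranchActive C x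
  · exact iff_of_true (hS.isSActive hG hc hC hx) (hT.isSActive hG hc hC hx)
  · constructor <;> rintro ⟨hxC, s, hs, hsx⟩
    · exact ⟨hxC, s, (h s ⟨x, hxC, hx, hsx⟩).1 hs, hsx⟩
    · exact ⟨hxC, s, (h s ⟨x, hxC, hx, hsx⟩).2 hs, hsx⟩

/-- Configurations carry over between two sets with the same active vertices if this is so for
the free threads that hang at the branch-active and edge-critical vertices of the cycle. -/
theorem IsHitting.containsADE (hG : G.IsCactus) (hc : 2 ≤ G.cycleSubgraphs.ncard)
    (hS : G.IsHitting S) (hT : G.IsHitting T) (hC : C ∈ G.cycleSubgraphs)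
    (h : ∀ x ∈ G.privatePart C, x ∈ S ↔ x ∈ T)
    (hth : ∀ v P, G.IsBranchActive C v → G.IsEdgeCritical T C v → G.IsFreeThread S v P →
      ∃ Q, G.IsFreeThread T v Q ∧ P.length ≤ Q.length) (hADE : G.ContainsADE S C) :
    G.ContainsADE T C := by
  refine hADE.mono hG hC (hS.isSActive_congr hG hc hT hC h) fun v P hv hP => ?_
  by_cases hvb : G.IsBranchActive C v
  · exact hth v P hvb hv hP
  · refine ⟨P, ⟨hP.1, fun x hx hxT => hP.2 x hx ((h x ⟨v, hv.isSActive.1, hvb, ?_⟩).2 hxT)⟩, le_rfl⟩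
    exact ((isThread_iff.1 hP.1).2.mem_hangingPart_iff hC hx).2 (mem_hangingPart_self C v)

end Regions

/-! ### Existence of nice sets, and the lower bound for generators -/

section Nice

variable {V : Type*} [Fintype V] {G : SimpleGraph V} [DecidableRel G.Adj] {C C' : G.Subgraph}
  {S T : Finset V}

/-- The witnesses `W C` of the ADE-negative cycles are merged. On the private part of an end-cycle
`C` the vertex of `W C` is used, and at every vertex a shortest thread is left free. Up to the
length of free threads, `C` cannot tell the result from `W C`, and shorter free threads do not help
E. -/
lemma exists_isADEAvoiding (hG : G.IsCactus) (hc : 2 ≤ G.cycleSubgraphs.ncard) :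
    ∃ S, G.IsADEAvoiding S := by
  classical
  have := hG.1.nonempty
  have hW : ∀ C : G.Subgraph, ∃ W, G.IsADENegative C →
      G.IsSmallestBBR W ∧ ¬ G.ContainsADE W C := by
    intro C
    by_cases h : G.IsADENegative C
    · obtain ⟨W, hW⟩ := h.2
      exact ⟨W, fun _ => hW⟩
    · exact ⟨∅, fun h' => absurd h' h⟩
  choose W hW using hW
  obtain ⟨F, hF⟩ := exists_threads G
  obtain ⟨t, ht⟩ := exists_mem_privatePart (G := G) (fun C x => G.IsADENegative C → x ∈ W C) (by
    intro C hC
    by_cases h : G.IsADENegative C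
    · obtain ⟨s, hs, hsC⟩ := (hW C h).1.1.isHitting.2 C hC
      exact ⟨s, hsC, fun _ => hs⟩
    · exact hC.exists_mem_privatePart.imp fun x hx => ⟨hx, fun h' => absurd h' h⟩)
  obtain ⟨S, hS, -, hfree, hend⟩ := exists_isSmallestBBR hG hc F (fun v P hP => (hF v P hP).1) t
    fun C hC => (ht C hC).1
  refine ⟨S, hS, fun C hC hADE => ?_⟩
  obtain ⟨hWC, hno⟩ := hW C hC
  have hSr := hS.regionCard_eq hG hc
  have hWr := hWC.regionCard_eq hG hc
  refine hno (hS.1.isHitting.containsADE hG hc hWC.1.isHitting hC.1 (fun x hx => ?_) ?_ hADE)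
  · by_cases hCe : G.IsEndCycle C
    · rw [mem_iff_of_regionCard hCe (ht C hCe).1 (hend C hCe) (by simp [hSr.1, regionBound, hCe]) hx,
        mem_iff_of_regionCard hCe (ht C hCe).1 ((ht C hCe).2 hC)
          (by simp [hWr.1, regionBound, hCe]) hx]
    · exact iff_of_false (notMem_of_mem_privatePart hG hSr.2 hC.1 hCe hx)
        (notMem_of_mem_privatePart hG hWr.2 hC.1 hCe hx)
  · intro v P hv _ hP
    obtain rfl := hfree v P hP
    have hj := isJunction_of_isBranchActive hG hC.1 hv
    have hpos : 0 < G.numThreads v := (Set.ncard_pos (finite_threads v)).2 ⟨_, hP.1⟩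
    -- The smallest set `W C` spends one vertex less than the number of threads on the threads at
    -- `v`.
    have : ∃ Q, G.IsFreeThread (W C) v Q := by
      by_contra! hno
      have h1 := numThreads_le_regionCard hj hno
      rw [hWr.1, regionBound] at h1
      omega
    obtain ⟨Q, hQ⟩ := this
    exact ⟨Q, hQ, (hF v Q hQ.1).2⟩

lemma exists_isNiceBBR (hG : G.IsCactus) (hc : 2 ≤ G.cycleSubgraphs.ncard) :
    ∃ S, G.IsNiceBBR S := by
  obtain ⟨S, hS, hmin⟩ := Set.exists_min_image {S | G.IsADEAvoiding S}
    (fun S => (G.edgeCriticalIncidence S).edgeSet.ncard) (Set.toFinite _)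
    (exists_isADEAvoiding hG hc)
  exact ⟨S, hS, hmin⟩

/-- An end-cycle whose private part contains exactly one vertex of `T`. -/
def IsSparse (G : SimpleGraph V) [DecidableRel G.Adj] (T : Finset V) (C : G.Subgraph) : Prop :=
  G.IsEndCycle C ∧ G.regionCard T (.inr C) = 1

/-- Threads hang at the junction `v`, but none of them is `T`-free. -/
def IsSaturated (G : SimpleGraph V) [DecidableRel G.Adj] (T : Finset V) (v : V) : Prop :=
  G.IsJunction v ∧ (∃ P, G.IsThread v P) ∧ ∀ P, ¬ G.IsFreeThread T v P

lemma IsSparse.exists_mem (hC : IsSparse G T C) : ∃ t ∈ T, t ∈ G.privatePart C := by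
  classical
  obtain ⟨t, ht⟩ := Finset.card_pos.1 (show 0 < G.regionCard T (.inr C) by rw [hC.2]; exact one_pos)
  rw [Finset.mem_filter] at ht
  exact ⟨t, ht.1, ht.2.2⟩

/-- A sparse cycle has exactly two active vertices, its branch-active vertex and one in the private
part, and a generator avoids A. -/
lemma IsSparse.isEdgeCritical (hG : G.IsCactus) (hc : 2 ≤ G.cycleSubgraphs.ncard)
    (hT : G.IsEdgeMetricGenerator T) (hC : IsSparse G T C) {x : V} (hx : G.IsBranchActive C x) :
    G.IsEdgeCritical T C x := by
  have hB := hT.isBBR hG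
  obtain ⟨t, htT, htC⟩ := hC.exists_mem
  obtain ⟨y, hy, huniq⟩ := hC.1.exists_unique
  have htC' := htC
  obtain ⟨u, hu, hub, htu⟩ := htC'
  have hsub : {v | G.IsSActive T C v} ⊆ {y, u} := by
    rintro v ⟨hv, s, hs, hsv⟩
    by_cases hvb : G.IsBranchActive C v
    · exact Or.inl (huniq v hvb)
    · have := (mem_iff_of_regionCard hC.1 htC htT hC.2 ⟨v, hv, hvb, hsv⟩).1 hs
      subst this
      exact Or.inr (hangingPart_unique hG hC.1.1 hv hu hsv htu)
  have h2 : G.numSActive T C = 2 := by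
    refine le_antisymm ?_ (hB.1 C hC.1.1)
    exact (Set.ncard_le_ncard hsub (Set.toFinite _)).trans ((Set.ncard_insert_le _ _).trans (by simp))
  exact isEdgeCritical_of_numSActive_eq_two hG hC.1.1 h2 (hT.not_containsADE hG C)
    (hB.isHitting.isSActive hG hc hC.1.1 hx)

lemma IsSparse.eq (hG : G.IsCactus) (hc : 2 ≤ G.cycleSubgraphs.ncard)
    (hT : G.IsEdgeMetricGenerator T) (hC : IsSparse G T C) (hC' : IsSparse G T C') {x : V}
    (hx : G.IsBranchActive C x) (hx' : G.IsBranchActive C' x) : C = C' := by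
  by_contra hne
  exact hT.not_incident hG C C' ⟨hne, hC.1.1, hC'.1.1, x, hx.1, hx'.1,
    hC.isEdgeCritical hG hc hT hx, hC'.isEdgeCritical hG hc hT hx'⟩

lemma exists_free_threads (G : SimpleGraph V) [DecidableRel G.Adj] (T : Finset V) :
    ∃ F : V → List V, (∀ v P, G.IsThread v P → G.IsThread v (F v)) ∧
      ∀ v P, G.IsFreeThread T v P → G.IsFreeThread T v (F v) := by
  classical
  have : ∀ v, ∃ Q, (∀ P, G.IsThread v P → G.IsThread v Q) ∧
      ∀ P, G.IsFreeThread T v P → G.IsFreeThread T v Q := by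
    intro v
    by_cases h : ∃ P, G.IsFreeThread T v P
    · obtain ⟨Q, hQ⟩ := h
      exact ⟨Q, fun P _ => hQ.1, fun P _ => hQ⟩
    · by_cases h' : ∃ P, G.IsThread v P
      · obtain ⟨Q, hQ⟩ := h'
        exact ⟨Q, fun P _ => hQ, fun P hP => absurd ⟨P, hP⟩ h⟩
      · exact ⟨[], fun P hP => absurd ⟨P, hP⟩ h', fun P hP => absurd ⟨P, hP⟩ h⟩
  choose F hF using this
  exact ⟨F, fun v => (hF v).1, fun v => (hF v).2⟩

/-- A smallest BBR set that follows a hitting set as closely as possible. -/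
lemma IsHitting.exists_isSmallestBBR (hG : G.IsCactus) (hc : 2 ≤ G.cycleSubgraphs.ncard)
    (hT : G.IsHitting T) : ∃ S, G.IsSmallestBBR S ∧
      (∀ v P Q, G.IsFreeThread S v P → G.IsFreeThread T v Q → G.IsFreeThread T v P) ∧
      ∀ C, G.IsEndCycle C → ∃ x ∈ G.privatePart C, x ∈ S ∧ x ∈ T := by
  have := hG.1.nonempty
  obtain ⟨F, hF, hFT⟩ := exists_free_threads G T
  obtain ⟨t, ht⟩ := exists_mem_privatePart (G := G) (fun C x => x ∈ T) fun C hC => by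
    obtain ⟨s, hs, hsC⟩ := hT.2 C hC
    exact ⟨s, hsC, hs⟩
  obtain ⟨S, hS, -, hfree, hend⟩ := SimpleGraph.exists_isSmallestBBR hG hc F hF t
    fun C hC => (ht C hC).1
  refine ⟨S, hS, fun v P Q hP hQ => ?_, fun C hC => ⟨t C, (ht C hC).1, hend C hC, (ht C hC).2⟩⟩
  rw [hfree v P hP]
  exact hFT v Q hQ

/-- An ADE-positive sparse cycle. -/
lemma IsSparse.isSaturated (hG : G.IsCactus) (hc : 2 ≤ G.cycleSubgraphs.ncard)
    (hT : G.IsEdgeMetricGenerator T) (hC : IsSparse G T C) (hpos : G.IsADEPositive C) {x : V}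
    (hx : G.IsBranchActive C x) : IsSaturated G T x := by
  have hTh := (hT.isBBR hG).isHitting
  obtain ⟨S, hS, hfree, hend⟩ := hTh.exists_isSmallestBBR hG hc
  have hADE : G.ContainsADE S C := by
    by_contra h
    exact hpos.2 ⟨hC.1.1, S, hS, h⟩
  have hSr := hS.regionCard_eq hG hc
  have hj := isJunction_of_isBranchActive hG hC.1.1 hx
  obtain ⟨y, hy, huniq⟩ := hC.1.exists_unique
  obtain ⟨t, htC, htS, htT⟩ := hend C hC.1
  -- If `x` is not saturated, `T` leaves a thread free at `x` whenever `S` does, and `S` then leaves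
  -- a `T`-free one. So the configuration passes from `S` to `T`.
  by_contra hsat
  refine hT.not_containsADE hG C (hS.1.isHitting.containsADE hG hc hTh hC.1.1 (fun z hz => ?_) ?_
    hADE)
  · rw [mem_iff_of_regionCard hC.1 htC htS (by simp [hSr.1, regionBound, hC.1]) hz,
      mem_iff_of_regionCard hC.1 htC htT hC.2 hz]
  · intro v P hv _ hP
    obtain rfl := (huniq v hv).trans (huniq x hx).symm
    have : ∃ Q, G.IsFreeThread T v Q := by
      by_contra! hno
      exact hsat ⟨hj, ⟨P, hP.1⟩, hno⟩
    obtain ⟨Q, hQ⟩ := this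
    exact ⟨P, hfree v P Q hP hQ, le_rfl⟩

open Classical in
/-- A refinement of the number of vertices that `T` has to have in a region. -/
noncomputable def refinedBound (G : SimpleGraph V) [DecidableRel G.Adj] (T : Finset V) :
    V ⊕ G.Subgraph → ℕ
  | .inl v => if IsSaturated G T v then 1 else 0
  | .inr C => if G.IsEndCycle C ∧ ¬ IsSparse G T C then 1 else 0

lemma IsHitting.regionBound_add_le (hT : G.IsHitting T) (i : V ⊕ G.Subgraph) :
    G.regionBound i + refinedBound G T i ≤ G.regionCard T i := by
  have h := hT.regionBound_le i
  rcases i with v | C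
  · simp only [refinedBound]
    split_ifs with hv
    · have h1 := numThreads_le_regionCard hv.1 hv.2.2
      have h2 : 0 < G.numThreads v := (Set.ncard_pos (finite_threads v)).2 hv.2.1
      simp only [regionBound]
      omega
    · exact h
  · simp only [refinedBound]
    split_ifs with hC
    · have h1 := hT.one_le_regionCard hC.1
      have h2 : G.regionCard T (.inr C) ≠ 1 := fun h => hC.2 ⟨hC.1, h⟩
      simp only [regionBound, hC.1, if_true]
      omega
    · exact h

lemma sum_refinedBound : ∑ i, refinedBound G T i =
    {v | IsSaturated G T v}.ncard + {C | G.IsEndCycle C ∧ ¬ IsSparse G T C}.ncard := by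
  classical
  rw [Fintype.sum_sum_type]
  simp only [refinedBound]
  rw [← Finset.card_filter, ← Finset.card_filter, ← Set.ncard_coe_finset, ← Set.ncard_coe_finset]
  congr 2 <;> ext <;> simp

lemma ncard_isEndCycle : {C | G.IsEndCycle C}.ncard =
    {C | IsSparse G T C}.ncard + {C | G.IsEndCycle C ∧ ¬ IsSparse G T C}.ncard := by
  rw [← Set.ncard_union_eq (Set.disjoint_left.2 fun C h h' => h'.2 h)]
  congr 1
  ext C
  simp only [Set.mem_ofPred_eq, Set.mem_union]
  exact ⟨fun h => (em _).imp id fun h' => ⟨h, h'⟩, fun h => h.elim (·.1) (·.1)⟩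

lemma exists_branchActive_map [Nonempty V] (G : SimpleGraph V) [DecidableRel G.Adj] :
    ∃ x : G.Subgraph → V, ∀ C, G.IsEndCycle C → G.IsBranchActive C (x C) := by
  classical
  have : ∀ C : G.Subgraph, ∃ x, G.IsEndCycle C → G.IsBranchActive C x := by
    intro C
    by_cases h : G.IsEndCycle C
    · obtain ⟨x, hx, -⟩ := h.exists_unique
      exact ⟨x, fun _ => hx⟩
    · exact ⟨Classical.arbitrary V, fun h' => absurd h' h⟩
  choose x hx using this
  exact ⟨x, hx⟩

lemma IsEdgeMetricGenerator.injOn_sparse (hG : G.IsCactus) (hc : 2 ≤ G.cycleSubgraphs.ncard)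
    (hT : G.IsEdgeMetricGenerator T) {x : G.Subgraph → V}
    (hx : ∀ C, G.IsEndCycle C → G.IsBranchActive C (x C)) :
    Set.InjOn x {C | IsSparse G T C ∧ G.IsADEPositive C} := fun C hC C' hC' h =>
  hC.1.eq hG hc hT hC'.1 (hx C hC.1.1) (h ▸ hx C' hC'.1.1)

/-- Each such cycle saturates its branch-active vertex, and no two of them share it. -/
lemma IsEdgeMetricGenerator.ncard_sparse_le (hG : G.IsCactus) (hc : 2 ≤ G.cycleSubgraphs.ncard)
    (hT : G.IsEdgeMetricGenerator T) :
    {C | IsSparse G T C ∧ G.IsADEPositive C}.ncard ≤ {v | IsSaturated G T v}.ncard := by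
  have := hG.1.nonempty
  obtain ⟨x, hx⟩ := exists_branchActive_map G
  exact Set.ncard_le_ncard_of_injOn x (fun C hC => hC.1.isSaturated hG hc hT hC.2 (hx C hC.1.1))
    (hT.injOn_sparse hG hc hx) (Set.toFinite _)

/-- Beyond `L(G) + m`, where `m` counts the end-cycles, `T` has a vertex for every end-cycle that is
not sparse and for every saturated vertex. The latter pay for the ADE-positive sparse cycles. -/
theorem IsEdgeMetricGenerator.le_card_add (hG : G.IsCactus) (hc : 2 ≤ G.cycleSubgraphs.ncard)
    (hT : G.IsEdgeMetricGenerator T) : G.threadExcess + 2 * {C | G.IsEndCycle C}.ncard ≤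
      T.card + {C | IsSparse G T C ∧ G.IsADENegative C}.ncard := by
  have h1 := sum_le_card_of_le_regionCard hG (hT.isBBR hG).isHitting.regionBound_add_le
  rw [Finset.sum_add_distrib, sum_regionBound, sum_refinedBound] at h1
  have h2 := ncard_isEndCycle (G := G) (T := T)
  have h3 := hT.ncard_sparse_le hG hc
  have h4 : {C | IsSparse G T C} ⊆ {C | IsSparse G T C ∧ G.IsADEPositive C} ∪
      {C | IsSparse G T C ∧ G.IsADENegative C} := by
    intro C hC
    by_cases h : G.IsADENegative C
    · exact Or.inr ⟨hC, h⟩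
    · exact Or.inl ⟨hC, hC.1.1, h⟩
  have h5 := (Set.ncard_le_ncard h4 (Set.toFinite _)).trans (Set.ncard_union_le _ _)
  omega

/-- If all cycles are ADE-positive and some cycle is not an end-cycle, the lower bound is
not attained. -/
theorem IsEdgeMetricGenerator.lt_card (hG : G.IsCactus) (hc : 2 ≤ G.cycleSubgraphs.ncard)
    (hT : G.IsEdgeMetricGenerator T) (hpos : ∀ C ∈ G.cycleSubgraphs, G.IsADEPositive C)
    (hC : C ∈ G.cycleSubgraphs) (hCe : ¬ G.IsEndCycle C) :
    G.threadExcess + 2 * {C | G.IsEndCycle C}.ncard < T.card := by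
  have := hG.1.nonempty
  obtain ⟨x, hx⟩ := exists_branchActive_map G
  by_contra! hle
  have hTh := (hT.isBBR hG).isHitting
  have h2 := ncard_isEndCycle (G := G) (T := T)
  have h3 := hT.ncard_sparse_le hG hc
  have h4 : {C | IsSparse G T C ∧ G.IsADEPositive C} = {C | IsSparse G T C} := by
    ext C
    exact ⟨fun h => h.1, fun h => ⟨h, hpos C h.1.1⟩⟩
  have h1 := sum_le_card_of_le_regionCard hG hTh.regionBound_add_le
  -- In case of equality `T` has no vertex outside the regions, in particular none in the private
  -- part of `C`.
  have htight := (eq_regionCard_of_card_le hG hTh.regionBound_add_le (by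
    rw [Finset.sum_add_distrib, sum_regionBound, sum_refinedBound]
    rw [h4] at h3
    omega)).2
  rw [Finset.sum_add_distrib, sum_regionBound, sum_refinedBound] at h1
  -- Equality also means that every saturated vertex is paid for by a sparse cycle.
  have himage : x '' {C | IsSparse G T C} = {v | IsSaturated G T v} := by
    refine Set.eq_of_subset_of_ncard_le ?_ ?_ (Set.toFinite _)
    · rintro _ ⟨C, hC, rfl⟩
      exact hC.isSaturated hG hc hT (hpos C hC.1.1) (hx C hC.1)
    · rw [Set.InjOn.ncard_image (h4 ▸ hT.injOn_sparse hG hc hx)]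
      omega
  obtain ⟨S, hS, hfree, hend⟩ := hTh.exists_isSmallestBBR hG hc
  have hADE : G.ContainsADE S C := by
    by_contra h
    exact (hpos C hC).2 ⟨hC, S, hS, h⟩
  have hSr := hS.regionCard_eq hG hc
  refine hT.not_containsADE hG C (hS.1.isHitting.containsADE hG hc hTh hC (fun z hz => ?_) ?_ hADE)
  · exact iff_of_false (notMem_of_mem_privatePart hG hSr.2 hC hCe hz)
      (notMem_of_mem_privatePart hG htight hC hCe hz)
  · intro v P hv hvc hP
    have : ∃ Q, G.IsFreeThread T v Q := by
      by_contra! hno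
      have hsat : v ∈ {v | IsSaturated G T v} :=
        ⟨isJunction_of_isBranchActive hG hC hv, ⟨P, hP.1⟩, hno⟩
      rw [← himage] at hsat
      obtain ⟨C', hC', rfl⟩ := hsat
      -- Without a `T`-free thread, the vertex `v` would be the branch-active vertex of a sparse
      -- cycle and edge-critical on that cycle and on `C`.
      refine hT.not_incident hG C C' ⟨fun h => hCe (h ▸ hC'.1), hC, hC'.1.1, x C', hv.1,
        (hx C' hC'.1).1, hvc, hC'.isEdgeCritical hG hc hT (hx C' hC'.1)⟩
    obtain ⟨Q, hQ⟩ := this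
    exact ⟨P, hfree v P Q hP hQ, le_rfl⟩

end Nice

/-! ### The upper bound and the characterisation -/

section Dimension

variable {V : Type*} [Fintype V] {G : SimpleGraph V} [DecidableRel G.Adj] {C C' : G.Subgraph}
  {S : Finset V}

lemma edgeMetricDim_le {T : Finset V} (hT : G.IsEdgeMetricGenerator T) :
    G.edgeMetricDim ≤ T.card := Nat.sInf_le ⟨T, hT, rfl⟩

lemma IsEdgeMetricGenerator.exists_card_eq {T : Finset V} (hT : G.IsEdgeMetricGenerator T) :
    ∃ T : Finset V, G.IsEdgeMetricGenerator T ∧ T.card = G.edgeMetricDim :=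
  Nat.sInf_mem (s := {n | ∃ S : Finset V, G.IsEdgeMetricGenerator S ∧ S.card = n}) ⟨_, T, hT, rfl⟩

/-- An upper bound for the edge metric dimension: it suffices to enlarge `S` on all cycles but
the pairwise non-incident ADE-negative cycles in `Y`. -/
theorem IsADEAvoiding.exists_isEdgeMetricGenerator (hG : G.IsCactus)
    (hc : 2 ≤ G.cycleSubgraphs.ncard) (hS : G.IsADEAvoiding S) (Y : Set G.Subgraph)
    (hY : ∀ C ∈ Y, G.IsADENegative C)
    (hYp : Y.Pairwise fun C C' => ¬ (G.edgeCriticalIncidence S).Adj C C') :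
    ∃ T : Finset V, G.IsEdgeMetricGenerator T ∧ T.card + Y.ncard ≤
      G.threadExcess + {C | G.IsEndCycle C}.ncard + G.cycleSubgraphs.ncard := by
  classical
  obtain ⟨T, hT, hcard⟩ := hS.1.1.exists_isEdgeMetricGenerator hG hc
    (Finset.univ.filter fun C => C ∈ G.cycleSubgraphs ∧ C ∉ Y)
    (fun C hC => (Finset.mem_filter.1 hC).2.1)
    (fun C hC hCX => hS.2 C (hY C (by_contra fun h => hCX (by simp [hC, h]))))
    (fun C C' hCX hCX' hadj => by
      have h1 : C ∈ Y := by_contra fun h => hCX (by simp [hadj.2.1, h])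
      have h2 : C' ∈ Y := by_contra fun h => hCX' (by simp [hadj.2.2.1, h])
      exact hYp h1 h2 hadj.ne hadj)
  refine ⟨T, hT, ?_⟩
  rw [hS.1.card_eq hG hc] at hcard
  have h1 : (Finset.univ.filter fun C => C ∈ G.cycleSubgraphs ∧ C ∉ Y).card =
      (G.cycleSubgraphs \ Y).ncard := by
    rw [← Set.ncard_coe_finset]
    congr 1
    ext
    simp
  have h2 := Set.ncard_sdiff_add_ncard_of_subset (s := Y) (t := G.cycleSubgraphs)
    fun C hC => (hY C hC).1
  omega

end Dimension

end SimpleGraph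

theorem mainTheorem6 {V : Type*} [Fintype V] (G : SimpleGraph V) [DecidableRel G.Adj]
    (hG : G.IsCactus) (c : ℕ) (hc : G.cycleSubgraphs.ncard = c) (hc2 : 2 ≤ c) :
    (∃ S : Finset V, G.IsNiceBBR S) ∧
    ∀ S : Finset V, G.IsNiceBBR S →
      (G.edgeMetricDim = G.threadExcess + 2 * c - 1 ↔
        ((∀ C ∈ G.cycleSubgraphs, G.IsEndCycle C) ∧
            {C | G.IsADEPositive C}.ncard ≤ c - 1 ∧
            {C ∈ G.cycleSubgraphs | ¬ G.IsADEPositive C}.Pairwise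
              (G.edgeCriticalIncidence S).Adj) ∨
          ({C | G.IsEndCycle C}.ncard = c - 1 ∧
            ∀ C ∈ G.cycleSubgraphs, G.IsADEPositive C)) := by
  have hc2' : 2 ≤ G.cycleSubgraphs.ncard := hc ▸ hc2
  refine ⟨SimpleGraph.exists_isNiceBBR hG hc2', fun S hS => ?_⟩
  have hneg : ∀ C ∈ G.cycleSubgraphs, ¬ G.IsADEPositive C → G.IsADENegative C :=
    fun C hC h => by_contra fun h' => h ⟨hC, h'⟩
  have hup := fun Y => hS.1.exists_isEdgeMetricGenerator hG hc2' Y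
  obtain ⟨T₀, hT₀, h₀⟩ := hup ∅ (by simp) (by simp)
  obtain ⟨T, hT, hTdim⟩ := hT₀.exists_card_eq
  have hsub : {C | G.IsEndCycle C} ⊆ G.cycleSubgraphs := fun C hC => hC.1
  have hEc := Set.ncard_le_ncard hsub (Set.toFinite _)
  have hall : {C | G.IsEndCycle C}.ncard = c → ∀ C ∈ G.cycleSubgraphs, G.IsEndCycle C := by
    intro h C hC
    rw [← Set.eq_of_subset_of_ncard_le hsub (by omega) (Set.toFinite _)] at hC
    exact hC
  have hall' : (∀ C ∈ G.cycleSubgraphs, G.IsEndCycle C) → {C | G.IsEndCycle C}.ncard = c := by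
    intro h
    rw [← hc]
    exact congrArg Set.ncard (hsub.antisymm h)
  -- A single ADE-negative cycle need not be made wide, which saves one vertex.
  have hsingle : ∀ C, G.IsADENegative C →
      G.edgeMetricDim + 1 ≤ G.threadExcess + {C | G.IsEndCycle C}.ncard + c := by
    intro C hC
    obtain ⟨T₁, hT₁, h₁⟩ := hup {C} (by simpa using hC) (by simp)
    rw [Set.ncard_singleton] at h₁
    have := SimpleGraph.edgeMetricDim_le hT₁
    omega
  have hdim₀ := SimpleGraph.edgeMetricDim_le hT₀
  rw [Set.ncard_empty] at h₀
  have hlow := hT.le_card_add hG hc2'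
  constructor
  · intro hdim
    by_cases hE : {C | G.IsEndCycle C}.ncard = c
    · refine Or.inl ⟨hall hE, ?_, ?_⟩
      · have hle : {C | G.IsADEPositive C} ⊆ G.cycleSubgraphs := fun C hC => hC.1
        have h1 := Set.ncard_le_ncard hle (Set.toFinite _)
        by_contra hlt
        have heq := Set.eq_of_subset_of_ncard_le hle (by omega) (Set.toFinite _)
        have : {C | G.IsSparse T C ∧ G.IsADENegative C} = ∅ := by
          refine Set.eq_empty_of_forall_notMem fun C hC => ?_
          have := hC.2.1
          rw [← heq] at this
          exact this.2 hC.2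
        rw [this, Set.ncard_empty] at hlow
        omega
      · intro C hC C' hC' hne
        by_contra hadj
        -- Two non-incident ADE-negative cycles would save two vertices.
        obtain ⟨T₁, hT₁, h₁⟩ := hup {C, C'} (by
          rintro D (rfl | rfl)
          · exact hneg _ hC.1 hC.2
          · exact hneg _ hC'.1 hC'.2) (by
          rw [Set.pairwise_pair]
          exact fun _ => ⟨hadj, fun h => hadj h.symm⟩)
        rw [Set.ncard_pair hne] at h₁
        have := SimpleGraph.edgeMetricDim_le hT₁
        omega
    -- The upper bound with nothing saved gives at least `c - 1` end-cycles. With exactly `c - 1` of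
    -- them, an ADE-negative cycle would push the dimension below the required value.
    · refine Or.inr ⟨by omega, fun C hC => ?_⟩
      by_contra hpos
      have := hsingle C (hneg C hC hpos)
      omega
  · rintro (⟨hend, hpos, hpair⟩ | ⟨hE, hpos⟩)
    · have hE := hall' hend
      have hex : ∃ C, G.IsADENegative C := by
        by_contra! hno
        have : {C | G.IsADEPositive C} = G.cycleSubgraphs :=
          Set.Subset.antisymm (fun C hC => hC.1) fun C hC => ⟨hC, hno C⟩
        rw [this] at hpos
        omega
      obtain ⟨C, hC⟩ := hex
      have h1 := hsingle C hC
      -- Incidence with respect to `S` provides a common vertex. It has degree at least four and is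
      -- thus branch-active on both cycles, which sparse cycles of the generator `T` do not allow.
      have h2 : {C | G.IsSparse T C ∧ G.IsADENegative C}.ncard ≤ 1 := by
        refine (Set.ncard_le_one (Set.toFinite _)).2 fun C hC C' hC' => ?_
        by_contra hne
        obtain ⟨-, h1, h2, x, hx, hx', -⟩ := hpair ⟨hC.2.1, fun h => h.2 hC.2⟩
          ⟨hC'.2.1, fun h => h.2 hC'.2⟩ hne
        have hd := SimpleGraph.four_le_degree_of_two_cycles hG h1 h2 hne hx hx'
        exact hne (hC.1.eq hG hc2' hT hC'.1 ⟨hx, Or.inl hd⟩ ⟨hx', Or.inl hd⟩)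
      omega
    · have hex : ∃ C ∈ G.cycleSubgraphs, ¬ G.IsEndCycle C := by
        by_contra! hno
        have := hall' hno
        omega
      obtain ⟨C, hC, hCe⟩ := hex
      have := hT.lt_card hG hc2' hpos hC hCe
      omega
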